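/- Let $D\ge 1$ and let $\mathbb{M}_D$ be the space of complex $D\times D$ matrices, with trace norm $\|A\|=\operatorname{Tr}\sqrt{A^*A}$; let $\mathbb{S}_D$ be the set of positive semidefinite matrices of trace one. Linear maps $\phi:\mathbb{M}_D\to\mathbb{M}_D$ carry the operator norm $\|\phi\|$ induced by the trace norm; $\phi^*$ is the adjoint for $\langle A,B\rangle=\operatorname{Tr}A^*B$, and $v(\phi)=\inf\{\|\phi(X)\|:X\in\mathbb{S}_D\}$. A map is positive if it preserves positive semidefiniteness, and strictly positive if it maps $\mathbb{S}_D$ into the positive definite matrices. Let $(\Omega,\mathcal{F},\mathbb{P})$ be a probability space, $\theta:\Omega\to\Omega$ an invertible (bimeasurable) ergodic measure preserving map, $\varphi_0$ a random variable whose values are positive linear maps on $\mathbb{M}_D$, $\varphi_k=\varphi_0\circ\theta^k$ for $k\in\mathbb{Z}$, and $\Phi^{(n)}=\varphi_n\circ\cdots\circ\varphi_1$. Assume that $\tau=\inf\{n\ge 1:\Phi^{(n+k)}\text{ is strictly positive for all }k\ge 0\}$ is finite almost surely. Let $L_n$ be the left Perron–Frobenius eigenmatrix of $\Phi^{(n)}$,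 that is, the eigenmatrix of $\Phi^{(n)*}$ in $\mathbb{S}_D$ (unique if $\Phi^{(n)}$ is strictly positive). Then $Z_1=\lim_n L_n$ exists almost surely. Put $Z_k=Z_1\circ\theta^{k-1}$, $l=\mathbb{E}[\ln\|\varphi_0^*(Z_1)\|]$ and $\xi_k=\ln\|\varphi_k^*(Z_{k+1})\|-l$. Let $\mathcal{F}_n=\sigma(\varphi_k:k\le n)$ and $\mathcal{F}^n=\sigma(\varphi_k:k\ge n)$ for $n\in\mathbb{Z}$, and $$\alpha_n=\sup_{k\ge 0}\ \sup\{|\mathbb{P}(A\cap B)-\mathbb{P}(A)\mathbb{P}(B)|:A\in\mathcal{F}_k,\ B\in\mathcal{F}^{n+k}\},$$ $$\rho_n=\sup_{k\ge 0}\ \sup\left\{\left|\frac{\operatorname{Cov}(Y,X)}{\sigma(Y)\sigma(X)}\right|:Y\in L^2(\mathcal{F}_k),\ X\in L^2(\mathcal{F}^{n+k}),\ \sigma(X),\sigma(Y)\ne 0\right\}.$$ 1. If $\ln\|\varphi_0^*\|$ and $\ln v(\varphi_0^*)$ are in $L^p$ for some real $p>2$ and $\sum_{n\ge1}\alpha_n^{(p-2)/p}<\infty$,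 then, with $\frac1p+\frac1q=1$, $\xi_0\in L^p$ and $$\sum_{n=1}^\infty\big\|\mathbb{E}[\xi_0\mid\mathcal{F}^n]\big\|_{q}<\infty.$$ 2. If $\ln\|\varphi_0^*\|$ and $\ln v(\varphi_0^*)$ are in $L^2$ and $\sum_{n\ge1}\rho_n<\infty$, then $\xi_0\in L^2$ and $$\sum_{n=1}^\infty\big\|\mathbb{E}[\xi_0\mid\mathcal{F}^n]\big\|_{2}<\infty.$$ -/

import Mathlib

open MeasureTheory ProbabilityTheory Filter Topology
open scoped Matrix MatrixOrder ComplexOrder ENNReal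

noncomputable section

namespace QProc

/-- The space of `D × D` complex matrices. -/
abbrev Mat (D : ℕ) : Type := Matrix (Fin D) (Fin D) ℂ

/-- Linear operators on matrices (continuity is automatic in finite dimension). -/
abbrev MapSpace (D : ℕ) : Type := Mat D →L[ℂ] Mat D

/-- The Borel σ-algebra of the standard topology on the space of linear operators. -/
instance instMeasurableSpaceMapSpace (D : ℕ) : MeasurableSpace (MapSpace D) := borel _

instance instBorelSpaceMapSpace (D : ℕ) : BorelSpace (MapSpace D) := ⟨rfl⟩

/-! ### Matrices and positive maps -/

/-- Trace norm `Tr √(A* A)`. -/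
def traceNorm {D : ℕ} (A : Mat D) : ℝ := (Matrix.trace (CFC.sqrt (Aᴴ * A))).re

/-- Positive semidefinite matrices of trace one. -/
def states (D : ℕ) : Set (Mat D) := {X | X.PosSemidef ∧ X.trace = 1}

/-- Operator norm induced by the trace norm. -/
def opNorm {D : ℕ} (φ : MapSpace D) : ℝ :=
  sSup {r : ℝ | ∃ A : Mat D, traceNorm A = 1 ∧ r = traceNorm (φ A)}

/-- `v(φ) = inf {‖φ(X)‖ : X a state}`. -/
def lowerNorm {D : ℕ} (φ : MapSpace D) : ℝ :=
  sInf {r : ℝ | ∃ X ∈ states D, r = traceNorm (φ X)}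

/-- The Hilbert–Schmidt inner product `Tr (A* B)`. -/
def hsInner {D : ℕ} (A B : Mat D) : ℂ := (Aᴴ * B).trace

/-- The Hilbert–Schmidt adjoint, given by its matrix entries. -/
def adj {D : ℕ} (φ : MapSpace D) : MapSpace D :=
  LinearMap.toContinuousLinearMap
    { toFun := fun A => Matrix.of fun i j => hsInner (φ (Matrix.single i j 1)) A
      map_add' := by
        intro A B; ext i j
        simp [hsInner, Matrix.mul_add, Matrix.trace_add]
      map_smul' := by
        intro c A; ext i j
        simp [hsInner, Matrix.trace_smul] }

/-- The defining identity of the adjoint. -/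
theorem hsInner_adj {D : ℕ} (φ : MapSpace D) (A B : Mat D) :
    hsInner A (φ B) = hsInner (adj φ A) B := by
  have hB : φ B = ∑ i, ∑ j, B i j • φ (Matrix.single i j 1) := by
    conv_lhs => rw [Matrix.matrix_eq_sum_single B]
    simp only [map_sum]
    refine Finset.sum_congr rfl fun i _ => Finset.sum_congr rfl fun j _ => ?_
    rw [← map_smul]; simp
  have hstar : ∀ X Y : Mat D, star (hsInner X Y) = hsInner Y X := by
    intro X Y
    simp only [hsInner]
    rw [← Matrix.trace_conjTranspose, Matrix.conjTranspose_mul, Matrix.conjTranspose_conjTranspose]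
  have h1 : hsInner A (φ B) = ∑ i, ∑ j, B i j * hsInner A (φ (Matrix.single i j 1)) := by
    rw [hB]
    simp [hsInner, Matrix.mul_sum, Matrix.trace_sum, Matrix.trace_smul]
  rw [h1]
  simp only [← hstar (φ _) A]
  simp only [hsInner, Matrix.trace, Matrix.diag, Matrix.mul_apply (M := (adj φ A)ᴴ),
    Matrix.conjTranspose_apply]
  rw [Finset.sum_comm]
  refine Finset.sum_congr rfl fun i _ => Finset.sum_congr rfl fun j _ => ?_
  rw [mul_comm]
  rfl

/-- The adjoint is the only map with this property. -/
theorem eq_adj_of_hsInner {D : ℕ} (φ ψ : MapSpace D)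
    (h : ∀ A B : Mat D, hsInner A (φ B) = hsInner (ψ A) B) : ψ = adj φ := by
  ext A i j
  have h1 : ∀ X : Mat D, hsInner (ψ A) X = hsInner (adj φ A) X := fun X => by
    rw [← h, hsInner_adj]
  have e := h1 (Matrix.single i j 1)
  simp only [hsInner, Matrix.trace_mul_single, Matrix.conjTranspose_apply, op_smul_eq_mul, mul_one] at e
  exact star_injective e

/-- A map is positive if it preserves positive semidefiniteness. -/
def IsPositiveMap {D : ℕ} (φ : MapSpace D) : Prop :=
  ∀ A : Mat D, A.PosSemidef → (φ A).PosSemidef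

/-- A map is strictly positive if it sends every state to a positive definite matrix. -/
def IsStrictlyPositive {D : ℕ} (φ : MapSpace D) : Prop :=
  ∀ X ∈ states D, (φ X).PosDef

/-- `R` is a state that is an eigenmatrix of `φ`. -/
def IsEigenstate {D : ℕ} (φ : MapSpace D) (R : Mat D) : Prop :=
  R ∈ states D ∧ ∃ c : ℂ, φ R = c • R

open Classical in
/-- The (right) Perron–Frobenius eigenmatrix: the eigenmatrix of `φ` among the states.
It is unique when `φ` is an irreducible positive map, in particular when `φ` is positive and
strictly positive; the value `0` is used if there is no such matrix or more than one. -/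
def perronFrobenius {D : ℕ} (φ : MapSpace D) : Mat D :=
  if h : ∃! R : Mat D, IsEigenstate φ R then h.choose else 0

/-! ### The process -/

section Dynamics

variable {Ω : Type*} [MeasurableSpace Ω] {D : ℕ}

/-- `φ_k = φ_0 ∘ θ^k`, for `k ∈ ℤ`. -/
def proc (θ : Ω ≃ᵐ Ω) (φ₀ : Ω → MapSpace D) (k : ℤ) (ω : Ω) : MapSpace D :=
  φ₀ ((θ.toEquiv ^ k : Equiv.Perm Ω) ω)

/-- `Φ^{(n)} = φ_n ∘ ⋯ ∘ φ_1`. -/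
def Phi (θ : Ω ≃ᵐ Ω) (φ₀ : Ω → MapSpace D) : ℕ → Ω → MapSpace D
  | 0, _ => ContinuousLinearMap.id ℂ (Mat D)
  | n + 1, ω => (proc θ φ₀ ((n : ℤ) + 1) ω).comp (Phi θ φ₀ n ω)

/-- The time from which on all `Φ^{(n)}` are strictly positive (`⊤` if there is none). -/
def tau (θ : Ω ≃ᵐ Ω) (φ₀ : Ω → MapSpace D) (ω : Ω) : ℕ∞ :=
  sInf {t : ℕ∞ | ∃ n : ℕ, t = n ∧ 1 ≤ n ∧ ∀ k : ℕ, IsStrictlyPositive (Phi θ φ₀ (n + k) ω)}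

/-- The left Perron–Frobenius eigenmatrix `L_n` of `Φ^{(n)}`. -/
def leftPF (θ : Ω ≃ᵐ Ω) (φ₀ : Ω → MapSpace D) (n : ℕ) (ω : Ω) : Mat D :=
  perronFrobenius (adj (Phi θ φ₀ n ω))

/-- `Z_1 = lim_n L_n`. -/
def Z₁ (θ : Ω ≃ᵐ Ω) (φ₀ : Ω → MapSpace D) (ω : Ω) : Mat D :=
  limUnder atTop fun n : ℕ => leftPF θ φ₀ n ω

/-- `Z_k = Z_1 ∘ θ^(k-1)`, for `k ∈ ℤ`. -/
def Z (θ : Ω ≃ᵐ Ω) (φ₀ : Ω → MapSpace D) (k : ℤ) (ω : Ω) : Mat D :=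
  Z₁ θ φ₀ ((θ.toEquiv ^ (k - 1) : Equiv.Perm Ω) ω)

/-- `ln ‖φ_k^*(Z_{k+1})‖`. -/
def logNorm (θ : Ω ≃ᵐ Ω) (φ₀ : Ω → MapSpace D) (k : ℤ) (ω : Ω) : ℝ :=
  Real.log (traceNorm (adj (proc θ φ₀ k ω) (Z θ φ₀ (k + 1) ω)))

/-- `ξ_k = ln ‖φ_k^*(Z_{k+1})‖ - l` with `l = E[ln ‖φ_0^*(Z_1)‖]`. -/
def xi (μ : Measure Ω) (θ : Ω ≃ᵐ Ω) (φ₀ : Ω → MapSpace D) (k : ℤ) (ω : Ω) : ℝ :=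
  logNorm θ φ₀ k ω - ∫ ω', logNorm θ φ₀ 0 ω' ∂μ

/-- `ln ‖φ_0^*‖` and `ln v(φ_0^*)` are in `L^p`. -/
def LogMoments (μ : Measure Ω) (φ₀ : Ω → MapSpace D) (p : ℝ) : Prop :=
  MemLp (fun ω => Real.log (opNorm (adj (φ₀ ω)))) (ENNReal.ofReal p) μ ∧
  MemLp (fun ω => Real.log (lowerNorm (adj (φ₀ ω)))) (ENNReal.ofReal p) μ

/-! ### Mixing -/

/-- The σ-algebra generated by `φ_k`, `k ≤ n`. -/
@[reducible] def past (θ : Ω ≃ᵐ Ω) (φ₀ : Ω → MapSpace D) (n : ℤ) : MeasurableSpace Ω :=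
  ⨆ (k : ℤ) (_ : k ≤ n), MeasurableSpace.comap (proc θ φ₀ k) inferInstance

/-- The σ-algebra generated by `φ_k`, `k ≥ n`. -/
@[reducible] def future (θ : Ω ≃ᵐ Ω) (φ₀ : Ω → MapSpace D) (n : ℤ) : MeasurableSpace Ω :=
  ⨆ (k : ℤ) (_ : n ≤ k), MeasurableSpace.comap (proc θ φ₀ k) inferInstance

/-- The `α`-mixing coefficients. -/
def alphaMix (μ : Measure Ω) (θ : Ω ≃ᵐ Ω) (φ₀ : Ω → MapSpace D) (n : ℕ) : ℝ :=
  sSup {r : ℝ | ∃ (k : ℕ) (A B : Set Ω), MeasurableSet[past θ φ₀ k] A ∧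
    MeasurableSet[future θ φ₀ (n + k)] B ∧ r = |μ.real (A ∩ B) - μ.real A * μ.real B|}

/-- The `ρ`-mixing coefficients: the supremum of the absolute correlations of
square-integrable, non-constant random variables. -/
def rhoMix (μ : Measure Ω) (θ : Ω ≃ᵐ Ω) (φ₀ : Ω → MapSpace D) (n : ℕ) : ℝ :=
  sSup {r : ℝ | ∃ (k : ℕ) (X Y : Ω → ℝ),
    Measurable[past θ φ₀ k] Y ∧ MemLp Y 2 μ ∧
    Measurable[future θ φ₀ (n + k)] X ∧ MemLp X 2 μ ∧
    Var[X; μ] ≠ 0 ∧ Var[Y; μ] ≠ 0 ∧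
    r = |cov[Y, X; μ] / (Real.sqrt (Var[Y; μ]) * Real.sqrt (Var[X; μ]))|}

end Dynamics

end QProc

end

/-!
A positive map `φ` acts projectively on states. If all cross-ratios of its kernel
`(X, A) ↦ Tr (X φ(A))` are at least `δ` (`crossRatio`), then `φ` contracts the projective distance
by the factor `contr φ = (1 - δ) / (1 + δ)`: this is a Birkhoff-type contraction theorem
(`Comparable.map`). The coefficient is submultiplicative (`contr_comp_le`), invariant under
adjoints (`contr_adj`), at most one, and less than one for strictly positive maps
(`contr_lt_one`).

**Convergence of `L_n`.** The infimum over `n` of the coefficients `c_n = contr Φ^{(n)}` is invariant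
under the shift, so it is constant by ergodicity; since `τ` is finite, the constant is zero and
`c_n → 0` almost surely (`ae_tendsto_contr`). The projective images of the states under `Φ^{(n)*}`
decrease, have diameters controlled by `c_n`, and contain the eigenstates `L_n`, so that `L_n`
converges to their common point `Z_1` (`ae_tendsto_leftPF`).

**A common form of the mixing hypotheses.** Both mixing conditions enter through a bound
`|cov (Y, X)| ≤ β_n ‖Y‖_p ‖X‖_p` for variables of the past and the future separated by `n`
(`MixBound`). For `ρ`-mixing, `p = 2` and `β = ρ`. For `α`-mixing, it is Davydov's covariance
inequality (`abs_covariance_le_rpow`), with `β_n` of order `(α_n + 2⁻ⁿ)^((p-2)/p)`.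

**Mixing gives a summable mean contraction.** Splitting `3m` steps into three blocks, discarding the
middle one and decoupling the other two gives `e_{3m} ≤ e_m² + β_m` for `e_n = E[c_n]`. As `e_n`
decreases to zero and `∑ β_n < ∞`, also `∑ e_n < ∞` (`summable_of_antitone_of_le_sq_add`).

**The projections of `ξ_0`.** With `Z_1` replaced by the projective image of the maximally mixed
state under `Φ^{(2m)*}`, the variable `ln ‖φ_0*(Z_1)‖` becomes measurable with respect to the maps of
index at most `2m`. The error is at most an `L^p` function of `φ_0` times the contraction
coefficient of the block `m + 1, …, 2m`, and this block is separated by gaps from `φ_0` and from the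
future of `3m`. Hence the covariance of `ln ‖φ_0*(Z_1)‖` with the unit ball of `L^p(F^{3m})` is at
most `K (e_m + β_m)` (`exists_abs_covariance_logNorm_le`). By duality
(`eLpNorm_condExp_le_of_forall`) this bounds `‖E[ξ_0 | F^{3m}]‖_q`, and the bounds are summable.
-/

set_option linter.unusedSectionVars false

noncomputable section

namespace QProc

/-! ### Trace pairing and states -/

section PositiveMaps

variable {D : ℕ}

/-- The real trace pairing `Re Tr (X A)`; on Hermitian matrices it is the Hilbert–Schmidt
inner product. -/
def pair (X A : Mat D) : ℝ := (X * A).trace.re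

lemma pair_comm (X A : Mat D) : pair X A = pair A X := by
  rw [pair, pair, Matrix.trace_mul_comm]

@[simp] lemma pair_sub (X A B : Mat D) : pair X (A - B) = pair X A - pair X B := by
  simp [pair, Matrix.mul_sub]

@[simp] lemma pair_smul (X A : Mat D) (c : ℝ) : pair X (c • A) = c * pair X A := by
  simp [pair]

@[simp] lemma smul_pair (X A : Mat D) (c : ℝ) : pair (c • X) A = c * pair X A := by
  simp [pair]

@[simp] lemma one_pair (A : Mat D) : pair 1 A = A.trace.re := by simp [pair]

lemma exists_factor {A : Mat D} (hA : A.PosSemidef) : ∃ S : Mat D, A = Sᴴ * S :=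
  CStarAlgebra.nonneg_iff_eq_star_mul_self.mp hA.nonneg

lemma pair_nonneg {X A : Mat D} (hX : X.PosSemidef) (hA : A.PosSemidef) : 0 ≤ pair X A := by
  obtain ⟨S, rfl⟩ := exists_factor hA
  have h := (hX.mul_mul_conjTranspose_same S).trace_nonneg
  rw [Matrix.trace_mul_comm, ← Matrix.mul_assoc, Matrix.trace_mul_comm] at h
  exact (Complex.nonneg_iff.mp h).1

lemma trace_re_nonneg {A : Mat D} (hA : A.PosSemidef) : 0 ≤ A.trace.re :=
  (Complex.nonneg_iff.mp hA.trace_nonneg).1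

lemma trace_eq_re {A : Mat D} (hA : A.PosSemidef) : A.trace = (A.trace.re : ℂ) :=
  Complex.ext rfl (Complex.nonneg_iff.mp hA.trace_nonneg).2.symm

lemma trace_re_pos {A : Mat D} (hA : A.PosSemidef) (h0 : A ≠ 0) : 0 < A.trace.re := by
  refine lt_of_le_of_ne (trace_re_nonneg hA) fun h => h0 ?_
  rw [← hA.trace_eq_zero_iff, trace_eq_re hA, ← h]
  simp

lemma pair_pos {X A : Mat D} (hX : X.PosDef) (hA : A.PosSemidef) (h0 : A ≠ 0) :
    0 < pair X A := by
  obtain ⟨S, rfl⟩ := exists_factor hA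
  have hp : (S * X * Sᴴ).PosSemidef := hX.posSemidef.mul_mul_conjTranspose_same S
  have he : pair X (Sᴴ * S) = (S * X * Sᴴ).trace.re := by
    rw [Matrix.trace_mul_comm, ← Matrix.mul_assoc, Matrix.trace_mul_comm, pair]
  rw [he]
  refine trace_re_pos hp fun hz => h0 ?_
  have hS : S = 0 := by
    ext i j
    by_contra hij
    have hx : (fun k => star (S i k)) ≠ 0 := fun h => hij (by
      have := congrFun h j
      simpa using this)
    have h1 := hX.dotProduct_mulVec_pos hx
    have h2 : (S * X * Sᴴ) i i = 0 := by rw [hz]; rfl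
    have h3 : (S * X * Sᴴ) i i = star (fun k => star (S i k)) ⬝ᵥ (X *ᵥ fun k => star (S i k)) := by
      rw [Matrix.mul_assoc]
      simp [Matrix.mul_apply, dotProduct, Matrix.mulVec]
    rw [← h3, h2] at h1
    exact lt_irrefl _ h1
  rw [hS]; simp

lemma smul_posSemidef {A : Mat D} (hA : A.PosSemidef) {c : ℝ} (hc : 0 ≤ c) :
    (c • A).PosSemidef := hA.smul hc

lemma isHermitian_real_smul {A : Mat D} (hA : A.IsHermitian) (c : ℝ) : (c • A).IsHermitian := by
  rw [Matrix.IsHermitian, Matrix.conjTranspose_smul, hA]; simp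

lemma states_ne_zero {A : Mat D} (hA : A ∈ states D) : A ≠ 0 := by
  rintro rfl
  have := hA.2
  simp at this

lemma normalize_mem_states {A : Mat D} (hA : A.PosSemidef) (h0 : 0 < A.trace.re) :
    A.trace.re⁻¹ • A ∈ states D := by
  refine ⟨smul_posSemidef hA (inv_nonneg.mpr h0.le), ?_⟩
  rw [Matrix.trace_smul]
  nth_rw 2 [trace_eq_re hA]
  rw [Complex.real_smul, ← Complex.ofReal_mul, inv_mul_cancel₀ h0.ne', Complex.ofReal_one]

lemma eq_smul_state {A : Mat D} (hA : A.PosSemidef) (h0 : A ≠ 0) :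
    ∃ c : ℝ, 0 < c ∧ ∃ B ∈ states D, A = c • B :=
  ⟨A.trace.re, trace_re_pos hA h0, _, normalize_mem_states hA (trace_re_pos hA h0), by
    rw [smul_smul, mul_inv_cancel₀ (trace_re_pos hA h0).ne', one_smul]⟩

/-- The cone of positive semidefinite matrices is self-dual for the trace pairing. -/
lemma posSemidef_of_pair_nonneg {A : Mat D} (hA : A.IsHermitian)
    (h : ∀ X ∈ states D, 0 ≤ pair X A) : A.PosSemidef := by
  refine Matrix.PosSemidef.of_dotProduct_mulVec_nonneg hA fun x => ?_
  have hx := Matrix.posSemidef_vecMulVec_self_star x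
  have h1 : 0 ≤ pair (Matrix.vecMulVec x (star x)) A := by
    by_cases h0 : Matrix.vecMulVec x (star x) = 0
    · simp [h0, pair]
    · obtain ⟨c, hc, B, hB, e⟩ := eq_smul_state hx h0
      rw [e, smul_pair]
      exact mul_nonneg hc.le (h B hB)
  have h2 : (Matrix.vecMulVec x (star x) * A).trace = star x ⬝ᵥ (A *ᵥ x) := by
    rw [Matrix.trace_mul_comm, Matrix.mul_vecMulVec, Matrix.trace_vecMulVec, dotProduct_comm]
  have h3 : star (star x ⬝ᵥ (A *ᵥ x)) = star x ⬝ᵥ (A *ᵥ x) := by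
    rw [← Matrix.star_dotProduct_star, star_star, Matrix.star_mulVec, hA.eq,
      Matrix.dotProduct_mulVec, dotProduct_comm]
  rw [Complex.nonneg_iff]
  refine ⟨by rw [← h2]; exact h1, ?_⟩
  have := congrArg Complex.im h3
  simp only [Complex.star_def, Complex.conj_im] at this
  linarith

/-- Each entry of a positive semidefinite matrix is bounded by the trace. -/
lemma norm_apply_le_trace {A : Mat D} (hA : A.PosSemidef) (i j : Fin D) :
    ‖A i j‖ ≤ A.trace.re := by
  obtain ⟨S, rfl⟩ := exists_factor hA
  have hd : ∀ k, ((Sᴴ * S) k k).re = ∑ l, ‖S l k‖ ^ 2 := fun k => by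
    simp [Matrix.mul_apply, Complex.sq_norm, Complex.normSq_apply]
  have ht : ∀ k, ((Sᴴ * S) k k).re ≤ (Sᴴ * S).trace.re := fun k => by
    simp only [Matrix.trace, Matrix.diag_apply, Complex.re_sum]
    exact Finset.single_le_sum (f := fun i => ((Sᴴ * S) i i).re)
      (fun i _ => by rw [hd]; positivity) (Finset.mem_univ k)
  have h1 : ‖(Sᴴ * S) i j‖ ≤ ∑ l, (‖S l i‖ ^ 2 + ‖S l j‖ ^ 2) / 2 := by
    rw [Matrix.mul_apply]
    refine (norm_sum_le _ _).trans (Finset.sum_le_sum fun l _ => ?_)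
    rw [norm_mul, Matrix.conjTranspose_apply, norm_star]
    nlinarith [sq_nonneg (‖S l i‖ - ‖S l j‖)]
  rw [← Finset.sum_div, Finset.sum_add_distrib, ← hd, ← hd] at h1
  linarith [ht i, ht j]

lemma isClosed_states : IsClosed (states D) := by
  have h : states D = {A : Mat D | A.IsHermitian} ∩ {A | A.trace = 1} ∩
      ⋂ x : Fin D → ℂ, {A | 0 ≤ star x ⬝ᵥ (A *ᵥ x)} := by
    ext A
    simp only [states, Set.mem_ofPred_eq, Set.mem_inter_iff, Set.mem_iInter,
      Matrix.posSemidef_iff_dotProduct_mulVec]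
    tauto
  rw [h]
  refine (IsClosed.inter ?_ ?_).inter (isClosed_iInter fun x => ?_)
  · exact isClosed_eq (by fun_prop) continuous_id
  · exact isClosed_eq (by fun_prop) continuous_const
  · exact isClosed_le continuous_const (by fun_prop)

lemma isCompact_states : IsCompact (states D) := by
  have hK : IsCompact (Set.univ.pi fun _ : Fin D => Set.univ.pi fun _ : Fin D =>
      Metric.closedBall (0 : ℂ) 1) :=
    isCompact_univ_pi fun _ => isCompact_univ_pi fun _ => isCompact_closedBall 0 1
  refine hK.of_isClosed_subset isClosed_states fun A hA => ?_
  intro i _ j _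
  have := norm_apply_le_trace hA.1 i j
  rw [hA.2] at this
  simpa using this

/-- The maximally mixed state. -/
def mixed (D : ℕ) : Mat D := (D : ℝ)⁻¹ • 1

lemma mixed_mem_states (hD : 1 ≤ D) : mixed D ∈ states D := by
  have h : (0 : ℝ) < (1 : Mat D).trace.re := by
    simp only [Matrix.trace_one, Fintype.card_fin, Complex.natCast_re]
    exact_mod_cast hD
  have := normalize_mem_states (Matrix.PosSemidef.one (n := Fin D) (R := ℂ)) h
  simpa [mixed] using this

/-! ### The adjoint and the trace norm -/

lemma pair_adj {X : Mat D} (hX : X.IsHermitian) {A : Mat D} (hA : A.IsHermitian)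
    (φ : MapSpace D) : pair X (adj φ A) = pair A (φ X) := by
  have h := hsInner_adj φ A X
  simp only [hsInner, hA.eq] at h
  have h2 : ((adj φ A)ᴴ * X).trace = star (X * adj φ A).trace := by
    rw [← Matrix.trace_conjTranspose, Matrix.conjTranspose_mul, hX.eq]
  rw [pair, pair, h, h2, Complex.star_def, Complex.conj_re]

lemma adj_comp (φ ψ : MapSpace D) : adj (φ.comp ψ) = (adj ψ).comp (adj φ) := by
  refine (eq_adj_of_hsInner _ _ fun A B => ?_).symm
  simp only [ContinuousLinearMap.comp_apply, hsInner_adj]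

@[simp] lemma adj_id : adj (ContinuousLinearMap.id ℂ (Mat D)) = ContinuousLinearMap.id ℂ _ :=
  (eq_adj_of_hsInner _ _ fun A B => by simp only [ContinuousLinearMap.id_apply]).symm

lemma IsPositiveMap.comp {φ ψ : MapSpace D} (hφ : IsPositiveMap φ) (hψ : IsPositiveMap ψ) :
    IsPositiveMap (φ.comp ψ) := fun A hA => hφ _ (hψ A hA)

lemma trace_mul_nonneg {X A : Mat D} (hX : X.PosSemidef) (hA : A.PosSemidef) :
    0 ≤ (X * A).trace := by
  obtain ⟨S, rfl⟩ := exists_factor hA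
  have h := (hX.mul_mul_conjTranspose_same S).trace_nonneg
  rwa [Matrix.trace_mul_comm, ← Matrix.mul_assoc, Matrix.trace_mul_comm] at h

lemma IsPositiveMap.adj {φ : MapSpace D} (hφ : IsPositiveMap φ) : IsPositiveMap (adj φ) := by
  intro A hA
  have key : ∀ x : Fin D → ℂ, 0 ≤ star x ⬝ᵥ ((QProc.adj φ A) *ᵥ x) := fun x => by
    have hx := Matrix.posSemidef_vecMulVec_self_star x
    have h1 := trace_mul_nonneg hA (hφ _ hx)
    have h2 := hsInner_adj φ A (Matrix.vecMulVec x (star x))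
    simp only [hsInner, hA.1.eq] at h2
    rw [h2, Matrix.mul_vecMulVec, Matrix.trace_vecMulVec, dotProduct_comm] at h1
    have h3 : star (star x ⬝ᵥ ((QProc.adj φ A)ᴴ *ᵥ x)) = star x ⬝ᵥ ((QProc.adj φ A) *ᵥ x) := by
      rw [← Matrix.star_dotProduct_star, star_star, Matrix.star_mulVec,
        Matrix.conjTranspose_conjTranspose, Matrix.dotProduct_mulVec, dotProduct_comm]
    rw [← h3]
    exact star_nonneg_iff.mpr h1
  rw [← Matrix.isPositive_toEuclideanLin_iff, LinearMap.isPositive_iff_complex]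
  intro x
  have h := key x.ofLp
  have e : inner ℂ ((Matrix.toEuclideanLin (QProc.adj φ A)) x) x
      = star (star x.ofLp ⬝ᵥ ((QProc.adj φ A) *ᵥ x.ofLp)) := by
    rw [EuclideanSpace.inner_eq_star_dotProduct, ← Matrix.star_dotProduct_star, star_star]
    simp [Matrix.toLpLin_apply, dotProduct_comm]
  rw [e]
  have h' := star_nonneg_iff.mpr h
  obtain ⟨h1, h2⟩ := Complex.nonneg_iff.mp h'
  exact ⟨Complex.ext rfl (by simpa using h2), h1⟩

lemma traceNorm_of_posSemidef {A : Mat D} (hA : A.PosSemidef) : traceNorm A = A.trace.re := by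
  rw [traceNorm, hA.1.eq, CFC.sqrt_mul_self A hA.nonneg]

/-- The positive square root in the definition of the trace norm. -/
lemma exists_traceNorm_root (A : Mat D) :
    ∃ S : Mat D, S.PosSemidef ∧ S * S = Aᴴ * A ∧ traceNorm A = S.trace.re :=
  ⟨CFC.sqrt (Aᴴ * A), Matrix.nonneg_iff_posSemidef.mp (CFC.sqrt_nonneg _),
    CFC.sqrt_mul_sqrt_self _ (Matrix.posSemidef_conjTranspose_mul_self A).nonneg, rfl⟩

lemma conjTranspose_mul_self_diag (A : Mat D) (k : Fin D) :
    ((Aᴴ * A) k k).re = ∑ l, ‖A l k‖ ^ 2 := by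
  simp [Matrix.mul_apply, Complex.sq_norm, Complex.normSq_apply]

lemma norm_apply_sq_le_traceNorm (A : Mat D) (i j : Fin D) :
    ‖A i j‖ ^ 2 ≤ D * traceNorm A ^ 2 := by
  obtain ⟨S, hS, h2, h⟩ := exists_traceNorm_root A
  have h3 : ∑ l, ‖A l j‖ ^ 2 = ∑ l, ‖S l j‖ ^ 2 := by
    rw [← conjTranspose_mul_self_diag, ← conjTranspose_mul_self_diag, ← h2, hS.1.eq]
  calc ‖A i j‖ ^ 2 ≤ ∑ l, ‖A l j‖ ^ 2 :=
        Finset.single_le_sum (f := fun l => ‖A l j‖ ^ 2) (fun _ _ => by positivity)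
          (Finset.mem_univ i)
    _ ≤ ∑ _l : Fin D, traceNorm A ^ 2 := by
        rw [h3]
        refine Finset.sum_le_sum fun l _ => ?_
        rw [h]
        exact pow_le_pow_left₀ (norm_nonneg _) (norm_apply_le_trace hS l j) 2
    _ = _ := by simp

lemma traceNorm_le_of_norm_apply_le {A : Mat D} {C : ℝ} (hC : 0 ≤ C)
    (h : ∀ i j, ‖A i j‖ ≤ C) : traceNorm A ≤ D * (D * C) := by
  obtain ⟨S, hS, h2, h3⟩ := exists_traceNorm_root A
  have h4 : ∀ i, (S i i).re ≤ D * C := fun i => by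
    have h5 : ∑ l, ‖A l i‖ ^ 2 = ∑ l, ‖S l i‖ ^ 2 := by
      rw [← conjTranspose_mul_self_diag, ← conjTranspose_mul_self_diag, ← h2, hS.1.eq]
    have h6 : ‖S i i‖ ^ 2 ≤ (D * C) ^ 2 := by
      calc ‖S i i‖ ^ 2 ≤ ∑ l, ‖S l i‖ ^ 2 :=
            Finset.single_le_sum (f := fun l => ‖S l i‖ ^ 2) (fun _ _ => by positivity)
              (Finset.mem_univ i)
        _ ≤ ∑ _l : Fin D, C ^ 2 := by
            rw [← h5]
            exact Finset.sum_le_sum fun l _ => pow_le_pow_left₀ (norm_nonneg _) (h l i) 2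
        _ = D * C ^ 2 := by simp
        _ ≤ (D * C) ^ 2 := by
            have hD : (1 : ℝ) ≤ D := by exact_mod_cast Fin.pos i
            nlinarith [mul_nonneg (mul_nonneg (by linarith : (0 : ℝ) ≤ D) (sub_nonneg.mpr hD))
              (sq_nonneg C)]
    exact (Complex.re_le_norm _).trans (abs_le_of_sq_le_sq' h6 (by positivity)).2
  rw [h3]
  simp only [Matrix.trace, Matrix.diag_apply, Complex.re_sum]
  exact (Finset.sum_le_sum fun i _ => h4 i).trans (by simp)

lemma map_eq_sum (φ : MapSpace D) (A : Mat D) :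
    φ A = ∑ i, ∑ j, A i j • φ (Matrix.single i j 1) := by
  conv_lhs => rw [Matrix.matrix_eq_sum_single A]
  simp only [map_sum]
  refine Finset.sum_congr rfl fun i _ => Finset.sum_congr rfl fun j _ => ?_
  rw [← map_smul]; simp

lemma bddAbove_opNorm (φ : MapSpace D) :
    BddAbove {r : ℝ | ∃ A : Mat D, traceNorm A = 1 ∧ r = traceNorm (φ A)} := by
  obtain ⟨C, hC⟩ := (Set.finite_range fun x : (Fin D × Fin D) × Fin D × Fin D =>
    ‖φ (Matrix.single x.1.1 x.1.2 1) x.2.1 x.2.2‖).bddAbove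
  have hC' : ∀ i j k l, ‖φ (Matrix.single i j 1) k l‖ ≤ max C 0 := fun i j k l =>
    (hC ⟨((i, j), (k, l)), rfl⟩).trans (le_max_left _ _)
  have hC0 : 0 ≤ max C 0 := le_max_right _ _
  generalize max C 0 = c at hC' hC0
  refine ⟨D * (D * (∑ _i : Fin D, ∑ _j : Fin D, Real.sqrt D * c)), ?_⟩
  rintro _ ⟨A, hA, rfl⟩
  refine traceNorm_le_of_norm_apply_le (by positivity) fun k l => ?_
  have h1 : ∀ i j, ‖A i j‖ ≤ Real.sqrt D := fun i j => by
    refine Real.le_sqrt_of_sq_le ?_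
    simpa [hA] using norm_apply_sq_le_traceNorm A i j
  rw [map_eq_sum φ A]
  simp only [Matrix.sum_apply, Matrix.smul_apply, smul_eq_mul]
  refine (norm_sum_le _ _).trans (Finset.sum_le_sum fun i _ =>
    (norm_sum_le _ _).trans (Finset.sum_le_sum fun j _ => ?_))
  rw [norm_mul]
  exact mul_le_mul (h1 i j) (hC' i j k l) (norm_nonneg _) (Real.sqrt_nonneg _)

lemma trace_map_le_opNorm {φ : MapSpace D} (hφ : IsPositiveMap φ) {X : Mat D}
    (hX : X ∈ states D) : pair 1 (φ X) ≤ opNorm φ := by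
  refine le_csSup (bddAbove_opNorm φ) ⟨X, ?_, ?_⟩
  · rw [traceNorm_of_posSemidef hX.1, hX.2]; simp
  · rw [traceNorm_of_posSemidef (hφ _ hX.1), one_pair]

lemma lowerNorm_eq {φ : MapSpace D} (hφ : IsPositiveMap φ) :
    lowerNorm φ = sInf ((fun X => pair 1 (φ X)) '' states D) := by
  rw [lowerNorm]
  congr 1
  ext r
  constructor
  · rintro ⟨X, hX, rfl⟩
    exact ⟨X, hX, by simp only [one_pair, traceNorm_of_posSemidef (hφ _ hX.1)]⟩
  · rintro ⟨X, hX, rfl⟩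
    exact ⟨X, hX, by simp only [one_pair, traceNorm_of_posSemidef (hφ _ hX.1)]⟩

/-! ### Cross-ratio coefficient and its projective contraction property -/

/-- All cross-ratios of the kernel `(X, A) ↦ Re Tr (X φ(A))` on states are at least `r`,
written without division. Nonnegativity of the kernel is part of the condition, so that the
condition is downward closed in `r`. -/
def CrossRatioGE (φ : MapSpace D) (r : ℝ) : Prop :=
  (∀ X ∈ states D, ∀ A ∈ states D, 0 ≤ pair X (φ A)) ∧
  ∀ A ∈ states D, ∀ B ∈ states D, ∀ X ∈ states D, ∀ Y ∈ states D,
    r * (pair X (φ B) * pair Y (φ A)) ≤ pair X (φ A) * pair Y (φ B)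

/-- The infimum of the cross-ratios of `φ`, truncated to `[0, 1]`
(and `0` if the kernel of `φ` is not nonnegative). -/
def crossRatio (φ : MapSpace D) : ℝ := sSup {r | 0 ≤ r ∧ r ≤ 1 ∧ CrossRatioGE φ r}

/-- The involution `x ↦ (1 - x) / (1 + x)` of `[0, 1]`, exchanging cross-ratios and contraction
coefficients. -/
def cayley (x : ℝ) : ℝ := (1 - x) / (1 + x)

/-- The contraction coefficient of a positive map for its projective action on states. -/
def contr (φ : MapSpace D) : ℝ := cayley (crossRatio φ)

lemma cayley_nonneg {x : ℝ} (h0 : 0 ≤ x) (h1 : x ≤ 1) : 0 ≤ cayley x :=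
  div_nonneg (by linarith) (by linarith)

lemma cayley_le_one {x : ℝ} (h0 : 0 ≤ x) : cayley x ≤ 1 :=
  (div_le_one (by linarith)).mpr (by linarith)

lemma cayley_lt_one {x : ℝ} (h0 : 0 < x) : cayley x < 1 :=
  (div_lt_one (by linarith)).mpr (by linarith)

lemma cayley_anti {x y : ℝ} (h0 : 0 ≤ x) (h : x ≤ y) : cayley y ≤ cayley x := by
  rw [cayley, cayley, div_le_div_iff₀ (by linarith) (by linarith)]
  nlinarith

lemma cayley_cayley {x : ℝ} (h0 : 0 ≤ x) : cayley (cayley x) = x := by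
  have : 1 + x ≠ 0 := by linarith
  unfold cayley
  field_simp
  ring

lemma one_sub_le_cayley {x : ℝ} (h0 : 0 ≤ x) (h1 : x ≤ 1) : 1 - x ≤ 2 * cayley x := by
  rw [cayley, ← mul_div_assoc, le_div_iff₀ (by linarith)]
  nlinarith

lemma crossRatio_nonneg (φ : MapSpace D) : 0 ≤ crossRatio φ :=
  Real.sSup_nonneg fun _ hr => hr.1

lemma crossRatio_le_one (φ : MapSpace D) : crossRatio φ ≤ 1 :=
  Real.sSup_le (fun _ hr => hr.2.1) zero_le_one

lemma contr_nonneg (φ : MapSpace D) : 0 ≤ contr φ :=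
  cayley_nonneg (crossRatio_nonneg φ) (crossRatio_le_one φ)

lemma contr_le_one (φ : MapSpace D) : contr φ ≤ 1 := cayley_le_one (crossRatio_nonneg φ)

lemma CrossRatioGE.mono {φ : MapSpace D} {r r' : ℝ} (h : CrossRatioGE φ r) (hr : r' ≤ r) :
    CrossRatioGE φ r' :=
  ⟨h.1, fun A hA B hB X hX Y hY => le_trans (mul_le_mul_of_nonneg_right hr
    (mul_nonneg (h.1 X hX B hB) (h.1 Y hY A hA))) (h.2 A hA B hB X hX Y hY)⟩

lemma bddAbove_crossRatio (φ : MapSpace D) :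
    BddAbove {r | 0 ≤ r ∧ r ≤ 1 ∧ CrossRatioGE φ r} := ⟨1, fun _ hr => hr.2.1⟩

lemma CrossRatioGE.le_crossRatio {φ : MapSpace D} {r : ℝ} (h : CrossRatioGE φ r) (h0 : 0 ≤ r)
    (h1 : r ≤ 1) : r ≤ crossRatio φ := le_csSup (bddAbove_crossRatio φ) ⟨h0, h1, h⟩

/-- The supremum in the definition of the cross-ratio is attained. -/
lemma crossRatioGE_crossRatio {φ : MapSpace D} (h : CrossRatioGE φ 0) :
    CrossRatioGE φ (crossRatio φ) := by
  refine ⟨h.1, fun A hA B hB X hX Y hY => ?_⟩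
  have hne : {r | 0 ≤ r ∧ r ≤ 1 ∧ CrossRatioGE φ r}.Nonempty := ⟨0, le_rfl, zero_le_one, h⟩
  have hK : 0 ≤ pair X (φ B) * pair Y (φ A) := mul_nonneg (h.1 X hX B hB) (h.1 Y hY A hA)
  rcases hK.eq_or_lt with h0 | h0
  · rw [← h0, mul_zero]
    exact mul_nonneg (h.1 X hX A hA) (h.1 Y hY B hB)
  · rw [← le_div_iff₀ h0]
    exact csSup_le hne fun r hr => (le_div_iff₀ h0).mpr (hr.2.2.2 A hA B hB X hX Y hY)

lemma IsPositiveMap.crossRatioGE_zero {φ : MapSpace D} (hφ : IsPositiveMap φ) :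
    CrossRatioGE φ 0 := by
  refine ⟨fun X hX A hA => pair_nonneg hX.1 (hφ _ hA.1), fun A hA B hB X hX Y hY => ?_⟩
  rw [zero_mul]
  exact mul_nonneg (pair_nonneg hX.1 (hφ _ hA.1)) (pair_nonneg hY.1 (hφ _ hB.1))

lemma IsPositiveMap.crossRatioGE {φ : MapSpace D} (hφ : IsPositiveMap φ) :
    CrossRatioGE φ (crossRatio φ) := crossRatioGE_crossRatio hφ.crossRatioGE_zero

lemma le_crossRatio_iff {φ : MapSpace D} {a : ℝ} (ha : 0 < a) :
    a ≤ crossRatio φ ↔ a ≤ 1 ∧ CrossRatioGE φ a := by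
  refine ⟨fun h => ⟨h.trans (crossRatio_le_one φ), ?_⟩, fun h => h.2.le_crossRatio ha.le h.1⟩
  have hne : {r | 0 ≤ r ∧ r ≤ 1 ∧ CrossRatioGE φ r}.Nonempty := by
    by_contra hne
    rw [Set.not_nonempty_iff_eq_empty] at hne
    rw [crossRatio, hne, Real.sSup_empty] at h
    linarith
  obtain ⟨r, hr0, -, hr⟩ := hne
  exact (crossRatioGE_crossRatio (hr.mono hr0)).mono h

lemma continuous_eval (A : Mat D) : Continuous fun φ : MapSpace D => φ A := by
  fun_prop

lemma continuous_pair_comp {α : Type*} [TopologicalSpace α] {f g : α → Mat D}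
    (hf : Continuous f) (hg : Continuous g) : Continuous fun x => pair (f x) (g x) := by
  unfold pair
  fun_prop

lemma continuous_pair_eval (X A : Mat D) : Continuous fun φ : MapSpace D => pair X (φ A) :=
  continuous_pair_comp continuous_const (continuous_eval A)

lemma isClosed_crossRatioGE (r : ℝ) : IsClosed {φ : MapSpace D | CrossRatioGE φ r} := by
  have h : {φ : MapSpace D | CrossRatioGE φ r} =
      (⋂ X ∈ states D, ⋂ A ∈ states D, {φ | 0 ≤ pair X (φ A)}) ∩
      ⋂ A ∈ states D, ⋂ B ∈ states D, ⋂ X ∈ states D, ⋂ Y ∈ states D,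
        {φ | r * (pair X (φ B) * pair Y (φ A)) ≤ pair X (φ A) * pair Y (φ B)} := by
    ext φ
    simp only [CrossRatioGE, Set.mem_ofPred_eq, Set.mem_inter_iff, Set.mem_iInter]
  rw [h]
  refine IsClosed.inter ?_ ?_
  · exact isClosed_biInter fun X _ => isClosed_biInter fun A _ =>
      isClosed_le continuous_const (continuous_pair_eval X A)
  · exact isClosed_biInter fun A _ => isClosed_biInter fun B _ => isClosed_biInter fun X _ =>
      isClosed_biInter fun Y _ => isClosed_le
        (continuous_const.mul ((continuous_pair_eval X B).mul (continuous_pair_eval Y A)))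
        ((continuous_pair_eval X A).mul (continuous_pair_eval Y B))

lemma measurable_crossRatio : Measurable (crossRatio : MapSpace D → ℝ) := by
  refine measurable_of_Ici fun a => ?_
  rcases le_or_gt a 0 with ha | ha
  · convert MeasurableSet.univ
    ext φ
    simpa using ha.trans (crossRatio_nonneg φ)
  · by_cases h1 : a ≤ 1
    · convert (isClosed_crossRatioGE (D := D) a).measurableSet
      ext φ
      simp [le_crossRatio_iff ha, h1]
    · convert MeasurableSet.empty
      ext φ
      simp [le_crossRatio_iff ha, h1]

lemma measurable_contr : Measurable (contr : MapSpace D → ℝ) :=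
  (measurable_const.sub measurable_crossRatio).div (measurable_const.add measurable_crossRatio)

lemma crossRatioGE_adj {φ : MapSpace D} {r : ℝ} :
    CrossRatioGE (adj φ) r ↔ CrossRatioGE φ r := by
  have hp : ∀ X ∈ states D, ∀ A ∈ states D, pair X (adj φ A) = pair A (φ X) :=
    fun X hX A hA => pair_adj hX.1.1 hA.1.1 φ
  constructor
  · rintro ⟨h1, h2⟩
    refine ⟨fun X hX A hA => hp A hA X hX ▸ h1 A hA X hX, fun A hA B hB X hX Y hY => ?_⟩
    have := h2 X hX Y hY A hA B hB
    rwa [hp _ hA _ hY, hp _ hB _ hX, hp _ hA _ hX, hp _ hB _ hY,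
      mul_comm (pair Y (φ A))] at this
  · rintro ⟨h1, h2⟩
    refine ⟨fun X hX A hA => hp X hX A hA ▸ h1 A hA X hX, fun A hA B hB X hX Y hY => ?_⟩
    have := h2 X hX Y hY A hA B hB
    rwa [hp _ hX _ hB, hp _ hY _ hA, hp _ hX _ hA, hp _ hY _ hB, mul_comm (pair B (φ X))]

lemma crossRatio_adj (φ : MapSpace D) : crossRatio (adj φ) = crossRatio φ := by
  simp only [crossRatio, crossRatioGE_adj]

lemma contr_adj (φ : MapSpace D) : contr (adj φ) = contr φ := by
  rw [contr, crossRatio_adj, contr]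

/-! ### Comparison of positive semidefinite matrices -/

/-- `P ≥ s Q` and `Q ≥ t P` for some `s, t ≥ 0` with `s t ≥ r`: the Hilbert projective distance
of `P` and `Q` is at most `-ln r`. -/
def Comparable (P Q : Mat D) (r : ℝ) : Prop :=
  ∃ s t : ℝ, 0 ≤ s ∧ 0 ≤ t ∧ r ≤ s * t ∧ (P - s • Q).PosSemidef ∧ (Q - t • P).PosSemidef

/-- Cross-ratio inequalities against all states produce a two-sided comparison; the constant `s`
is the infimum of `Tr (XP) / Tr (XQ)` over states `X`. -/
lemma comparable_of_cross {P Q : Mat D} (hP : P.PosSemidef) (hQ : Q.PosSemidef) (hP0 : P ≠ 0)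
    (hQ0 : Q ≠ 0) {r : ℝ} (hr : 0 ≤ r)
    (h : ∀ X ∈ states D, ∀ Y ∈ states D, r * (pair X Q * pair Y P) ≤ pair X P * pair Y Q) :
    Comparable P Q r := by
  rcases hr.eq_or_lt with rfl | hr
  · exact ⟨0, 0, le_rfl, le_rfl, by simp, by simpa using hP, by simpa using hQ⟩
  set T : Set ℝ := {x | ∃ X ∈ states D, 0 < pair X Q ∧ x = pair X P / pair X Q} with hT
  have hTb : ∀ x ∈ T, 0 ≤ x := by
    rintro x ⟨X, hX, h0, rfl⟩
    exact div_nonneg (pair_nonneg hX.1 hP) h0.le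
  have hTbdd : BddBelow T := ⟨0, hTb⟩
  obtain ⟨cQ, hcQ, Q', hQ', eQ⟩ := eq_smul_state hQ hQ0
  have hself : ∀ {A : Mat D}, A ∈ states D → 0 < pair A A := fun {A} hA => by
    refine lt_of_le_of_ne (pair_nonneg hA.1 hA.1) fun h0 => states_ne_zero hA ?_
    have h1 : (Aᴴ * A).trace.re = 0 := by rw [hA.1.1.eq]; exact h0.symm
    have h2 := trace_eq_re (Matrix.posSemidef_conjTranspose_mul_self A)
    rw [h1] at h2
    exact Matrix.trace_conjTranspose_mul_self_eq_zero_iff.mp (by simpa using h2)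
  have hTne : T.Nonempty := ⟨_, Q', hQ', by
    rw [eQ, pair_smul]
    exact mul_pos hcQ (hself hQ'), rfl⟩
  set s := sInf T with hs
  have hs0 : 0 ≤ s := le_csInf hTne hTb
  have h1 : ∀ X ∈ states D, s * pair X Q ≤ pair X P := fun X hX => by
    rcases (pair_nonneg hX.1 hQ).eq_or_lt with h0 | h0
    · rw [← h0, mul_zero]
      exact pair_nonneg hX.1 hP
    · rw [← le_div_iff₀ h0]
      exact csInf_le hTbdd ⟨X, hX, h0, rfl⟩
  have h2 : ∀ Y ∈ states D, r * pair Y P ≤ s * pair Y Q := fun Y hY => by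
    rcases (pair_nonneg hY.1 hQ).eq_or_lt with h0 | h0
    · obtain ⟨_, X, hX, hXQ, rfl⟩ := hTne
      have := h X hX Y hY
      rw [← h0, mul_zero] at this ⊢
      by_contra hcon
      push Not at hcon
      have : 0 < r * (pair X Q * pair Y P) := by
        have := mul_pos hXQ hcon
        nlinarith
      linarith
    · rw [← div_le_iff₀ h0]
      refine le_csInf hTne ?_
      rintro _ ⟨X, hX, hXQ, rfl⟩
      rw [div_le_div_iff₀ h0 hXQ]
      have := h X hX Y hY
      nlinarith
  have hspos : 0 < s := by
    refine lt_of_le_of_ne hs0 fun h0 => ?_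
    obtain ⟨cP, hcP, P', hP', eP⟩ := eq_smul_state hP hP0
    have := h2 P' hP'
    rw [← h0, zero_mul, eP, pair_smul] at this
    have h3 := mul_pos hr (mul_pos hcP (hself hP'))
    linarith
  refine ⟨s, r / s, hs0, by positivity, le_of_eq (by field_simp), ?_, ?_⟩
  · refine posSemidef_of_pair_nonneg (hP.1.sub (isHermitian_real_smul hQ.1 s)) fun X hX => ?_
    rw [pair_sub, pair_smul]
    linarith [h1 X hX]
  · refine posSemidef_of_pair_nonneg (hQ.1.sub (isHermitian_real_smul hP.1 _)) fun X hX => ?_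
    rw [pair_sub, pair_smul, sub_nonneg, div_mul_eq_mul_div, div_le_iff₀ hspos]
    linarith [h2 X hX]

lemma Comparable.cross {P Q : Mat D} (hP : P.PosSemidef) (hQ : Q.PosSemidef) {r : ℝ}
    (h : Comparable P Q r) {X Y : Mat D} (hX : X.PosSemidef) (hY : Y.PosSemidef) :
    r * (pair X Q * pair Y P) ≤ pair X P * pair Y Q := by
  obtain ⟨s, t, hs, ht, hst, h1, h2⟩ := h
  have e1 := pair_nonneg hX h1
  have e2 := pair_nonneg hY h2
  rw [pair_sub, pair_smul, sub_nonneg] at e1 e2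
  have a := pair_nonneg hX hQ
  have b := pair_nonneg hY hP
  calc r * (pair X Q * pair Y P) ≤ (s * t) * (pair X Q * pair Y P) :=
        mul_le_mul_of_nonneg_right hst (mul_nonneg a b)
    _ = (s * pair X Q) * (t * pair Y P) := by ring
    _ ≤ pair X P * pair Y Q :=
        mul_le_mul e1 e2 (mul_nonneg ht b) (pair_nonneg hX hP)

/-- The product of the comparison constants of a nonzero pair is at most one. -/
lemma mul_le_one_of_sub_posSemidef {P Q : Mat D} (hP : P.PosSemidef) (hP0 : P ≠ 0) {s t : ℝ}
    (hs : 0 ≤ s) (h1 : (P - s • Q).PosSemidef) (h2 : (Q - t • P).PosSemidef) : s * t ≤ 1 := by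
  have e1 := trace_re_nonneg h1
  have e2 := trace_re_nonneg h2
  have e3 := trace_re_pos hP hP0
  rw [← one_pair, pair_sub, pair_smul, one_pair, one_pair] at e1 e2
  nlinarith [mul_nonneg hs e2]

/-- A map which annihilates no state. -/
def Nonvanishing (φ : MapSpace D) : Prop := ∀ A ∈ states D, φ A ≠ 0

lemma map_real_smul (φ : MapSpace D) (c : ℝ) (A : Mat D) : φ (c • A) = c • φ A := by
  have := φ.map_smul (c : ℂ) A
  rwa [Complex.coe_smul, Complex.coe_smul] at this

lemma Nonvanishing.map_ne_zero {φ : MapSpace D} (h : Nonvanishing φ) {A : Mat D}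
    (hA : A.PosSemidef) (h0 : A ≠ 0) : φ A ≠ 0 := by
  obtain ⟨c, hc, B, hB, rfl⟩ := eq_smul_state hA h0
  rw [map_real_smul]
  exact smul_ne_zero hc.ne' (h B hB)

lemma Nonvanishing.comp {φ ψ : MapSpace D} (hφ : Nonvanishing φ) (hψ : Nonvanishing ψ)
    (hψp : IsPositiveMap ψ) : Nonvanishing (φ.comp ψ) := fun A hA =>
  hφ.map_ne_zero (hψp A hA.1) (hψ A hA)

lemma cayley_composition {s t m m' δ r : ℝ} (hs : 0 ≤ s) (ht : 0 ≤ t) (hm : 0 ≤ m)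
    (hm' : 0 ≤ m') (hst : s * t ≤ 1) (hmm : m * m' ≤ 1) (hδ : 0 ≤ δ) (hδs : δ ≤ s * t)
    (hr : 0 ≤ r) (hrm : r ≤ m * m') :
    cayley (cayley δ * cayley r) ≤ (s + m) / (1 + s * m') * ((t + m') / (1 + t * m)) := by
  have hsm := mul_nonneg hs hm'
  have htm := mul_nonneg ht hm
  have hst0 := mul_nonneg hs ht
  have hmm0 := mul_nonneg hm hm'
  set L := (s + m) / (1 + s * m') * ((t + m') / (1 + t * m)) with hL
  have hL0 : 0 ≤ L := by positivity
  rw [← cayley_cayley hL0]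
  have hkey : cayley L ≤ cayley (s * t) * cayley (m * m') := by
    have e : cayley L = ((1 - s * t) * (1 - m * m')) /
        ((1 + s * m') * (1 + t * m) + (s + m) * (t + m')) := by
      have h1 : 1 + s * m' ≠ 0 := by positivity
      have h2 : 1 + t * m ≠ 0 := by positivity
      have h3 : (1 + s * m') * (1 + t * m) + (s + m) * (t + m') ≠ 0 := by positivity
      have hL' : L = ((s + m) * (t + m')) / ((1 + s * m') * (1 + t * m)) := by
        rw [hL, div_mul_div_comm]
      have hd : (1 + s * m') * (1 + t * m) ≠ 0 := mul_ne_zero h1 h2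
      have hx : 1 + L ≠ 0 := by positivity
      rw [cayley, div_eq_div_iff hx h3, hL']
      field_simp
      ring
    rw [e, cayley, cayley, div_mul_div_comm]
    refine div_le_div_of_nonneg_left (mul_nonneg (by linarith) (by linarith)) (by positivity) ?_
    nlinarith
  have hL1 : 0 ≤ cayley L := by
    have e : L ≤ 1 := by
      rw [hL, div_mul_div_comm, div_le_one (by positivity)]
      nlinarith [mul_nonneg (sub_nonneg.mpr hst) (sub_nonneg.mpr hmm)]
    exact cayley_nonneg hL0 e
  refine cayley_anti hL1 (hkey.trans ?_)
  exact mul_le_mul (cayley_anti hδ hδs) (cayley_anti hr hrm) (cayley_nonneg hmm0 hmm)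
    (cayley_nonneg hδ (hδs.trans hst))

/-- Birkhoff-type contraction: a positive map with cross-ratios at least `δ` contracts
the projective distance `cayley r` by the factor `cayley δ`. The pair `(A, B)` is
replaced by `U = A - m B`, `V = B - m' A`, and a comparison of `φ U` and `φ V` is read as an
improved comparison of `φ A` and `φ B`. -/
lemma Comparable.map {φ : MapSpace D} (hφ : IsPositiveMap φ) (hn : Nonvanishing φ) {δ : ℝ}
    (hδ0 : 0 ≤ δ) (hδ1 : δ ≤ 1) (hδ : CrossRatioGE φ δ) {A B : Mat D} (hA : A.PosSemidef)
    (hA0 : A ≠ 0) (hB0 : B ≠ 0) {r : ℝ} (hr0 : 0 ≤ r) (hr1 : r ≤ 1)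
    (h : Comparable A B r) : Comparable (φ A) (φ B) (cayley (cayley δ * cayley r)) := by
  obtain ⟨m, m', hm, hm', hmm, hU, hV⟩ := h
  have hcc : cayley (cayley δ * cayley r) ≤ 1 :=
    cayley_le_one (mul_nonneg (cayley_nonneg hδ0 hδ1) (cayley_nonneg hr0 hr1))
  have hmm1 := mul_le_one_of_sub_posSemidef hA hA0 hm hU hV
  set U := A - m • B with hUd
  set V := B - m' • A with hVd
  have hmap : ∀ (c : ℝ) (X Y : Mat D), φ (X - c • Y) = φ X - c • φ Y := fun c X Y => by
    rw [map_sub, map_real_smul]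
  -- If `U` or `V` vanishes, then `A` and `B` are proportional, and so are their images.
  by_cases hU0 : U = 0
  · have hAB : A = m • B := sub_eq_zero.mp hU0
    have hm0 : m ≠ 0 := by
      rintro rfl
      exact hA0 (by rw [hAB, zero_smul])
    refine ⟨m, m⁻¹, hm, inv_nonneg.mpr hm, by rwa [mul_inv_cancel₀ hm0], ?_, ?_⟩
    · rw [hAB, map_real_smul, sub_self]
      exact Matrix.PosSemidef.zero
    · rw [hAB, map_real_smul, smul_smul, inv_mul_cancel₀ hm0, one_smul, sub_self]
      exact Matrix.PosSemidef.zero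
  by_cases hV0 : V = 0
  · have hAB : B = m' • A := sub_eq_zero.mp hV0
    have hm0 : m' ≠ 0 := by
      rintro rfl
      exact hB0 (by rw [hAB, zero_smul])
    refine ⟨m'⁻¹, m', inv_nonneg.mpr hm', hm', by rwa [inv_mul_cancel₀ hm0], ?_, ?_⟩
    · rw [hAB, map_real_smul, smul_smul, inv_mul_cancel₀ hm0, one_smul, sub_self]
      exact Matrix.PosSemidef.zero
    · rw [hAB, map_real_smul, sub_self]
      exact Matrix.PosSemidef.zero
  have hcomp : Comparable (φ U) (φ V) δ := by
    refine comparable_of_cross (hφ _ hU) (hφ _ hV) (hn.map_ne_zero hU hU0)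
      (hn.map_ne_zero hV hV0) hδ0 fun X hX Y hY => ?_
    obtain ⟨c, hc, U', hU', eU⟩ := eq_smul_state hU hU0
    obtain ⟨d, hd, V', hV', eV⟩ := eq_smul_state hV hV0
    rw [eU, eV, map_real_smul, map_real_smul, pair_smul, pair_smul, pair_smul, pair_smul]
    have := mul_le_mul_of_nonneg_left (hδ.2 U' hU' V' hV' X hX Y hY) (mul_pos hc hd).le
    linarith
  obtain ⟨s, t, hs, ht, hst, h1, h2⟩ := hcomp
  have hst1 := mul_le_one_of_sub_posSemidef (hφ _ hU) (hn.map_ne_zero hU hU0) hs h1 h2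
  have hp1 : 0 < 1 + s * m' := by positivity
  have hp2 : 0 < 1 + t * m := by positivity
  -- `φ U ≥ s φ V` rearranges to `φ A ≥ ((s + m) / (1 + s m')) φ B`, and similarly for `t`.
  refine ⟨(s + m) / (1 + s * m'), (t + m') / (1 + t * m), by positivity, by positivity,
    cayley_composition hs ht hm hm' hst1 hmm1 hδ0 hst hr0 hmm, ?_, ?_⟩
  · have e : φ A - ((s + m) / (1 + s * m')) • φ B = (1 + s * m')⁻¹ • (φ U - s • φ V) := by
      rw [hUd, hVd, hmap, hmap]
      have : φ A = ((1 + s * m')⁻¹ * (1 + s * m')) • φ A := by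
        rw [inv_mul_cancel₀ hp1.ne', one_smul]
      rw [div_eq_inv_mul]
      nth_rw 1 [this]
      module
    rw [e]
    exact smul_posSemidef h1 (inv_nonneg.mpr hp1.le)
  · have e : φ B - ((t + m') / (1 + t * m)) • φ A = (1 + t * m)⁻¹ • (φ V - t • φ U) := by
      rw [hUd, hVd, hmap, hmap]
      have : φ B = ((1 + t * m)⁻¹ * (1 + t * m)) • φ B := by
        rw [inv_mul_cancel₀ hp2.ne', one_smul]
      rw [div_eq_inv_mul]
      nth_rw 1 [this]
      module
    rw [e]
    exact smul_posSemidef h2 (inv_nonneg.mpr hp2.le)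

/-! ### The contraction coefficient and Perron–Frobenius eigenstates -/

lemma comparable_map_states {φ : MapSpace D} (hφ : IsPositiveMap φ) (hn : Nonvanishing φ)
    {A B : Mat D} (hA : A ∈ states D) (hB : B ∈ states D) :
    Comparable (φ A) (φ B) (crossRatio φ) :=
  comparable_of_cross (hφ _ hA.1) (hφ _ hB.1) (hn A hA) (hn B hB) (crossRatio_nonneg φ)
    fun X hX Y hY => hφ.crossRatioGE.2 A hA B hB X hX Y hY

/-- The contraction coefficient is submultiplicative. -/
lemma contr_comp_le {φ ψ : MapSpace D} (hφ : IsPositiveMap φ) (hψ : IsPositiveMap ψ)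
    (hφn : Nonvanishing φ) (hψn : Nonvanishing ψ) :
    contr (φ.comp ψ) ≤ contr φ * contr ψ := by
  have h0 : 0 ≤ contr φ * contr ψ := mul_nonneg (contr_nonneg _) (contr_nonneg _)
  have h1 : contr φ * contr ψ ≤ 1 := mul_le_one₀ (contr_le_one _) (contr_nonneg _) (contr_le_one _)
  have hc0 : 0 ≤ cayley (contr φ * contr ψ) := cayley_nonneg h0 h1
  rw [← cayley_cayley h0]
  refine cayley_anti hc0 (CrossRatioGE.le_crossRatio ?_ hc0 (cayley_le_one h0))
  have hcomp := hφ.comp hψ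
  refine ⟨fun X hX A hA => pair_nonneg hX.1 (hcomp _ hA.1), fun A hA B hB X hX Y hY => ?_⟩
  have h2 := (comparable_map_states hψ hψn hA hB).map hφ hφn (crossRatio_nonneg φ)
    (crossRatio_le_one φ) hφ.crossRatioGE (hψ _ hA.1) (hψn A hA) (hψn B hB)
    (crossRatio_nonneg ψ) (crossRatio_le_one ψ)
  exact h2.cross (hcomp _ hA.1) (hcomp _ hB.1) hX.1 hY.1

/-- The kernel of `φ` on states is bounded above, and below by its infimum. -/
lemma exists_kernel_bounds (hD : 1 ≤ D) {φ : MapSpace D}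
    (h : ∀ X ∈ states D, ∀ A ∈ states D, 0 < pair X (φ A)) :
    ∃ ε C : ℝ, 0 < ε ∧ ∀ X ∈ states D, ∀ A ∈ states D, ε ≤ pair X (φ A) ∧ pair X (φ A) ≤ C := by
  have hK : IsCompact (states D ×ˢ states D) := isCompact_states.prod isCompact_states
  have hne : (states D ×ˢ states D).Nonempty :=
    ⟨(mixed D, mixed D), mixed_mem_states hD, mixed_mem_states hD⟩
  have hcont : Continuous (fun p : Mat D × Mat D => pair p.1 (φ p.2)) :=
    continuous_pair_comp continuous_fst (φ.continuous.comp continuous_snd)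
  obtain ⟨p, hm, hmin⟩ := hK.exists_isMinOn hne hcont.continuousOn
  obtain ⟨p', -, hmax⟩ := hK.exists_isMaxOn hne hcont.continuousOn
  exact ⟨pair p.1 (φ p.2), pair p'.1 (φ p'.2), h _ hm.1 _ hm.2, fun X hX A hA =>
    ⟨hmin (a := (X, A)) ⟨hX, hA⟩, hmax (a := (X, A)) ⟨hX, hA⟩⟩⟩

/-- A map whose kernel is strictly positive on states contracts strictly. -/
lemma contr_lt_one (hD : 1 ≤ D) {φ : MapSpace D}
    (h : ∀ X ∈ states D, ∀ A ∈ states D, 0 < pair X (φ A)) : contr φ < 1 := by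
  refine cayley_lt_one ?_
  obtain ⟨ε, C, he, hb⟩ := exists_kernel_bounds hD h
  have hεC : ε ≤ C :=
    (hb _ (mixed_mem_states hD) _ (mixed_mem_states hD)).1.trans
      (hb _ (mixed_mem_states hD) _ (mixed_mem_states hD)).2
  have hCpos : 0 < C := he.trans_le hεC
  have hpos : 0 < (ε / C) ^ 2 := by positivity
  have hle : (ε / C) ^ 2 ≤ 1 := pow_le_one₀ (by positivity) ((div_le_one hCpos).mpr hεC)
  refine hpos.trans_le (CrossRatioGE.le_crossRatio (r := (ε / C) ^ 2) ?_ hpos.le hle)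
  refine ⟨fun X hX A hA => (h X hX A hA).le, fun A hA B hB X hX Y hY => ?_⟩
  calc (ε / C) ^ 2 * (pair X (φ B) * pair Y (φ A)) ≤ (ε / C) ^ 2 * (C * C) :=
        mul_le_mul_of_nonneg_left (mul_le_mul (hb X hX B hB).2 (hb Y hY A hA).2
          (h Y hY A hA).le hCpos.le) hpos.le
    _ = ε * ε := by field_simp
    _ ≤ _ := mul_le_mul (hb X hX A hA).1 (hb Y hY B hB).1 he.le (h X hX A hA).le

lemma Comparable.le_of_states {P Q : Mat D} {r : ℝ} (hP : P ∈ states D) (hQ : Q ∈ states D)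
    (h : Comparable P Q r) : (P - r • Q).PosSemidef ∧ (Q - r • P).PosSemidef := by
  obtain ⟨s, t, hs, ht, hst, h1, h2⟩ := h
  have e1 := trace_re_nonneg h1
  have e2 := trace_re_nonneg h2
  rw [← one_pair, pair_sub, pair_smul, one_pair, one_pair, hP.2, hQ.2] at e1 e2
  simp only [Complex.one_re, mul_one, sub_nonneg] at e1 e2
  have hrs : r ≤ s := by nlinarith
  have hrt : r ≤ t := by nlinarith
  have key : ∀ (x : ℝ) (P Q : Mat D), Q.PosSemidef → r ≤ x → (P - x • Q).PosSemidef →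
      (P - r • Q).PosSemidef := fun x P Q hQ hx h => by
    have e : P - r • Q = (P - x • Q) + (x - r) • Q := by module
    rw [e]
    exact h.add (smul_posSemidef hQ (by linarith))
  exact ⟨key s P Q hQ.1 hrs h1, key t Q P hP.1 hrt h2⟩

lemma Comparable.norm_sub_le {P Q : Mat D} {r : ℝ} (hP : P ∈ states D) (hQ : Q ∈ states D)
    (hr : r ≤ 1) (h : Comparable P Q r) (i j : Fin D) : ‖P i j - Q i j‖ ≤ 2 * (1 - r) := by
  have h1 := (h.le_of_states hP hQ).1
  have e : P i j - Q i j = (P - r • Q) i j - ((1 - r : ℝ) : ℂ) * Q i j := by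
    simp only [Matrix.sub_apply, Matrix.smul_apply, Complex.real_smul]
    push_cast
    ring
  have b1 := norm_apply_le_trace h1 i j
  have b2 := norm_apply_le_trace hQ.1 i j
  rw [← one_pair, pair_sub, pair_smul, one_pair, one_pair, hP.2, hQ.2] at b1
  rw [hQ.2] at b2
  simp only [Complex.one_re, mul_one] at b1 b2
  rw [e]
  refine (_root_.norm_sub_le _ _).trans ?_
  rw [norm_mul, Complex.norm_real, Real.norm_of_nonneg (by linarith)]
  nlinarith

lemma abs_log_sub_log_le {p q r : ℝ} (hp : 0 < p) (hq : 0 < q) (hr : 0 < r)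
    (h1 : r * q ≤ p) (h2 : r * p ≤ q) : |Real.log p - Real.log q| ≤ r⁻¹ - 1 := by
  have key : ∀ {a b : ℝ}, 0 < a → 0 < b → r * b ≤ a → Real.log b - Real.log a ≤ r⁻¹ - 1 :=
    fun {a b} ha hb h => by
      rw [← Real.log_div hb.ne' ha.ne']
      refine (Real.log_le_sub_one_of_pos (by positivity)).trans ?_
      have : b / a ≤ r⁻¹ := by
        rw [div_le_iff₀ ha, inv_mul_eq_div, le_div_iff₀ hr]
        linarith
      linarith
  rw [abs_le]
  constructor
  · linarith [key hp hq h1]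
  · linarith [key hq hp h2]

/-- The logarithmic growth of a positive map on two comparable states: close states are controlled
by the projective distance, the others by the a priori bound `M`. -/
lemma Comparable.abs_log_sub_le {φ : MapSpace D} (hφ : IsPositiveMap φ) (hn : Nonvanishing φ)
    {P Q : Mat D} {r M : ℝ} (hP : P ∈ states D) (hQ : Q ∈ states D) (hr0 : 0 ≤ r) (hr1 : r ≤ 1)
    (h : Comparable P Q r) (hM : ∀ A ∈ states D, |Real.log (pair 1 (φ A))| ≤ M) :
    |Real.log (pair 1 (φ P)) - Real.log (pair 1 (φ Q))| ≤ (6 + 4 * M) * cayley r := by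
  have hM0 : 0 ≤ M := (abs_nonneg _).trans (hM P hP)
  have hc0 := cayley_nonneg hr0 hr1
  have hpos : ∀ A ∈ states D, 0 < pair 1 (φ A) := fun A hA => by
    rw [one_pair]
    exact trace_re_pos (hφ _ hA.1) (hn A hA)
  by_cases hc : cayley r ≤ 1 / 2
  · have hr3 : 1 / 3 ≤ r := by
      rw [cayley, div_le_iff₀ (by linarith)] at hc
      linarith
    have hrpos : 0 < r := by linarith
    obtain ⟨h1, h2⟩ := h.le_of_states hP hQ
    have g1 := trace_re_nonneg (hφ _ h1)
    have g2 := trace_re_nonneg (hφ _ h2)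
    rw [map_sub, map_real_smul, ← one_pair, pair_sub, pair_smul, sub_nonneg] at g1 g2
    refine (abs_log_sub_log_le (hpos P hP) (hpos Q hQ) hrpos g1 g2).trans ?_
    have e1 : r⁻¹ - 1 ≤ 3 * (1 - r) := by
      have : r⁻¹ ≤ 3 := by
        rw [inv_le_comm₀ hrpos (by norm_num)]
        linarith
      have e : r⁻¹ - 1 = r⁻¹ * (1 - r) := by field_simp
      rw [e]
      exact mul_le_mul_of_nonneg_right this (by linarith)
    have e2 := one_sub_le_cayley hr0 hr1
    nlinarith
  · push Not at hc
    refine (abs_sub _ _).trans ?_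
    nlinarith [hM P hP, hM Q hQ]

/-! ### Projective images -/

/-- The projective action of a positive map on states. -/
def proj (φ : MapSpace D) (A : Mat D) : Mat D := (pair 1 (φ A))⁻¹ • φ A

/-- The image of the states under the projective action. -/
def projRange (φ : MapSpace D) : Set (Mat D) := proj φ '' states D

lemma proj_mem_states {φ : MapSpace D} (hφ : IsPositiveMap φ) (hn : Nonvanishing φ) {A : Mat D}
    (hA : A ∈ states D) : proj φ A ∈ states D := by
  rw [proj, one_pair]
  exact normalize_mem_states (hφ _ hA.1) (trace_re_pos (hφ _ hA.1) (hn A hA))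

lemma pair_one_pos {φ : MapSpace D} (hφ : IsPositiveMap φ) (hn : Nonvanishing φ) {A : Mat D}
    (hA : A ∈ states D) : 0 < pair 1 (φ A) := by
  rw [one_pair]
  exact trace_re_pos (hφ _ hA.1) (hn A hA)

lemma projRange_subset_states {φ : MapSpace D} (hφ : IsPositiveMap φ) (hn : Nonvanishing φ) :
    projRange φ ⊆ states D := by
  rintro _ ⟨A, hA, rfl⟩
  exact proj_mem_states hφ hn hA

lemma continuousOn_proj {φ : MapSpace D} (hφ : IsPositiveMap φ) (hn : Nonvanishing φ) :
    ContinuousOn (proj φ) (states D) := by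
  have h1 : Continuous fun A => pair 1 (φ A) :=
    continuous_pair_comp continuous_const φ.continuous
  exact (h1.continuousOn.inv₀ fun A hA => (pair_one_pos hφ hn hA).ne').smul
    φ.continuous.continuousOn

lemma isClosed_projRange {φ : MapSpace D} (hφ : IsPositiveMap φ) (hn : Nonvanishing φ) :
    IsClosed (projRange φ) :=
  (isCompact_states.image_of_continuousOn (continuousOn_proj hφ hn)).isClosed

lemma proj_proj {φ ψ : MapSpace D} (hψ : IsPositiveMap ψ) (hψn : Nonvanishing ψ) {A : Mat D}
    (hA : A ∈ states D) : proj φ (proj ψ A) = proj (φ.comp ψ) A := by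
  have h := (pair_one_pos hψ hψn hA).ne'
  simp only [proj, map_real_smul, pair_smul, ContinuousLinearMap.comp_apply, smul_smul]
  congr 1
  field_simp

lemma projRange_comp_subset {φ ψ : MapSpace D} (hψ : IsPositiveMap ψ)
    (hψn : Nonvanishing ψ) : projRange (φ.comp ψ) ⊆ projRange φ := by
  rintro _ ⟨A, hA, rfl⟩
  exact ⟨proj ψ A, proj_mem_states hψ hψn hA, proj_proj hψ hψn hA⟩

lemma comparable_projRange {φ : MapSpace D} (hφ : IsPositiveMap φ) (hn : Nonvanishing φ)
    {P Q : Mat D} (hP : P ∈ projRange φ) (hQ : Q ∈ projRange φ) :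
    Comparable P Q (crossRatio φ) := by
  obtain ⟨A, hA, rfl⟩ := hP
  obtain ⟨B, hB, rfl⟩ := hQ
  have sA := proj_mem_states hφ hn hA
  have sB := proj_mem_states hφ hn hB
  refine comparable_of_cross sA.1 sB.1 (states_ne_zero sA) (states_ne_zero sB)
    (crossRatio_nonneg φ) fun X hX Y hY => ?_
  simp only [proj, pair_smul]
  have h := mul_le_mul_of_nonneg_left (hφ.crossRatioGE.2 A hA B hB X hX Y hY)
    (mul_pos (inv_pos.mpr (pair_one_pos hφ hn hA)) (inv_pos.mpr (pair_one_pos hφ hn hB))).le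
  linarith

lemma norm_sub_le_contr {φ : MapSpace D} (hφ : IsPositiveMap φ) (hn : Nonvanishing φ)
    {P Q : Mat D} (hP : P ∈ projRange φ) (hQ : Q ∈ projRange φ) (i j : Fin D) :
    ‖P i j - Q i j‖ ≤ 4 * contr φ := by
  have h := (comparable_projRange hφ hn hP hQ).norm_sub_le (projRange_subset_states hφ hn hP)
    (projRange_subset_states hφ hn hQ) (crossRatio_le_one φ) i j
  have := one_sub_le_cayley (crossRatio_nonneg φ) (crossRatio_le_one φ)
  rw [contr]
  linarith

lemma eigenstate_mem_projRange {φ : MapSpace D} (hφ : IsPositiveMap φ) (hn : Nonvanishing φ)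
    {R : Mat D} (hR : IsEigenstate φ R) : R = proj φ R := by
  obtain ⟨hs, c, hc⟩ := hR
  have hp := pair_one_pos hφ hn hs
  have h1 : pair 1 (φ R) = c.re := by
    rw [one_pair, hc, Matrix.trace_smul, hs.2]; simp
  have h2 : (φ R).trace = c := by rw [hc, Matrix.trace_smul, hs.2]; simp
  have h3 : c = (c.re : ℂ) := by
    have := trace_eq_re (hφ _ hs.1)
    rwa [h2] at this
  rw [h1] at hp
  rw [proj, h1, hc, h3, Complex.coe_smul, Complex.ofReal_re, smul_smul, inv_mul_cancel₀ hp.ne',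
    one_smul]

lemma isEigenstate_of_proj_eq {φ : MapSpace D} (hφ : IsPositiveMap φ) (hn : Nonvanishing φ)
    {R : Mat D} (hR : R ∈ states D) (h : proj φ R = R) : IsEigenstate φ R := by
  refine ⟨hR, ((pair 1 (φ R) : ℝ) : ℂ), ?_⟩
  rw [Complex.coe_smul]
  nth_rw 3 [← h]
  rw [proj, smul_smul, mul_inv_cancel₀ (pair_one_pos hφ hn hR).ne', one_smul]

/-- Nested projective images with contraction coefficients tending to zero have a common limit. -/
lemma exists_tendsto_of_projRange {ψ : ℕ → MapSpace D} (hψ : ∀ n, IsPositiveMap (ψ n))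
    (hn : ∀ n, Nonvanishing (ψ n)) (hanti : ∀ m n, m ≤ n → projRange (ψ n) ⊆ projRange (ψ m))
    (hc : Tendsto (fun n => contr (ψ n)) atTop (𝓝 0)) {x : ℕ → Mat D}
    (hx : ∀ᶠ n in atTop, x n ∈ projRange (ψ n)) :
    ∃ Z, Tendsto x atTop (𝓝 Z) ∧ ∀ n, Z ∈ projRange (ψ n) := by
  obtain ⟨N, hN⟩ := eventually_atTop.mp hx
  have hlim : ∀ i j, ∃ z : ℂ, Tendsto (fun n => x n i j) atTop (𝓝 z) := fun i j => by
    refine cauchySeq_tendsto_of_complete (Metric.cauchySeq_iff'.mpr fun ε hε => ?_)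
    obtain ⟨M, hM⟩ := eventually_atTop.mp
      (hc.eventually (gt_mem_nhds (show (0 : ℝ) < ε / 4 by positivity)))
    refine ⟨max M N, fun n hnM => ?_⟩
    have h1 := hM (max M N) (le_max_left _ _)
    have hMN := hN (max M N) (le_max_right _ _)
    have h2 := hanti _ _ hnM (hN n ((le_max_right _ _).trans hnM))
    rw [dist_eq_norm]
    have := norm_sub_le_contr (hψ _) (hn _) h2 hMN i j
    linarith
  choose z hz using hlim
  have hZ : Tendsto x atTop (𝓝 (Matrix.of z)) :=
    tendsto_pi_nhds.mpr fun i => tendsto_pi_nhds.mpr fun j => hz i j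
  refine ⟨Matrix.of z, hZ, fun n => ?_⟩
  refine (isClosed_projRange (hψ n) (hn n)).mem_of_tendsto hZ ?_
  filter_upwards [eventually_ge_atTop (max n N)] with k hk
  exact hanti _ _ ((le_max_left _ _).trans hk) (hN k ((le_max_right _ _).trans hk))

lemma eq_of_forall_mem_projRange {ψ : ℕ → MapSpace D} (hψ : ∀ n, IsPositiveMap (ψ n))
    (hn : ∀ n, Nonvanishing (ψ n)) (hc : Tendsto (fun n => contr (ψ n)) atTop (𝓝 0))
    {P Q : Mat D} (hP : ∀ n, P ∈ projRange (ψ n)) (hQ : ∀ n, Q ∈ projRange (ψ n)) : P = Q := by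
  ext i j
  have h : ‖P i j - Q i j‖ ≤ 0 := by
    refine ge_of_tendsto' (by simpa using hc.const_mul 4) fun n =>
      norm_sub_le_contr (hψ n) (hn n) (hP n) (hQ n) i j
  exact sub_eq_zero.mp (norm_le_zero_iff.mp h)

/-- Iterates of a map. -/
def iter (φ : MapSpace D) : ℕ → MapSpace D
  | 0 => ContinuousLinearMap.id ℂ (Mat D)
  | n + 1 => φ.comp (iter φ n)

lemma nonvanishing_id : Nonvanishing (ContinuousLinearMap.id ℂ (Mat D)) :=
  fun _ hA => states_ne_zero hA

lemma isPositiveMap_id : IsPositiveMap (ContinuousLinearMap.id ℂ (Mat D)) := fun _ hA => hA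

lemma iter_succ' (φ : MapSpace D) (n : ℕ) : iter φ (n + 1) = (iter φ n).comp φ := by
  induction n with
  | zero => rfl
  | succ n ih =>
    change φ.comp (iter φ (n + 1)) = (φ.comp (iter φ n)).comp φ
    rw [ih]
    rfl

lemma isPositiveMap_iter {φ : MapSpace D} (hφ : IsPositiveMap φ) (n : ℕ) :
    IsPositiveMap (iter φ n) := by
  induction n with
  | zero => exact isPositiveMap_id
  | succ n ih => exact hφ.comp ih

lemma nonvanishing_iter {φ : MapSpace D} (hφ : IsPositiveMap φ) (hn : Nonvanishing φ) (n : ℕ) :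
    Nonvanishing (iter φ n) := by
  induction n with
  | zero => exact nonvanishing_id
  | succ n ih => exact hn.comp ih (isPositiveMap_iter hφ n)

/-- Perron–Frobenius theorem for strictly contracting positive maps. -/
lemma existsUnique_eigenstate (hD : 1 ≤ D) {φ : MapSpace D} (hφ : IsPositiveMap φ)
    (hn : Nonvanishing φ) (hc : contr φ < 1) : ∃! R : Mat D, IsEigenstate φ R := by
  have hp := isPositiveMap_iter hφ
  have hnv := nonvanishing_iter hφ hn
  have hle : ∀ n, contr (iter φ n) ≤ contr φ ^ n := fun n => by
    induction n with
    | zero => simpa using contr_le_one _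
    | succ n ih =>
      rw [pow_succ']
      exact (contr_comp_le hφ (hp n) hn (hnv n)).trans
        (mul_le_mul_of_nonneg_left ih (contr_nonneg _))
  have hlim : Tendsto (fun n => contr (iter φ n)) atTop (𝓝 0) :=
    squeeze_zero (fun n => contr_nonneg _) hle
      (tendsto_pow_atTop_nhds_zero_of_lt_one (contr_nonneg _) hc)
  have hanti : ∀ m n, m ≤ n → projRange (iter φ n) ⊆ projRange (iter φ m) := fun m n hmn => by
    induction n, hmn using Nat.le_induction with
    | base => exact subset_rfl
    | succ n _ ih =>
      rw [iter_succ']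
      exact (projRange_comp_subset hφ hn).trans ih
  have hmix : ∀ n, proj (iter φ n) (mixed D) ∈ projRange (iter φ n) := fun n =>
    ⟨_, mixed_mem_states hD, rfl⟩
  obtain ⟨Z, hZ, hZr⟩ := exists_tendsto_of_projRange hp hnv hanti hlim
    (Eventually.of_forall hmix)
  have hZs : Z ∈ states D := projRange_subset_states (hp 0) (hnv 0) (hZr 0)
  have hfix : proj φ Z = Z := by
    have h1 : Tendsto (fun n => proj φ (proj (iter φ n) (mixed D))) atTop (𝓝 (proj φ Z)) :=
      ((continuousOn_proj hφ hn) Z hZs).tendsto.comp (tendsto_nhdsWithin_iff.mpr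
        ⟨hZ, Eventually.of_forall fun n => projRange_subset_states (hp n) (hnv n) (hmix n)⟩)
    have h2 : ∀ n, proj φ (proj (iter φ n) (mixed D)) = proj (iter φ (n + 1)) (mixed D) :=
      fun n => proj_proj (hp n) (hnv n) (mixed_mem_states hD)
    simp only [h2] at h1
    exact tendsto_nhds_unique h1 (hZ.comp (tendsto_add_atTop_nat 1))
  refine ⟨Z, isEigenstate_of_proj_eq hφ hn hZs hfix, fun R hR => ?_⟩
  -- Every eigenstate is a fixed point of `proj φ`, hence lies in all projective images.
  refine eq_of_forall_mem_projRange hp hnv hlim (fun n => ?_) hZr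
  have hRe := eigenstate_mem_projRange hφ hn hR
  induction n with
  | zero => exact ⟨R, hR.1, by simp [proj, iter, pair, hR.1.2]⟩
  | succ n ih =>
    obtain ⟨A, hA, hAR⟩ := ih
    refine ⟨A, hA, ?_⟩
    change proj (φ.comp (iter φ n)) A = R
    rw [← proj_proj (hp n) (hnv n) hA, hAR, ← hRe]

end PositiveMaps

/-! ### Measurability on the space of maps -/

section MapSpaceTopology

variable {D : ℕ}

lemma continuous_mapSpace {α : Type*} [TopologicalSpace α] {F : α → MapSpace D}
    (h : ∀ A, Continuous fun x => F x A) : Continuous F := by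
  let E : MapSpace D →ₗ[ℂ] (Fin D × Fin D → Mat D) :=
    { toFun := fun φ p => φ (Matrix.single p.1 p.2 1)
      map_add' := fun _ _ => rfl
      map_smul' := fun _ _ => rfl }
  have hE : LinearMap.ker E = ⊥ := by
    refine LinearMap.ker_eq_bot'.mpr fun φ hφ => ?_
    ext1 A
    rw [map_eq_sum φ A]
    have : ∀ i j, φ (Matrix.single i j 1) = 0 := fun i j => congrFun hφ (i, j)
    simp [this]
  obtain ⟨G, hG⟩ := E.exists_leftInverse_of_injective hE
  have hGc : Continuous G := G.continuous_of_finiteDimensional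
  have e : F = fun x => G fun p => F x (Matrix.single p.1 p.2 1) := by
    funext x
    exact (LinearMap.congr_fun hG (F x)).symm
  rw [e]
  exact hGc.comp (continuous_pi fun p => h _)

instance instSecondCountableTopologyMapSpace : SecondCountableTopology (MapSpace D) :=
  (ContinuousLinearEquiv.ofFinrankEq (𝕜 := ℂ) (E := MapSpace D)
    (F := Fin (Module.finrank ℂ (MapSpace D)) → ℂ) (by simp)).toHomeomorph.secondCountableTopology

lemma continuous_comp_mapSpace :
    Continuous fun p : MapSpace D × MapSpace D => p.1.comp p.2 := by
  refine continuous_mapSpace fun A => ?_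
  simp only [ContinuousLinearMap.comp_apply]
  have e : (fun p : MapSpace D × MapSpace D => p.1 (p.2 A)) =
      fun p => ∑ i, ∑ j, (p.2 A) i j • p.1 (Matrix.single i j 1) := by
    funext p
    exact map_eq_sum p.1 _
  rw [e]
  have h2 : Continuous fun p : MapSpace D × MapSpace D => p.2 A :=
    (continuous_eval A).comp continuous_snd
  refine continuous_finsetSum _ fun i _ => continuous_finsetSum _ fun j _ => ?_
  exact ((continuous_apply j).comp ((continuous_apply i).comp h2)).smul
    ((continuous_eval _).comp continuous_fst)

lemma measurable_comp_mapSpace {Ω : Type*} {m : MeasurableSpace Ω} {f g : Ω → MapSpace D}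
    (hf : Measurable f) (hg : Measurable g) : Measurable fun ω => (f ω).comp (g ω) :=
  continuous_comp_mapSpace.measurable.comp (hf.prodMk hg)

/-- `inf Tr (φ* X)` over the states `X`; for positive `φ` it is `v(φ*)`. -/
def lo (φ : MapSpace D) : ℝ := sInf ((fun X => pair X (φ 1)) '' states D)

/-- `sup Tr (φ* X)` over the states `X`; for positive `φ` it is the norm of `φ*` on the
positive cone. -/
def hi (φ : MapSpace D) : ℝ := sSup ((fun X => pair X (φ 1)) '' states D)

lemma continuous_lo : Continuous (lo : MapSpace D → ℝ) :=
  isCompact_states.continuous_sInf (f := fun (φ : MapSpace D) X => pair X (φ 1))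
    (continuous_pair_comp continuous_snd ((continuous_eval 1).comp continuous_fst))

lemma continuous_hi : Continuous (hi : MapSpace D → ℝ) :=
  isCompact_states.continuous_sSup (f := fun (φ : MapSpace D) X => pair X (φ 1))
    (continuous_pair_comp continuous_snd ((continuous_eval 1).comp continuous_fst))

lemma isHermitian_one : (1 : Mat D).IsHermitian := Matrix.isHermitian_one

lemma pair_one_adj (φ : MapSpace D) {X : Mat D} (hX : X ∈ states D) :
    pair 1 (adj φ X) = pair X (φ 1) := pair_adj isHermitian_one hX.1.1 φ

lemma lowerNorm_adj {φ : MapSpace D} (hφ : IsPositiveMap φ) : lowerNorm (adj φ) = lo φ := by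
  rw [lowerNorm_eq hφ.adj, lo]
  congr 1
  exact Set.image_congr fun X hX => pair_one_adj φ hX

lemma isCompact_image_pair (φ : MapSpace D) :
    IsCompact ((fun X => pair X (φ 1)) '' states D) :=
  isCompact_states.image (continuous_pair_comp continuous_id continuous_const)

lemma lo_le (φ : MapSpace D) {X : Mat D} (hX : X ∈ states D) : lo φ ≤ pair 1 (adj φ X) := by
  rw [pair_one_adj φ hX]
  exact csInf_le (isCompact_image_pair φ).bddBelow ⟨X, hX, rfl⟩

lemma le_hi (φ : MapSpace D) {X : Mat D} (hX : X ∈ states D) : pair 1 (adj φ X) ≤ hi φ := by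
  rw [pair_one_adj φ hX]
  exact le_csSup (isCompact_image_pair φ).bddAbove ⟨X, hX, rfl⟩

lemma hi_le_opNorm (hD : 1 ≤ D) {φ : MapSpace D} (hφ : IsPositiveMap φ) :
    hi φ ≤ opNorm (adj φ) := by
  refine csSup_le ⟨_, mixed D, mixed_mem_states hD, rfl⟩ ?_
  rintro _ ⟨X, hX, rfl⟩
  simp only
  rw [← pair_one_adj φ hX]
  exact trace_map_le_opNorm hφ.adj hX

lemma nonvanishing_adj_of_lo_pos {φ : MapSpace D} (h : 0 < lo φ) : Nonvanishing (adj φ) := by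
  intro X hX h0
  have := h.trans_le (lo_le φ hX)
  simp [h0] at this

lemma lo_pos_of_nonvanishing_adj (hD : 1 ≤ D) {φ : MapSpace D} (hφ : IsPositiveMap φ)
    (h : Nonvanishing (adj φ)) : 0 < lo φ := by
  obtain ⟨X, hX, hX'⟩ := (isCompact_image_pair φ).sInf_mem ⟨_, mixed D, mixed_mem_states hD, rfl⟩
  have e : lo φ = pair X (φ 1) := hX'.symm
  rw [e, ← pair_one_adj φ hX]
  exact pair_one_pos hφ.adj h hX

lemma kernel_pos_of_isStrictlyPositive {φ : MapSpace D} (h : IsStrictlyPositive φ) :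
    ∀ X ∈ states D, ∀ A ∈ states D, 0 < pair X (φ A) := fun X hX A hA => by
  rw [pair_comm]
  exact pair_pos (h A hA) hX.1 (states_ne_zero hX)

lemma contr_lt_one_of_isStrictlyPositive (hD : 1 ≤ D) {φ : MapSpace D}
    (h : IsStrictlyPositive φ) : contr φ < 1 :=
  contr_lt_one hD (kernel_pos_of_isStrictlyPositive h)

end MapSpaceTopology

/-! ### The process and its contraction coefficients -/

section DynamicsFacts

variable {Ω : Type*} [MeasurableSpace Ω] {D : ℕ}

/-- The iterates `θ^k`, `k ∈ ℤ`. -/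
def shift (θ : Ω ≃ᵐ Ω) (k : ℤ) (ω : Ω) : Ω := (θ.toEquiv ^ k : Equiv.Perm Ω) ω

@[simp] lemma shift_zero (θ : Ω ≃ᵐ Ω) (ω : Ω) : shift θ 0 ω = ω := by simp [shift]

@[simp] lemma shift_one (θ : Ω ≃ᵐ Ω) (ω : Ω) : shift θ 1 ω = θ ω := by simp [shift]

lemma shift_shift (θ : Ω ≃ᵐ Ω) (j k : ℤ) (ω : Ω) : shift θ j (shift θ k ω) = shift θ (j + k) ω := by
  simp [shift, zpow_add]

lemma shift_neg_one (θ : Ω ≃ᵐ Ω) (ω : Ω) : shift θ (-1) ω = θ.symm ω := by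
  rw [shift, zpow_neg_one]
  rfl

lemma proc_eq (θ : Ω ≃ᵐ Ω) (φ₀ : Ω → MapSpace D) (k : ℤ) (ω : Ω) :
    proc θ φ₀ k ω = φ₀ (shift θ k ω) := rfl

lemma proc_shift (θ : Ω ≃ᵐ Ω) (φ₀ : Ω → MapSpace D) (k j : ℤ) (ω : Ω) :
    proc θ φ₀ k (shift θ j ω) = proc θ φ₀ (k + j) ω := by
  rw [proc_eq, proc_eq, shift_shift]

lemma measurePreserving_shift {μ : Measure Ω} {θ : Ω ≃ᵐ Ω} (hθ : MeasurePreserving θ μ μ)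
    (k : ℤ) : MeasurePreserving (shift θ k) μ μ := by
  induction k with
  | zero =>
    have : shift θ 0 = id := funext fun ω => shift_zero θ ω
    rw [this]
    exact MeasurePreserving.id μ
  | succ n ih =>
    have : shift θ (n + 1) = shift θ n ∘ θ := funext fun ω => by
      rw [Function.comp, ← shift_one θ, shift_shift]
    rw [this]
    exact ih.comp hθ
  | pred n ih =>
    have : shift θ (-n - 1) = shift θ (-n) ∘ θ.symm := funext fun ω => by
      rw [Function.comp, ← shift_neg_one θ, shift_shift, sub_eq_add_neg]
    rw [this]
    exact ih.comp (hθ.symm θ)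

lemma Phi_add (θ : Ω ≃ᵐ Ω) (φ₀ : Ω → MapSpace D) (n m : ℕ) (ω : Ω) :
    Phi θ φ₀ (n + m) ω = (Phi θ φ₀ m (shift θ n ω)).comp (Phi θ φ₀ n ω) := by
  induction m with
  | zero => rfl
  | succ m ih =>
    rw [← Nat.add_assoc, Phi, ih, Phi, proc_shift]
    have : ((n + m : ℕ) : ℤ) + 1 = (m : ℤ) + 1 + n := by push_cast; ring
    rw [this]
    rfl

lemma isPositiveMap_Phi {θ : Ω ≃ᵐ Ω} {φ₀ : Ω → MapSpace D} (hpos : ∀ ω, IsPositiveMap (φ₀ ω))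
    (n : ℕ) (ω : Ω) : IsPositiveMap (Phi θ φ₀ n ω) := by
  induction n with
  | zero => exact isPositiveMap_id
  | succ n ih => exact IsPositiveMap.comp (hpos _) ih

/-- `Phi n` along the shifted orbit is measurable for any σ-algebra making the factors
measurable. -/
lemma measurable_Phi_shift {Ω : Type*} {m : MeasurableSpace Ω} [MeasurableSpace Ω] {D : ℕ}
    {θ : Ω ≃ᵐ Ω} {φ₀ : Ω → MapSpace D} {j : ℤ} {n : ℕ}
    (h : ∀ k : ℤ, j + 1 ≤ k → k ≤ j + n → Measurable[m] (proc θ φ₀ k)) :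
    Measurable[m] fun ω => Phi θ φ₀ n (shift θ j ω) := by
  induction n with
  | zero => exact @measurable_const _ _ _ m _
  | succ n ih =>
    simp only [Phi, proc_shift]
    refine measurable_comp_mapSpace (h _ (by omega) (by push_cast; omega)) (ih fun k h1 h2 => ?_)
    exact h k h1 (by push_cast; omega)

lemma measurable_proc {θ : Ω ≃ᵐ Ω} {φ₀ : Ω → MapSpace D} (hφ₀ : Measurable φ₀) {μ : Measure Ω}
    (hθ : MeasurePreserving θ μ μ) (k : ℤ) : Measurable (proc θ φ₀ k) :=
  hφ₀.comp (measurePreserving_shift hθ k).measurable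

lemma measurable_Phi {θ : Ω ≃ᵐ Ω} {φ₀ : Ω → MapSpace D} (hφ₀ : Measurable φ₀) {μ : Measure Ω}
    (hθ : MeasurePreserving θ μ μ) (n : ℕ) : Measurable (Phi θ φ₀ n) := by
  have := measurable_Phi_shift (θ := θ) (φ₀ := φ₀) (j := 0) (n := n)
    fun k _ _ => measurable_proc hφ₀ hθ k
  simpa only [shift_zero] using this

/-- A point at which no adjoint `φ_k*` annihilates a state. -/
def Regular (θ : Ω ≃ᵐ Ω) (φ₀ : Ω → MapSpace D) (ω : Ω) : Prop :=
  ∀ k : ℤ, Nonvanishing (adj (proc θ φ₀ k ω))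

lemma Regular.shift {θ : Ω ≃ᵐ Ω} {φ₀ : Ω → MapSpace D} {ω : Ω} (h : Regular θ φ₀ ω) (j : ℤ) :
    Regular θ φ₀ (shift θ j ω) := fun k => by
  rw [proc_shift]
  exact h _

lemma Regular.nonvanishing {θ : Ω ≃ᵐ Ω} {φ₀ : Ω → MapSpace D}
    (hpos : ∀ ω, IsPositiveMap (φ₀ ω)) {ω : Ω} (h : Regular θ φ₀ ω) (n : ℕ) :
    Nonvanishing (adj (Phi θ φ₀ n ω)) := by
  induction n with
  | zero =>
    rw [Phi, adj_id]
    exact nonvanishing_id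
  | succ n ih =>
    rw [Phi, adj_comp]
    exact ih.comp (h _) (hpos _).adj

lemma contr_Phi_add_le {θ : Ω ≃ᵐ Ω} {φ₀ : Ω → MapSpace D} (hpos : ∀ ω, IsPositiveMap (φ₀ ω))
    {ω : Ω} (h : Regular θ φ₀ ω) (n m : ℕ) : contr (Phi θ φ₀ (n + m) ω) ≤
      contr (Phi θ φ₀ n ω) * contr (Phi θ φ₀ m (QProc.shift θ n ω)) := by
  rw [← contr_adj, Phi_add, adj_comp, ← contr_adj (Phi θ φ₀ n ω),
    ← contr_adj (Phi θ φ₀ m (QProc.shift θ n ω))]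
  exact contr_comp_le (isPositiveMap_Phi hpos n ω).adj (isPositiveMap_Phi hpos m _).adj
    (h.nonvanishing hpos n) ((h.shift n).nonvanishing hpos m)

lemma projRange_Phi_antitone {θ : Ω ≃ᵐ Ω} {φ₀ : Ω → MapSpace D}
    (hpos : ∀ ω, IsPositiveMap (φ₀ ω)) {ω : Ω} (h : Regular θ φ₀ ω) {m n : ℕ} (hmn : m ≤ n) :
    projRange (adj (Phi θ φ₀ n ω)) ⊆ projRange (adj (Phi θ φ₀ m ω)) := by
  obtain ⟨k, rfl⟩ := Nat.exists_eq_add_of_le hmn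
  rw [Phi_add, adj_comp]
  exact projRange_comp_subset (isPositiveMap_Phi hpos k _).adj ((h.shift m).nonvanishing hpos k)

lemma antitone_contr_Phi {θ : Ω ≃ᵐ Ω} {φ₀ : Ω → MapSpace D} (hpos : ∀ ω, IsPositiveMap (φ₀ ω))
    {ω : Ω} (h : Regular θ φ₀ ω) : Antitone fun n => contr (Phi θ φ₀ n ω) := by
  intro m n hmn
  obtain ⟨k, rfl⟩ := Nat.exists_eq_add_of_le hmn
  exact (contr_Phi_add_le hpos h m k).trans
    (mul_le_of_le_one_right (contr_nonneg _) (contr_le_one _))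

lemma exists_strictlyPositive_of_tau_lt_top {θ : Ω ≃ᵐ Ω} {φ₀ : Ω → MapSpace D} {ω : Ω}
    (h : tau θ φ₀ ω < ⊤) : ∃ n : ℕ, ∀ k : ℕ, IsStrictlyPositive (Phi θ φ₀ (n + k) ω) := by
  by_contra hcon
  push Not at hcon
  refine h.ne (sInf_eq_top.mpr ?_)
  rintro t ⟨n, -, -, hn⟩
  obtain ⟨k, hk⟩ := hcon n
  exact absurd (hn k) hk

/-- Strict positivity of `φ_{n+1} ∘ Φ^{(n)}` prevents `φ_{n+1}*` from annihilating a state. -/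
lemma nonvanishing_adj_of_comp {φ ψ : MapSpace D} (hD : 1 ≤ D) (hψ : IsPositiveMap ψ)
    (h : IsStrictlyPositive (φ.comp ψ)) : Nonvanishing (adj φ) := by
  intro X hX h0
  have h1 := kernel_pos_of_isStrictlyPositive h X hX _ (mixed_mem_states hD)
  have h2 : pair X (φ (ψ (mixed D))) = pair (ψ (mixed D)) (adj φ X) :=
    (pair_adj (hψ _ (mixed_mem_states hD).1).1 hX.1.1 φ).symm
  rw [ContinuousLinearMap.comp_apply, h2, h0] at h1
  simp [pair] at h1

variable {μ : Measure Ω} [IsProbabilityMeasure μ] {θ : Ω ≃ᵐ Ω} {φ₀ : Ω → MapSpace D}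

/-- By stationarity, the event `v(φ_0*) > 0` has at least the probability of `τ ≤ n` for
every `n`. -/
lemma ae_regular (hθ : MeasurePreserving θ μ μ) (hD : 1 ≤ D) (hφ₀ : Measurable φ₀)
    (hpos : ∀ ω, IsPositiveMap (φ₀ ω)) (hτ : ∀ᵐ ω ∂μ, tau θ φ₀ ω < ⊤) :
    ∀ᵐ ω ∂μ, Regular θ φ₀ ω := by
  set S : ℕ → Set Ω := fun n => {ω | ∀ k : ℕ, IsStrictlyPositive (Phi θ φ₀ (n + k) ω)} with hS
  have hmono : Monotone S := fun m n hmn ω hω k => by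
    obtain ⟨l, rfl⟩ := Nat.exists_eq_add_of_le hmn
    rw [Nat.add_assoc]
    exact hω (l + k)
  have hunion : μ (⋃ n, S n) = 1 := by
    have : ∀ᵐ ω ∂μ, ω ∈ ⋃ n, S n := hτ.mono fun ω hω => by
      obtain ⟨n, hn⟩ := exists_strictlyPositive_of_tau_lt_top hω
      exact Set.mem_iUnion.mpr ⟨n, hn⟩
    have h : (⋃ n, S n) ∈ ae μ := this
    rw [measure_congr (eventuallyEq_univ.mpr h), measure_univ]
  have hT : MeasurableSet {ω | 0 < lo (φ₀ ω)} :=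
    measurableSet_lt measurable_const (continuous_lo.measurable.comp hφ₀)
  have hle : ∀ n, μ (S n) ≤ μ {ω | 0 < lo (φ₀ ω)} := fun n => by
    rw [← (measurePreserving_shift hθ ((n : ℤ) + 1)).measure_preimage hT.nullMeasurableSet]
    refine measure_mono fun ω hω => ?_
    exact lo_pos_of_nonvanishing_adj hD (hpos _)
      (nonvanishing_adj_of_comp hD (isPositiveMap_Phi hpos n ω) (hω 1))
  have h1 : 1 ≤ μ {ω | 0 < lo (φ₀ ω)} := by
    rw [← hunion]
    exact le_of_tendsto' (tendsto_measure_iUnion_atTop hmono) hle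
  have h2 : ∀ᵐ ω ∂μ, 0 < lo (φ₀ ω) :=
    (prob_compl_eq_zero_iff hT).mpr (le_antisymm prob_le_one h1)
  refine ae_all_iff.mpr fun k => ?_
  filter_upwards [(measurePreserving_shift hθ k).quasiMeasurePreserving.ae h2] with ω hω
  exact nonvanishing_adj_of_lo_pos hω

/-- The contraction coefficients tend to zero: their infimum `g` satisfies `g ≤ c_n (g ∘ θ^n)`, so
it is invariant, hence a constant `C` with `C ≤ c_n C` where `c_n < 1` eventually. -/
lemma ae_tendsto_contr (hθ : Ergodic θ μ) (hD : 1 ≤ D) (hφ₀ : Measurable φ₀)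
    (hpos : ∀ ω, IsPositiveMap (φ₀ ω)) (hτ : ∀ᵐ ω ∂μ, tau θ φ₀ ω < ⊤) :
    ∀ᵐ ω ∂μ, Tendsto (fun n => contr (Phi θ φ₀ n ω)) atTop (𝓝 0) := by
  have hmp := hθ.toMeasurePreserving
  have hreg := ae_regular hmp hD hφ₀ hpos hτ
  have hbdd : ∀ ω, BddBelow (Set.range fun n => contr (Phi θ φ₀ n ω)) := fun ω =>
    ⟨0, by rintro _ ⟨n, rfl⟩; exact contr_nonneg _⟩
  set g : Ω → ℝ := fun ω => ⨅ n, contr (Phi θ φ₀ n ω) with hg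
  have hgm : Measurable g := Measurable.iInf fun n =>
    measurable_contr.comp (measurable_Phi hφ₀ hmp n)
  have hg0 : ∀ ω, 0 ≤ g ω := fun ω => le_ciInf fun n => contr_nonneg _
  have hg1 : ∀ ω, g ω ≤ 1 := fun ω => (ciInf_le (hbdd ω) 0).trans (contr_le_one _)
  have hsub : ∀ᵐ ω ∂μ, ∀ n : ℕ, g ω ≤ contr (Phi θ φ₀ n ω) * g (shift θ n ω) := by
    filter_upwards [hreg] with ω hω n
    rw [hg, Real.mul_iInf_of_nonneg (contr_nonneg _)]
    exact le_ciInf fun m => (ciInf_le (hbdd ω) (n + m)).trans (contr_Phi_add_le hpos hω n m)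
  have hgi : Integrable g μ := Integrable.of_bound hgm.aestronglyMeasurable 1
    (Eventually.of_forall fun ω => by rw [Real.norm_of_nonneg (hg0 ω)]; exact hg1 ω)
  -- The functions `g ≤ g ∘ θ` have equal integrals, so they agree almost surely.
  have hinv : g ∘ θ =ᵐ[μ] g := by
    have hle : g ≤ᵐ[μ] g ∘ θ := by
      filter_upwards [hsub] with ω hω
      have := hω 1
      rw [Nat.cast_one, shift_one] at this
      exact this.trans (mul_le_of_le_one_left (hg0 _) (contr_le_one _))
    have hi : Integrable (g ∘ θ) μ := hmp.integrable_comp_of_integrable hgi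
    refine ((integral_eq_iff_of_ae_le hgi hi hle).mp ?_).symm
    exact (hmp.integral_comp θ.measurableEmbedding g).symm
  obtain ⟨C, hC⟩ := hθ.ae_eq_const_of_ae_eq_comp_ae hgm.aestronglyMeasurable hinv
  have hCs : ∀ᵐ ω ∂μ, ∀ n : ℕ, g (shift θ n ω) = C := ae_all_iff.mpr fun n =>
    (measurePreserving_shift hmp n).quasiMeasurePreserving.ae hC
  filter_upwards [hreg, hsub, hCs, hτ] with ω h1 h2 h3 h4
  obtain ⟨n, hn⟩ := exists_strictlyPositive_of_tau_lt_top h4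
  have hc := contr_lt_one_of_isStrictlyPositive hD (hn 0)
  have h5 : g ω = C := by simpa using h3 0
  have h6 := h2 (n + 0)
  rw [h3, h5] at h6
  have h7 : C = 0 := by
    have h8 : 0 ≤ C := h5 ▸ hg0 ω
    nlinarith
  have := tendsto_atTop_ciInf (antitone_contr_Phi hpos h1) (hbdd ω)
  rw [← h7, ← h5]
  exact this

/-- The left Perron–Frobenius eigenmatrices converge, and the limit lies in every projective image
`Φ^{(n)*} · states`. -/
lemma ae_tendsto_leftPF (hθ : Ergodic θ μ) (hD : 1 ≤ D) (hφ₀ : Measurable φ₀)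
    (hpos : ∀ ω, IsPositiveMap (φ₀ ω)) (hτ : ∀ᵐ ω ∂μ, tau θ φ₀ ω < ⊤) :
    ∀ᵐ ω ∂μ, Tendsto (fun n => leftPF θ φ₀ n ω) atTop (𝓝 (Z₁ θ φ₀ ω)) ∧
      ∀ n, Z₁ θ φ₀ ω ∈ projRange (adj (Phi θ φ₀ n ω)) := by
  filter_upwards [ae_regular hθ.toMeasurePreserving hD hφ₀ hpos hτ,
    ae_tendsto_contr hθ hD hφ₀ hpos hτ, hτ] with ω h1 h2 h3
  obtain ⟨N, hN⟩ := exists_strictlyPositive_of_tau_lt_top h3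
  have hp := fun n => (isPositiveMap_Phi (θ := θ) hpos n ω).adj
  have hmem : ∀ᶠ n in atTop, leftPF θ φ₀ n ω ∈ projRange (adj (Phi θ φ₀ n ω)) := by
    filter_upwards [eventually_ge_atTop N] with n hn
    obtain ⟨k, rfl⟩ := Nat.exists_eq_add_of_le hn
    have hc : contr (adj (Phi θ φ₀ (N + k) ω)) < 1 := by
      rw [contr_adj]
      exact contr_lt_one_of_isStrictlyPositive hD (hN k)
    have hex := existsUnique_eigenstate hD (hp (N + k)) (h1.nonvanishing hpos _) hc
    have he : IsEigenstate (adj (Phi θ φ₀ (N + k) ω)) (leftPF θ φ₀ (N + k) ω) := by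
      rw [leftPF, perronFrobenius, dif_pos hex]
      exact hex.choose_spec.1
    exact ⟨_, he.1, (eigenstate_mem_projRange (hp _) (h1.nonvanishing hpos _) he).symm⟩
  obtain ⟨Z, hZ, hZr⟩ := exists_tendsto_of_projRange hp (h1.nonvanishing hpos)
    (fun m n hmn => projRange_Phi_antitone hpos h1 hmn) (by simpa only [contr_adj] using h2) hmem
  have e : Z₁ θ φ₀ ω = Z := hZ.limUnder_eq
  rw [e]
  exact ⟨hZ, hZr⟩

end DynamicsFacts

/-! ### Covariance inequalities under mixing -/

section Covariance

variable {Ω : Type*} {m₁ m₂ mΩ : MeasurableSpace Ω} {μ : Measure Ω}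

/-- The closed unit ball of `L^p`. -/
def LpBall (μ : Measure Ω) (p : ℝ) (X : Ω → ℝ) : Prop :=
  MemLp X (ENNReal.ofReal p) μ ∧ ∫ ω, |X ω| ^ p ∂μ ≤ 1

lemma integrable_abs_rpow {p : ℝ} (hp : 0 < p) {X : Ω → ℝ}
    (hX : MemLp X (ENNReal.ofReal p) μ) : Integrable (fun ω => |X ω| ^ p) μ := by
  have := hX.integrable_norm_rpow (by simpa using hp) ENNReal.ofReal_ne_top
  simpa [ENNReal.toReal_ofReal hp.le, Real.norm_eq_abs] using this

lemma memLp_of_integrable_abs_rpow {p : ℝ} (hp : 0 < p) {X : Ω → ℝ}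
    (hm : AEStronglyMeasurable X μ) (hX : Integrable (fun ω => |X ω| ^ p) μ) :
    MemLp X (ENNReal.ofReal p) μ := by
  rw [← integrable_norm_rpow_iff hm (by simpa using hp) ENNReal.ofReal_ne_top]
  simpa [ENNReal.toReal_ofReal hp.le, Real.norm_eq_abs] using hX

variable [IsProbabilityMeasure μ]

lemma memLp_two_of_memLp {p : ℝ} (hp : 2 ≤ p) {X : Ω → ℝ}
    (hX : MemLp X (ENNReal.ofReal p) μ) : MemLp X 2 μ :=
  hX.mono_exponent (by rw [← ENNReal.ofReal_ofNat]; exact ENNReal.ofReal_le_ofReal hp)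

lemma abs_le_rpow_add {p q : ℝ} (hpq : p.HolderConjugate q) (x : ℝ) :
    |x| ≤ |x| ^ p / p + 1 / q := by
  have := Real.young_inequality_of_nonneg (abs_nonneg x) zero_le_one hpq
  simpa using this

lemma rpow_sub_one_mul_le {p q : ℝ} (hpq : p.HolderConjugate q) {a b : ℝ} (ha : 0 ≤ a)
    (hb : 0 ≤ b) : a ^ (p - 1) * b ≤ a ^ p / q + b ^ p / p := by
  have := Real.young_inequality_of_nonneg hb (Real.rpow_nonneg ha (p - 1)) hpq
  rw [← Real.rpow_mul ha, hpq.sub_one_mul_conj] at this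
  linarith

lemma LpBall.integral_abs_le {p q : ℝ} (hpq : p.HolderConjugate q) (hp : 2 ≤ p) {X : Ω → ℝ}
    (hX : LpBall μ p X) : ∫ ω, |X ω| ∂μ ≤ 1 := by
  have hi := integrable_abs_rpow hpq.pos hX.1
  calc ∫ ω, |X ω| ∂μ ≤ ∫ ω, (|X ω| ^ p / p + 1 / q) ∂μ :=
        integral_mono ((memLp_two_of_memLp hp hX.1).integrable one_le_two).abs
          ((hi.div_const p).add (integrable_const _)) fun ω => abs_le_rpow_add hpq (X ω)
    _ = (∫ ω, |X ω| ^ p ∂μ) / p + 1 / q := by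
        rw [integral_add (hi.div_const p) (integrable_const _), integral_div]
        simp
    _ ≤ 1 / p + 1 / q := by
        have := hpq.pos
        gcongr
        exact hX.2
    _ = 1 := by simpa using hpq.inv_add_inv_eq_one

lemma abs_covariance_le_integral {X Y : Ω → ℝ} (hX : MemLp X 2 μ) (hY : MemLp Y 2 μ) :
    |cov[X, Y; μ]| ≤ ∫ ω, |X ω| * |Y ω| ∂μ + (∫ ω, |X ω| ∂μ) * ∫ ω, |Y ω| ∂μ := by
  rw [covariance_eq_sub hX hY]
  refine (abs_sub _ _).trans (add_le_add ?_ ?_)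
  · refine abs_integral_le_integral_abs.trans (le_of_eq ?_)
    simp only [Pi.mul_apply, abs_mul]
  · rw [abs_mul]
    exact mul_le_mul abs_integral_le_integral_abs abs_integral_le_integral_abs (abs_nonneg _)
      (integral_nonneg fun _ => abs_nonneg _)

/-- A bounded `m₁`-measurable variable can be replaced by an indicator of an `m₁`-measurable set:
the set is the one where the conditional expectation of the centred `Y` is nonnegative. -/
lemma exists_set_abs_covariance_le (hm : m₁ ≤ mΩ) {X Y : Ω → ℝ} {a : ℝ}
    (hX : Measurable[m₁] X) (ha : ∀ ω, |X ω| ≤ a) (hY : MemLp Y 2 μ) :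
    ∃ A, MeasurableSet[m₁] A ∧
      |cov[X, Y; μ]| ≤ 2 * a * |cov[A.indicator fun _ => (1 : ℝ), Y; μ]| := by
  set Y₀ : Ω → ℝ := fun ω => Y ω - ∫ x, Y x ∂μ with hY₀
  have hYi : Integrable Y μ := hY.integrable one_le_two
  have hY₀2 : MemLp Y₀ 2 μ := hY.sub (memLp_const _)
  have hY₀i : Integrable Y₀ μ := hY₀2.integrable one_le_two
  have hY₀0 : ∫ ω, Y₀ ω ∂μ = 0 := by
    rw [hY₀, integral_sub hYi (integrable_const _)]
    simp
  have hcov : ∀ f : Ω → ℝ, MemLp f 2 μ → cov[f, Y; μ] = ∫ ω, f ω * Y₀ ω ∂μ := fun f hf => by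
    rw [← covariance_sub_const_right hYi (∫ x, Y x ∂μ), covariance_eq_sub hf hY₀2, hY₀0, mul_zero,
      sub_zero]
    rfl
  have hXm : Measurable X := hX.mono hm le_rfl
  have hX2 : MemLp X 2 μ := MemLp.of_bound hXm.aestronglyMeasurable a
    (Eventually.of_forall fun ω => by rw [Real.norm_eq_abs]; exact ha ω)
  set h : Ω → ℝ := μ[Y₀|m₁] with hh
  have hhm : StronglyMeasurable[m₁] h := stronglyMeasurable_condExp
  have hhi : Integrable h μ := integrable_condExp
  set A : Set Ω := {ω | 0 ≤ h ω} with hA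
  have hAm : MeasurableSet[m₁] A := hhm.measurable measurableSet_Ici
  have hAm' : MeasurableSet A := hm _ hAm
  refine ⟨A, hAm, ?_⟩
  have h1 : cov[X, Y; μ] = ∫ ω, X ω * h ω ∂μ := by
    rw [hcov X hX2, ← integral_condExp hm]
    refine integral_congr_ae ?_
    have hXY : Integrable (X * Y₀) μ := hX2.integrable_mul hY₀2
    exact condExp_mul_of_stronglyMeasurable_left hX.stronglyMeasurable hXY hY₀i
  have h2 : cov[A.indicator fun _ => (1 : ℝ), Y; μ] = ∫ ω in A, Y₀ ω ∂μ := by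
    rw [hcov _ (memLp_indicator_const 2 hAm' 1 (Or.inr (measure_ne_top μ A))),
      ← integral_indicator hAm']
    refine integral_congr_ae (Eventually.of_forall fun ω => ?_)
    by_cases hω : ω ∈ A <;> simp [hω]
  -- `h` has mean zero, so its positive and negative parts have equal integrals.
  have h3 : ∫ ω, |h ω| ∂μ = 2 * ∫ ω in A, Y₀ ω ∂μ := by
    rw [← integral_add_compl hAm' hhi.abs]
    have e1 : ∫ ω in A, |h ω| ∂μ = ∫ ω in A, Y₀ ω ∂μ := by
      rw [← setIntegral_condExp hm hY₀i hAm]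
      exact setIntegral_congr_fun hAm' fun ω hω => abs_of_nonneg hω
    have e2 : ∫ ω in Aᶜ, |h ω| ∂μ = -∫ ω in Aᶜ, Y₀ ω ∂μ := by
      rw [← setIntegral_condExp hm hY₀i hAm.compl, ← integral_neg]
      exact setIntegral_congr_fun hAm'.compl fun ω hω => abs_of_neg (not_le.mp hω)
    have e3 := integral_add_compl hAm' hY₀i
    rw [hY₀0] at e3
    rw [e1, e2]
    linarith
  have ha0 : ∀ ω, |X ω * h ω| ≤ a * |h ω| := fun ω => by
    rw [abs_mul]
    exact mul_le_mul_of_nonneg_right (ha ω) (abs_nonneg _)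
  calc |cov[X, Y; μ]| ≤ ∫ ω, |X ω * h ω| ∂μ := h1 ▸ abs_integral_le_integral_abs
    _ ≤ ∫ ω, a * |h ω| ∂μ := integral_mono_of_nonneg (Eventually.of_forall fun _ => abs_nonneg _)
        (hhi.abs.const_mul a) (Eventually.of_forall ha0)
    _ = 2 * a * ∫ ω in A, Y₀ ω ∂μ := by rw [integral_const_mul, h3]; ring
    _ ≤ _ := by
      rw [h2]
      have : 0 ≤ a := by
        obtain ⟨ω⟩ := nonempty_of_isProbabilityMeasure μ
        exact (abs_nonneg _).trans (ha ω)
      exact mul_le_mul_of_nonneg_left (le_abs_self _) (by positivity)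

lemma covariance_indicator {A B : Set Ω} (hA : MeasurableSet A) (hB : MeasurableSet B) :
    cov[A.indicator fun _ => (1 : ℝ), B.indicator fun _ => (1 : ℝ); μ] =
      μ.real (A ∩ B) - μ.real A * μ.real B := by
  rw [covariance_eq_sub (memLp_indicator_const 2 hA 1 (Or.inr (measure_ne_top μ A)))
    (memLp_indicator_const 2 hB 1 (Or.inr (measure_ne_top μ B)))]
  have e : (A.indicator fun _ => (1 : ℝ)) * (B.indicator fun _ => (1 : ℝ)) =
      (A ∩ B).indicator fun _ => (1 : ℝ) := by
    ext ω
    by_cases h1 : ω ∈ A <;> by_cases h2 : ω ∈ B <;> simp [h1, h2]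
  rw [e, integral_indicator_const _ (hA.inter hB), integral_indicator_const _ hA,
    integral_indicator_const _ hB]
  simp

/-- Covariance inequality for bounded variables. -/
lemma abs_covariance_le_of_bounded (hm₁ : m₁ ≤ mΩ) (hm₂ : m₂ ≤ mΩ)
    {α : ℝ} (hα : ∀ A B, MeasurableSet[m₁] A → MeasurableSet[m₂] B →
      |μ.real (A ∩ B) - μ.real A * μ.real B| ≤ α) {X Y : Ω → ℝ} {a b : ℝ} (ha0 : 0 ≤ a)
    (hb0 : 0 ≤ b) (hX : Measurable[m₁] X) (ha : ∀ ω, |X ω| ≤ a) (hY : Measurable[m₂] Y)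
    (hb : ∀ ω, |Y ω| ≤ b) : |cov[X, Y; μ]| ≤ 4 * a * b * α := by
  have hY2 : MemLp Y 2 μ := MemLp.of_bound (hY.mono hm₂ le_rfl).aestronglyMeasurable b
    (Eventually.of_forall fun ω => by rw [Real.norm_eq_abs]; exact hb ω)
  obtain ⟨A, hA, h1⟩ := exists_set_abs_covariance_le hm₁ hX ha hY2
  obtain ⟨B, hB, h2⟩ := exists_set_abs_covariance_le hm₂ hY hb
    (memLp_indicator_const (μ := μ) 2 (hm₁ _ hA) (1 : ℝ) (Or.inr (measure_ne_top μ A)))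
  rw [covariance_comm, covariance_comm (B.indicator _),
    covariance_indicator (hm₁ _ hA) (hm₂ _ hB)] at h2
  calc |cov[X, Y; μ]| ≤ 2 * a * (2 * b * α) :=
        h1.trans (mul_le_mul_of_nonneg_left (h2.trans
          (mul_le_mul_of_nonneg_left (hα A B hA hB) (by positivity))) (by positivity))
    _ = 4 * a * b * α := by ring

/-- Truncation of a real number at level `T`. -/
def trunc (T x : ℝ) : ℝ := if |x| ≤ T then x else 0

lemma measurable_trunc (T : ℝ) : Measurable (trunc T) :=
  Measurable.ite (measurableSet_le measurable_norm measurable_const) measurable_id measurable_const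

lemma abs_trunc_le {T : ℝ} (hT : 0 ≤ T) (x : ℝ) : |trunc T x| ≤ T := by
  rw [trunc]
  split_ifs with h
  · exact h
  · simpa using hT

lemma abs_trunc_le_abs (T x : ℝ) : |trunc T x| ≤ |x| := by
  rw [trunc]
  split_ifs with h
  · exact le_rfl
  · simp

lemma abs_sub_trunc_le_abs (T x : ℝ) : |x - trunc T x| ≤ |x| := by
  rw [trunc]
  split_ifs with h
  · simp
  · simp

lemma abs_sub_trunc_le {T p : ℝ} (hT : 0 < T) (hp : 2 ≤ p) (x : ℝ) :
    |x - trunc T x| ≤ T ^ (2 - p) * |x| ^ (p - 1) := by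
  rw [trunc]
  split_ifs with h
  · simp only [sub_self, abs_zero]
    positivity
  · push Not at h
    have hx : 0 < |x| := hT.trans h
    rw [sub_zero]
    calc |x| = |x| ^ (2 - p) * |x| ^ (p - 1) := by
          rw [← Real.rpow_add hx]
          norm_num
      _ ≤ _ := mul_le_mul_of_nonneg_right
          (Real.rpow_le_rpow_of_nonpos hT h.le (by linarith)) (by positivity)

/-- The tail of one variable contributes at most `2 T^(2-p)` to the covariance. -/
lemma abs_covariance_tail_le {p q : ℝ} (hpq : p.HolderConjugate q) (hp : 2 ≤ p) {X Y Y' : Ω → ℝ}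
    (hX : LpBall μ p X) (hY : LpBall μ p Y) (hY'm : AEStronglyMeasurable Y' μ)
    (hY' : ∀ ω, |Y' ω| ≤ |Y ω|) {T : ℝ} (hT : 0 < T) :
    |cov[fun ω => X ω - trunc T (X ω), Y'; μ]| ≤ 2 * T ^ (2 - p) := by
  have hX2 := memLp_two_of_memLp hp hX.1
  have hY2 := memLp_two_of_memLp hp hY.1
  have hXp := integrable_abs_rpow hpq.pos hX.1
  have hYp := integrable_abs_rpow hpq.pos hY.1
  have hpq1 : 1 / q + 1 / p = 1 := by simpa [add_comm] using hpq.inv_add_inv_eq_one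
  have hp0 := hpq.pos
  have hq0 := hpq.symm.pos
  have hT0 : 0 ≤ T ^ (2 - p) := by positivity
  have hY'2 : MemLp Y' 2 μ := hY2.mono hY'm (Eventually.of_forall hY')
  have htm : AEStronglyMeasurable (fun ω => X ω - trunc T (X ω)) μ :=
    hX2.1.sub ((measurable_trunc T).comp_aemeasurable hX2.1.aemeasurable).aestronglyMeasurable
  have ht2 : MemLp (fun ω => X ω - trunc T (X ω)) 2 μ :=
    hX2.mono htm (Eventually.of_forall fun ω => abs_sub_trunc_le_abs T (X ω))
  refine (abs_covariance_le_integral ht2 hY'2).trans ?_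
  have h1 : ∫ ω, |X ω - trunc T (X ω)| * |Y' ω| ∂μ ≤ T ^ (2 - p) := by
    calc _ ≤ ∫ ω, T ^ (2 - p) * (|X ω| ^ p / q + |Y ω| ^ p / p) ∂μ := by
          refine integral_mono_of_nonneg (Eventually.of_forall fun _ => by positivity)
            (((hXp.div_const q).add (hYp.div_const p)).const_mul _)
            (Eventually.of_forall fun ω => ?_)
          calc |X ω - trunc T (X ω)| * |Y' ω| ≤ (T ^ (2 - p) * |X ω| ^ (p - 1)) * |Y ω| :=
                mul_le_mul (abs_sub_trunc_le hT hp _) (hY' ω) (abs_nonneg _) (by positivity)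
            _ = T ^ (2 - p) * (|X ω| ^ (p - 1) * |Y ω|) := by ring
            _ ≤ _ := mul_le_mul_of_nonneg_left
                (rpow_sub_one_mul_le hpq (abs_nonneg _) (abs_nonneg _)) hT0
      _ = T ^ (2 - p) * ((∫ ω, |X ω| ^ p ∂μ) / q + (∫ ω, |Y ω| ^ p ∂μ) / p) := by
          rw [integral_const_mul, integral_add (hXp.div_const q) (hYp.div_const p), integral_div,
            integral_div]
      _ ≤ T ^ (2 - p) * (1 / q + 1 / p) := by
          gcongr
          · exact hX.2
          · exact hY.2
      _ = T ^ (2 - p) := by rw [hpq1, mul_one]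
  have h2 : ∫ ω, |X ω - trunc T (X ω)| ∂μ ≤ T ^ (2 - p) := by
    calc _ ≤ ∫ ω, T ^ (2 - p) * (|X ω| ^ p / q + 1 / p) ∂μ := by
          refine integral_mono_of_nonneg (Eventually.of_forall fun _ => abs_nonneg _)
            (((hXp.div_const q).add (integrable_const _)).const_mul _)
            (Eventually.of_forall fun ω => ?_)
          have h := rpow_sub_one_mul_le hpq (abs_nonneg (X ω)) zero_le_one
          rw [mul_one, Real.one_rpow] at h
          exact (abs_sub_trunc_le hT hp _).trans (mul_le_mul_of_nonneg_left h hT0)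
      _ = T ^ (2 - p) * ((∫ ω, |X ω| ^ p ∂μ) / q + 1 / p) := by
          rw [integral_const_mul, integral_add (hXp.div_const q) (integrable_const _), integral_div]
          simp
      _ ≤ T ^ (2 - p) * (1 / q + 1 / p) := by
          gcongr
          exact hX.2
      _ = T ^ (2 - p) := by rw [hpq1, mul_one]
  have h3 : ∫ ω, |Y' ω| ∂μ ≤ 1 :=
    (integral_mono (hY'2.integrable one_le_two).abs (hY2.integrable one_le_two).abs hY').trans
      (hY.integral_abs_le hpq hp)
  have h4 := mul_le_mul h2 h3 (integral_nonneg fun _ => abs_nonneg _) hT0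
  linarith

/-- Davydov's covariance inequality for the unit ball of `L^p`, by truncation at the level
`a ^ (-1 / p)`. -/
lemma abs_covariance_le_rpow (hm₁ : m₁ ≤ mΩ) (hm₂ : m₂ ≤ mΩ)
    {a : ℝ} (ha0 : 0 < a) (ha : ∀ A B, MeasurableSet[m₁] A → MeasurableSet[m₂] B →
      |μ.real (A ∩ B) - μ.real A * μ.real B| ≤ a) {p q : ℝ} (hpq : p.HolderConjugate q)
    (hp : 2 ≤ p) {X Y : Ω → ℝ} (hX : LpBall μ p X) (hY : LpBall μ p Y)
    (hXm : Measurable[m₁] X) (hYm : Measurable[m₂] Y) :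
    |cov[X, Y; μ]| ≤ 8 * a ^ ((p - 2) / p) := by
  have hp0 := hpq.pos
  -- This level balances the bounded part `4 T² a` with the tails `2 T ^ (2 - p)`.
  set T : ℝ := a ^ (-(1 / p)) with hT
  have hT0 : 0 < T := Real.rpow_pos_of_pos ha0 _
  have hTp : T ^ (2 - p) = a ^ ((p - 2) / p) := by
    rw [hT, ← Real.rpow_mul ha0.le]
    congr 1
    field_simp
    ring
  have hTa : T * T * a = a ^ ((p - 2) / p) := by
    calc T * T * a = a ^ (-(1 / p)) * a ^ (-(1 / p)) * a ^ (1 : ℝ) := by rw [hT, Real.rpow_one]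
      _ = _ := ?_
    rw [← Real.rpow_add ha0, ← Real.rpow_add ha0]
    congr 1
    field_simp
    ring
  have hX2 := memLp_two_of_memLp hp hX.1
  have hY2 := memLp_two_of_memLp hp hY.1
  have hXt : AEStronglyMeasurable (fun ω => trunc T (X ω)) μ :=
    ((measurable_trunc T).comp_aemeasurable hX2.1.aemeasurable).aestronglyMeasurable
  have hYt : AEStronglyMeasurable (fun ω => trunc T (Y ω)) μ :=
    ((measurable_trunc T).comp_aemeasurable hY2.1.aemeasurable).aestronglyMeasurable
  have hXt2 : MemLp (fun ω => trunc T (X ω)) 2 μ :=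
    hX2.mono hXt (Eventually.of_forall fun ω => abs_trunc_le_abs T (X ω))
  have hYt2 : MemLp (fun ω => trunc T (Y ω)) 2 μ :=
    hY2.mono hYt (Eventually.of_forall fun ω => abs_trunc_le_abs T (Y ω))
  have b1 := abs_covariance_le_of_bounded (μ := μ) hm₁ hm₂ ha hT0.le hT0.le
    ((measurable_trunc T).comp hXm) (fun ω => abs_trunc_le hT0.le (X ω))
    ((measurable_trunc T).comp hYm) (fun ω => abs_trunc_le hT0.le (Y ω))
  have b2 := abs_covariance_tail_le hpq hp hX hY hY2.1 (fun _ => le_rfl) hT0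
  have b3 := abs_covariance_tail_le hpq hp hY hX hXt (fun ω => abs_trunc_le_abs T (X ω)) hT0
  have e2 := covariance_fun_sub_left (μ := μ) hX2 hXt2 hY2
  have e3 := covariance_fun_sub_left (μ := μ) hY2 hYt2 hXt2
  rw [covariance_comm, covariance_comm (fun ω => trunc T (Y ω))] at e3
  rw [covariance_comm] at b3
  rw [hTp] at b2 b3
  have b1' : |cov[fun ω => trunc T (X ω), fun ω => trunc T (Y ω); μ]| ≤
      4 * a ^ ((p - 2) / p) := by
    refine b1.trans (le_of_eq ?_)
    rw [← hTa]
    ring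
  have e4 : cov[X, Y; μ] = cov[fun ω => trunc T (X ω), fun ω => trunc T (Y ω); μ] +
      cov[fun ω => X ω - trunc T (X ω), Y; μ] +
      cov[fun ω => trunc T (X ω), fun ω => Y ω - trunc T (Y ω); μ] := by
    rw [e2, e3, covariance_comm Y]
    ring
  rw [e4]
  refine (abs_add_le _ _).trans ?_
  have := abs_add_le (cov[fun ω => trunc T (X ω), fun ω => trunc T (Y ω); μ])
    (cov[fun ω => X ω - trunc T (X ω), Y; μ])
  linarith

lemma abs_covariance_le_sqrt_variance {X Y : Ω → ℝ} (hX : MemLp X 2 μ) (hY : MemLp Y 2 μ) :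
    |cov[X, Y; μ]| ≤ Real.sqrt (Var[X; μ]) * Real.sqrt (Var[Y; μ]) := by
  have hX₀ := hX.sub (memLp_const (∫ ω, X ω ∂μ))
  have hY₀ := hY.sub (memLp_const (∫ ω, Y ω ∂μ))
  have h := integral_mul_norm_le_Lp_mul_Lq (μ := μ) Real.HolderConjugate.two_two
    (by simpa using hX₀) (by simpa using hY₀)
  simp only [Real.rpow_two, Real.norm_eq_abs, sq_abs, ← Real.sqrt_eq_rpow, ← abs_mul,
    Pi.sub_apply] at h
  rw [variance_eq_integral hX.aemeasurable, variance_eq_integral hY.aemeasurable]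
  exact abs_integral_le_integral_abs.trans h

end Covariance

/-! ### Summability and duality -/

section SumsAndDuality

/-- A decreasing null sequence with `e (3m) ≤ e m ^ 2 + β m` and `∑ β < ∞` is summable: beyond the
index where `e ≤ 1/6` the partial sums satisfy `S (3M) ≤ C + S M / 2`. -/
lemma summable_of_antitone_of_le_sq_add {e β : ℕ → ℝ} (hanti : Antitone e) (h0 : ∀ m, 0 ≤ e m)
    (hlim : Tendsto e atTop (𝓝 0)) (hβ0 : ∀ m, 0 ≤ β m) (hβ : Summable β)
    (hrec : ∀ m, 1 ≤ m → e (3 * m) ≤ e m ^ 2 + β m) : Summable e := by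
  obtain ⟨N, hN⟩ := eventually_atTop.mp
    (hlim.eventually (gt_mem_nhds (show (0 : ℝ) < 1 / 6 by norm_num)))
  -- The second summand covers the finitely many `m` for which `e m < 1 / 6` is not known.
  set h : ℕ → ℝ := fun m => β m + if m < N + 1 then e 0 else 0 with hh
  have hh0 : ∀ m, 0 ≤ h m := fun m => by
    have := h0 0
    have := hβ0 m
    simp only [hh]
    split_ifs <;> linarith
  have hhs : Summable h := by
    refine hβ.add (summable_of_ne_finset_zero (s := Finset.range (N + 1)) fun m hm => ?_)
    rw [if_neg (by simpa using hm)]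
  have hstep : ∀ m, e (3 * m) ≤ e m / 6 + h m := fun m => by
    simp only [hh]
    have := h0 m
    have := hβ0 m
    split_ifs with hm
    · have := hanti (Nat.zero_le (3 * m))
      linarith
    · have h1 := hN m (by omega)
      have h2 := hrec m (by omega)
      nlinarith
  have hsum3 : ∀ M, ∑ n ∈ Finset.range (3 * M), e n ≤ 3 * ∑ m ∈ Finset.range M, e (3 * m) := by
    intro M
    induction M with
    | zero => simp
    | succ M ih =>
      rw [show 3 * (M + 1) = 3 * M + 1 + 1 + 1 by ring, Finset.sum_range_succ,
        Finset.sum_range_succ, Finset.sum_range_succ, Finset.sum_range_succ]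
      have h1 := hanti (show 3 * M ≤ 3 * M + 1 by omega)
      have h2 := hanti (show 3 * M ≤ 3 * M + 1 + 1 by omega)
      linarith
  have hmono : ∀ M, ∑ n ∈ Finset.range M, e n ≤ ∑ n ∈ Finset.range (3 * M), e n := fun M =>
    Finset.sum_le_sum_of_subset_of_nonneg (Finset.range_mono (by omega)) fun n _ _ => h0 n
  refine summable_of_sum_range_le (c := 6 * ∑' m, h m) h0 fun M => ?_
  have h1 : ∑ m ∈ Finset.range M, e (3 * m) ≤
      (∑ m ∈ Finset.range M, e m) / 6 + ∑' m, h m := by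
    calc _ ≤ ∑ m ∈ Finset.range M, (e m / 6 + h m) := Finset.sum_le_sum fun m _ => hstep m
      _ = (∑ m ∈ Finset.range M, e m) / 6 + ∑ m ∈ Finset.range M, h m := by
          rw [Finset.sum_add_distrib, Finset.sum_div]
      _ ≤ _ := by
          gcongr
          exact hhs.sum_le_tsum _ fun m _ => hh0 m
  have h2 := hsum3 M
  have h3 := hmono M
  linarith

lemma summable_comp_div_three {f : ℕ → ℝ} (h0 : ∀ m, 0 ≤ f m) (hf : Summable f) :
    Summable fun n => f (n / 3) := by
  have h3 : ∀ M, ∑ n ∈ Finset.range (3 * M), f (n / 3) = 3 * ∑ m ∈ Finset.range M, f m := by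
    intro M
    induction M with
    | zero => simp
    | succ M ih =>
      rw [show 3 * (M + 1) = 3 * M + 1 + 1 + 1 by ring, Finset.sum_range_succ,
        Finset.sum_range_succ, Finset.sum_range_succ, Finset.sum_range_succ, ih,
        show 3 * M / 3 = M by omega, show (3 * M + 1) / 3 = M by omega,
        show (3 * M + 1 + 1) / 3 = M by omega]
      ring
  refine summable_of_sum_range_le (c := 3 * ∑' m, f m) (fun n => h0 _) fun M => ?_
  calc ∑ n ∈ Finset.range M, f (n / 3) ≤ ∑ n ∈ Finset.range (3 * M), f (n / 3) :=
        Finset.sum_le_sum_of_subset_of_nonneg (Finset.range_mono (by omega)) fun n _ _ => h0 _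
    _ ≤ _ := by
        rw [h3]
        exact mul_le_mul_of_nonneg_left (hf.sum_le_tsum _ fun m _ => h0 m) (by norm_num)

variable {Ω : Type*} {m mΩ : MeasurableSpace Ω} {μ : Measure Ω} [IsProbabilityMeasure μ]

/-- Duality for conditional expectations: the `L^q` norm of `E[ξ | m]` is the supremum of `E[ξ W]`
over `m`-measurable `W` in the unit ball of `L^p`; the extremal `W` is a multiple of
`g |g|^(q-2)` with `g = E[ξ | m]`. -/
lemma eLpNorm_condExp_le_of_forall {p q : ℝ} (hpq : p.HolderConjugate q) (hp : 2 ≤ p)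
    (hm : m ≤ mΩ) {ξ : Ω → ℝ} (hξ : MemLp ξ (ENNReal.ofReal p) μ) {K : ℝ}
    (hK : ∀ W : Ω → ℝ, Measurable[m] W → LpBall μ p W → |∫ ω, ξ ω * W ω ∂μ| ≤ K) :
    eLpNorm (μ[ξ|m]) (ENNReal.ofReal q) μ ≤ ENNReal.ofReal K := by
  have hp0 := hpq.pos
  have hq0 := hpq.symm.pos
  have hq1 := hpq.symm.lt
  have hξ2 := memLp_two_of_memLp hp hξ
  have hξi : Integrable ξ μ := hξ2.integrable one_le_two
  set g : Ω → ℝ := μ[ξ|m] with hg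
  have hgm : StronglyMeasurable[m] g := stronglyMeasurable_condExp
  have hg2 : MemLp g 2 μ := hξ2.condExp one_le_two
  have hqp : q ≤ 2 := by
    have := hpq.inv_add_inv_eq_one
    have h1 : p⁻¹ ≤ 1 / 2 := by
      rw [one_div]
      exact inv_anti₀ two_pos hp
    have h2 : (1 / 2 : ℝ) ≤ q⁻¹ := by linarith
    have := (le_inv_comm₀ (by norm_num) hq0).mp h2
    norm_num at this
    exact this
  have hgq : MemLp g (ENNReal.ofReal q) μ := hg2.mono_exponent (by
    rw [← ENNReal.ofReal_ofNat]
    exact ENNReal.ofReal_le_ofReal hqp)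
  have hGi := integrable_abs_rpow hq0 hgq
  set G : ℝ := ∫ ω, |g ω| ^ q ∂μ with hG
  have hG0 : 0 ≤ G := integral_nonneg fun _ => by positivity
  have hnorm : eLpNorm g (ENNReal.ofReal q) μ = ENNReal.ofReal (G ^ q⁻¹) := by
    rw [hgq.eLpNorm_eq_integral_rpow_norm (by simpa using hq0) ENNReal.ofReal_ne_top,
      ENNReal.toReal_ofReal hq0.le]
    rfl
  rw [hnorm]
  refine ENNReal.ofReal_le_ofReal ?_
  rcases hG0.eq_or_lt with hz | hpos
  · rw [← hz, Real.zero_rpow (by positivity)]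
    refine (abs_nonneg _).trans (hK 0 measurable_const ⟨MemLp.zero, ?_⟩)
    simp [Real.zero_rpow hp0.ne']
  set c : ℝ := G ^ (-p⁻¹) with hc
  have hc0 : 0 < c := Real.rpow_pos_of_pos hpos _
  set W : Ω → ℝ := fun ω => g ω * |g ω| ^ (q - 2) * c with hW
  have hWm : Measurable[m] W := by
    have hgm' : Measurable[m] g := hgm.measurable
    exact (hgm'.mul ((measurable_norm.comp hgm').pow_const _)).mul_const c
  have hWabs : ∀ ω, |W ω| ^ p = |g ω| ^ q * c ^ p := fun ω => by
    have h1 : |W ω| = |g ω| ^ (q - 1) * c := by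
      simp only [hW]
      rw [abs_mul, abs_mul, abs_of_pos hc0, abs_of_nonneg (Real.rpow_nonneg (abs_nonneg _) _)]
      congr 1
      rcases (abs_nonneg (g ω)).eq_or_lt with h | h
      · rw [← h, zero_mul, Real.zero_rpow (by linarith)]
      · nth_rw 1 [← Real.rpow_one |g ω|]
        rw [← Real.rpow_add h]
        congr 1
        ring
    rw [h1, Real.mul_rpow (by positivity) hc0.le, ← Real.rpow_mul (abs_nonneg _),
      hpq.symm.sub_one_mul_conj]
  have hcp : G * c ^ p = 1 := by
    rw [hc, ← Real.rpow_mul hG0, neg_mul, inv_mul_cancel₀ hp0.ne', Real.rpow_neg_one,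
      mul_inv_cancel₀ hpos.ne']
  have hWball : LpBall μ p W := by
    refine ⟨memLp_of_integrable_abs_rpow hp0 (hWm.mono hm le_rfl).aestronglyMeasurable ?_, ?_⟩
    · simp only [hWabs]
      exact hGi.mul_const _
    · simp only [hWabs]
      rw [integral_mul_const, ← hG, hcp]
  have hW2 := memLp_two_of_memLp hp hWball.1
  have h1 : ∫ ω, ξ ω * W ω ∂μ = ∫ ω, g ω * W ω ∂μ := by
    rw [← integral_condExp hm]
    exact integral_congr_ae (condExp_mul_of_stronglyMeasurable_right hWm.stronglyMeasurable
      (hξ2.integrable_mul hW2) hξi)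
  have h2 : ∀ ω, g ω * W ω = |g ω| ^ q * c := fun ω => by
    simp only [hW]
    rw [← mul_assoc, ← mul_assoc]
    congr 1
    rcases (abs_nonneg (g ω)).eq_or_lt with h | h
    · rw [← h, Real.zero_rpow hq0.ne', abs_eq_zero.mp h.symm]
      simp
    · rw [← abs_mul_abs_self (g ω)]
      nth_rw 1 [← Real.rpow_one |g ω|]
      nth_rw 2 [← Real.rpow_one |g ω|]
      rw [← Real.rpow_add h, ← Real.rpow_add h]
      congr 1
      ring
  have h3 : ∫ ω, ξ ω * W ω ∂μ = G ^ q⁻¹ := by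
    rw [h1]
    simp only [h2]
    rw [integral_mul_const, ← hG, hc]
    nth_rw 1 [← Real.rpow_one G]
    rw [← Real.rpow_add hpos]
    congr 1
    linarith [hpq.inv_add_inv_eq_one]
  exact h3 ▸ (le_abs_self _).trans (hK W hWm hWball)

/-- Every function in `L^p` is a multiple of an element of the unit ball, with a scale that works
for all functions it dominates. -/
lemma exists_scale {p : ℝ} (hp : 1 ≤ p) {H : Ω → ℝ} (hH : MemLp H (ENNReal.ofReal p) μ) :
    ∃ κ : ℝ, 0 < κ ∧ ∀ f : Ω → ℝ, AEStronglyMeasurable f μ → (∀ᵐ ω ∂μ, |f ω| ≤ |H ω|) →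
      LpBall μ p fun ω => κ⁻¹ * f ω := by
  have hp0 : 0 < p := by linarith
  have hHi := integrable_abs_rpow hp0 hH
  have hI : 0 ≤ ∫ ω, |H ω| ^ p ∂μ := integral_nonneg fun _ => by positivity
  refine ⟨1 + ∫ ω, |H ω| ^ p ∂μ, by positivity, fun f hfm hf => ?_⟩
  set κ := 1 + ∫ ω, |H ω| ^ p ∂μ with hκ
  have hκ0 : 0 < κ := by positivity
  have hfp : MemLp f (ENNReal.ofReal p) μ := hH.mono hfm hf
  refine ⟨hfp.const_mul _, ?_⟩
  have hκp : (κ⁻¹) ^ p * κ ≤ 1 := by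
    rw [Real.inv_rpow hκ0.le, inv_mul_le_one₀ (Real.rpow_pos_of_pos hκ0 _)]
    exact Real.self_le_rpow_of_one_le (by linarith) hp
  calc ∫ ω, |κ⁻¹ * f ω| ^ p ∂μ = (κ⁻¹) ^ p * ∫ ω, |f ω| ^ p ∂μ := by
        rw [← integral_const_mul]
        refine integral_congr_ae (Eventually.of_forall fun ω => ?_)
        simp only
        rw [abs_mul, abs_of_pos (inv_pos.mpr hκ0),
          Real.mul_rpow (inv_nonneg.mpr hκ0.le) (abs_nonneg _)]
    _ ≤ (κ⁻¹) ^ p * κ := by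
        refine mul_le_mul_of_nonneg_left ?_ (by positivity)
        have := integral_mono_ae (integrable_abs_rpow hp0 hfp) hHi
          (hf.mono fun ω h => Real.rpow_le_rpow (abs_nonneg _) h hp0.le)
        linarith
    _ ≤ 1 := hκp

end SumsAndDuality

/-! ### Mixing bounds for the process -/

section MainEstimate

variable {Ω : Type*} [MeasurableSpace Ω] {D : ℕ} {μ : Measure Ω} [IsProbabilityMeasure μ]
  {θ : Ω ≃ᵐ Ω} {φ₀ : Ω → MapSpace D}

/-- The covariances of `L^p` variables of the past of `k` and the future of `n + k` are bounded by
`β n`, uniformly over the unit balls. Both mixing hypotheses are used through this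
inequality only. -/
def MixBound (μ : Measure Ω) (θ : Ω ≃ᵐ Ω) (φ₀ : Ω → MapSpace D) (p : ℝ) (β : ℕ → ℝ) : Prop :=
  ∀ n k : ℕ, 1 ≤ n → ∀ Y X : Ω → ℝ, Measurable[past θ φ₀ k] Y →
    Measurable[future θ φ₀ (n + k)] X → LpBall μ p Y → LpBall μ p X → |cov[Y, X; μ]| ≤ β n

lemma past_le (hθ : MeasurePreserving θ μ μ) (hφ₀ : Measurable φ₀) (n : ℤ) :
    past θ φ₀ n ≤ ‹MeasurableSpace Ω› :=
  iSup₂_le fun k _ => (measurable_proc hφ₀ hθ k).comap_le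

lemma future_le (hθ : MeasurePreserving θ μ μ) (hφ₀ : Measurable φ₀) (n : ℤ) :
    future θ φ₀ n ≤ ‹MeasurableSpace Ω› :=
  iSup₂_le fun k _ => (measurable_proc hφ₀ hθ k).comap_le

lemma measurable_proc_past {n k : ℤ} (h : k ≤ n) : Measurable[past θ φ₀ n] (proc θ φ₀ k) :=
  measurable_iff_comap_le.mpr (le_iSup₂_of_le k h le_rfl)

lemma measurable_proc_future {n k : ℤ} (h : n ≤ k) : Measurable[future θ φ₀ n] (proc θ φ₀ k) :=
  measurable_iff_comap_le.mpr (le_iSup₂_of_le k h le_rfl)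

lemma future_anti {m n : ℤ} (h : m ≤ n) : future θ φ₀ n ≤ future θ φ₀ m :=
  iSup₂_le fun k hk => le_iSup₂_of_le k (h.trans hk) le_rfl

lemma abs_measureReal_sub_le_one (A B : Set Ω) :
    |μ.real (A ∩ B) - μ.real A * μ.real B| ≤ 1 := by
  have h1 : μ.real (A ∩ B) ≤ 1 := measureReal_le_one
  have h2 : μ.real A ≤ 1 := measureReal_le_one
  have h3 : μ.real B ≤ 1 := measureReal_le_one
  have h4 : 0 ≤ μ.real (A ∩ B) := measureReal_nonneg
  have h5 : 0 ≤ μ.real A := measureReal_nonneg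
  have h6 : 0 ≤ μ.real B := measureReal_nonneg
  rw [abs_le]
  constructor <;> nlinarith [mul_nonneg h5 h6, mul_le_one₀ h2 h6 h3]

lemma le_alphaMix {n k : ℕ} {A B : Set Ω} (hA : MeasurableSet[past θ φ₀ k] A)
    (hB : MeasurableSet[future θ φ₀ (n + k)] B) :
    |μ.real (A ∩ B) - μ.real A * μ.real B| ≤ alphaMix μ θ φ₀ n :=
  le_csSup ⟨1, by rintro _ ⟨k, A, B, -, -, rfl⟩; exact abs_measureReal_sub_le_one A B⟩
    ⟨k, A, B, hA, hB, rfl⟩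

lemma alphaMix_nonneg (n : ℕ) : 0 ≤ alphaMix μ θ φ₀ n :=
  Real.sSup_nonneg (by rintro _ ⟨k, A, B, -, -, rfl⟩; exact abs_nonneg _)

lemma rhoMix_nonneg (n : ℕ) : 0 ≤ rhoMix μ θ φ₀ n :=
  Real.sSup_nonneg (by rintro _ ⟨k, X, Y, -, -, -, -, -, -, rfl⟩; exact abs_nonneg _)

/-- The extra summand `2⁻ⁿ` makes the coefficient positive, as the truncation level in
`abs_covariance_le_rpow` requires. -/
lemma mixBound_alphaMix (hθ : MeasurePreserving θ μ μ) (hφ₀ : Measurable φ₀) {p q : ℝ}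
    (hpq : p.HolderConjugate q) (hp : 2 ≤ p) :
    MixBound μ θ φ₀ p fun n => 8 * (alphaMix μ θ φ₀ n + (1 / 2) ^ n) ^ ((p - 2) / p) := by
  intro n k _ Y X hY hX hYb hXb
  have hpos : (0 : ℝ) < (1 / 2) ^ n := by positivity
  have h0 := alphaMix_nonneg (μ := μ) (θ := θ) (φ₀ := φ₀) n
  exact abs_covariance_le_rpow (past_le hθ hφ₀ k) (future_le hθ hφ₀ (n + k))
    (by linarith) (fun A B hA hB => (le_alphaMix hA hB).trans (by linarith)) hpq hp hYb hXb hY hX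

lemma summable_alphaMix_bound {p : ℝ} (hp : 2 < p)
    (h : Summable fun n : ℕ => alphaMix μ θ φ₀ (n + 1) ^ ((p - 2) / p)) :
    Summable fun n => 8 * (alphaMix μ θ φ₀ n + (1 / 2) ^ n) ^ ((p - 2) / p) := by
  have hr0 : 0 < (p - 2) / p := div_pos (by linarith) (by linarith)
  have hr1 : (p - 2) / p ≤ 1 := (div_le_one (by linarith)).mpr (by linarith)
  have h1 : Summable fun n : ℕ => alphaMix μ θ φ₀ n ^ ((p - 2) / p) :=
    (summable_nat_add_iff 1).mp h
  have h2 : Summable fun n : ℕ => (((1 / 2 : ℝ) ^ n) ^ ((p - 2) / p)) := by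
    have e : (fun n : ℕ => (((1 / 2 : ℝ) ^ n) ^ ((p - 2) / p))) =
        fun n : ℕ => ((1 / 2 : ℝ) ^ ((p - 2) / p)) ^ n := by
      funext n
      rw [← Real.rpow_natCast, ← Real.rpow_natCast, ← Real.rpow_mul (by norm_num),
        ← Real.rpow_mul (by norm_num), mul_comm]
    rw [e]
    exact summable_geometric_of_lt_one (by positivity)
      (Real.rpow_lt_one (by norm_num) (by norm_num) hr0)
  have h0 := alphaMix_nonneg (μ := μ) (θ := θ) (φ₀ := φ₀)
  refine Summable.mul_left 8 (Summable.of_nonneg_of_le (fun n => ?_) (fun n => ?_) (h1.add h2))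
  · have := h0 n
    positivity
  · exact Real.rpow_add_le_add_rpow (h0 n) (by positivity) hr0.le hr1

lemma mixBound_rhoMix : MixBound μ θ φ₀ 2 (rhoMix μ θ φ₀) := by
  intro n k _ Y X hY hX hYb hXb
  have hY2 := memLp_two_of_memLp le_rfl hYb.1
  have hX2 := memLp_two_of_memLp le_rfl hXb.1
  have hvar : ∀ {f : Ω → ℝ}, LpBall μ 2 f → Real.sqrt (Var[f; μ]) ≤ 1 := fun {f} hf => by
    have hf2 := memLp_two_of_memLp le_rfl hf.1
    refine Real.sqrt_le_one.mpr ((variance_le_expectation_sq hf2.1).trans ?_)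
    simpa using hf.2
  by_cases h0 : Var[X; μ] ≠ 0 ∧ Var[Y; μ] ≠ 0
  · have hs : ∀ {f : Ω → ℝ}, Var[f; μ] ≠ 0 → 0 < Real.sqrt (Var[f; μ]) := fun {f} hf =>
      Real.sqrt_pos.mpr (lt_of_le_of_ne (variance_nonneg f μ) hf.symm)
    have hpos := mul_pos (hs h0.2) (hs h0.1)
    have hb : ∀ {f g : Ω → ℝ}, MemLp f 2 μ → MemLp g 2 μ →
        |cov[f, g; μ] / (Real.sqrt (Var[f; μ]) * Real.sqrt (Var[g; μ]))| ≤ 1 :=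
      fun {f g} hf hg => by
        rw [abs_div, abs_of_nonneg (a := Real.sqrt (Var[f; μ]) * Real.sqrt (Var[g; μ]))
          (by positivity)]
        exact div_le_one_of_le₀ (abs_covariance_le_sqrt_variance hf hg) (by positivity)
    have h1 : |cov[Y, X; μ] / (Real.sqrt (Var[Y; μ]) * Real.sqrt (Var[X; μ]))| ≤
        rhoMix μ θ φ₀ n :=
      le_csSup ⟨1, by rintro _ ⟨k, X, Y, -, hY, -, hX, -, -, rfl⟩; exact hb hY hX⟩
        ⟨k, X, Y, hY, hY2, hX, hX2, h0.1, h0.2, rfl⟩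
    rw [abs_div, abs_of_pos hpos, div_le_iff₀ hpos] at h1
    exact h1.trans (mul_le_of_le_one_right (rhoMix_nonneg n)
      (mul_le_one₀ (hvar hYb) (Real.sqrt_nonneg _) (hvar hXb)))
  · have h1 := abs_covariance_le_sqrt_variance hY2 hX2
    have h2 : Real.sqrt (Var[Y; μ]) * Real.sqrt (Var[X; μ]) = 0 := by
      by_cases hX0 : Var[X; μ] = 0
      · simp [hX0]
      · have : Var[Y; μ] = 0 := by tauto
        simp [this]
    rw [h2] at h1
    exact h1.trans (rhoMix_nonneg n)

/-! ### Growth along the stationary direction and its finite-range approximations -/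

/-- `ln ‖φ_0*(X_n)‖`, where `X_n` is the projective image of the maximally mixed state
under `Φ^{(n)*}`; written through `Φ^{(n)}` so that measurability is visible. -/
def growth (θ : Ω ≃ᵐ Ω) (φ₀ : Ω → MapSpace D) (n : ℕ) (ω : Ω) : ℝ :=
  Real.log ((pair (mixed D) (Phi θ φ₀ n ω 1))⁻¹ *
    pair (mixed D) ((Phi θ φ₀ n ω).comp (φ₀ ω) 1))

lemma growth_eq (hD : 1 ≤ D) (n : ℕ) (ω : Ω) : growth θ φ₀ n ω =
    Real.log (pair 1 (adj (φ₀ ω) (proj (adj (Phi θ φ₀ n ω)) (mixed D)))) := by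
  have hm := mixed_mem_states hD
  rw [growth, proj, map_real_smul, pair_smul, pair_one_adj _ hm,
    ← ContinuousLinearMap.comp_apply, ← adj_comp, pair_one_adj _ hm]

/-- A measurable a priori bound for the logarithmic growth of `φ_0*` on states. -/
def logBound (φ₀ : Ω → MapSpace D) (ω : Ω) : ℝ :=
  |Real.log (lo (φ₀ ω))| + |Real.log (hi (φ₀ ω))|

lemma abs_log_le_of_mem_Icc {v x V : ℝ} (hv : 0 < v) (h1 : v ≤ x) (h2 : x ≤ V) :
    |Real.log x| ≤ |Real.log v| + |Real.log V| := by
  have e1 := Real.log_le_log hv h1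
  have e2 := Real.log_le_log (hv.trans_le h1) h2
  rw [abs_le]
  constructor
  · linarith [neg_abs_le (Real.log v), abs_nonneg (Real.log V)]
  · linarith [le_abs_self (Real.log V), abs_nonneg (Real.log v)]

lemma abs_log_le_logBound {ω : Ω} (hD : 1 ≤ D) (hp : IsPositiveMap (φ₀ ω))
    (hn : Nonvanishing (adj (φ₀ ω))) {A : Mat D} (hA : A ∈ states D) :
    |Real.log (pair 1 (adj (φ₀ ω) A))| ≤ logBound φ₀ ω :=
  abs_log_le_of_mem_Icc (lo_pos_of_nonvanishing_adj hD hp hn) (lo_le _ hA) (le_hi _ hA)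

lemma logNorm_zero_eq {ω : Ω} (hpos : ∀ ω, IsPositiveMap (φ₀ ω))
    (hZ : Z₁ θ φ₀ ω ∈ states D) :
    logNorm θ φ₀ 0 ω = Real.log (pair 1 (adj (φ₀ ω) (Z₁ θ φ₀ ω))) := by
  have e1 : Z θ φ₀ (0 + 1) ω = Z₁ θ φ₀ ω := by simp [Z]
  have e2 : proc θ φ₀ 0 ω = φ₀ ω := by simp [proc]
  rw [logNorm, e1, e2, traceNorm_of_posSemidef ((hpos ω).adj _ hZ.1), one_pair]

lemma measurable_growth {Ω : Type*} {m : MeasurableSpace Ω} [MeasurableSpace Ω] {D : ℕ}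
    {θ : Ω ≃ᵐ Ω} {φ₀ : Ω → MapSpace D} {n : ℕ}
    (h : ∀ k : ℤ, 0 ≤ k → k ≤ n → Measurable[m] (proc θ φ₀ k)) :
    Measurable[m] (growth θ φ₀ n) := by
  have h0 : Measurable[m] φ₀ := by
    have := h 0 le_rfl (by omega)
    have e : proc θ φ₀ 0 = φ₀ := funext fun ω => by simp [proc]
    rwa [e] at this
  have hP : Measurable[m] (Phi θ φ₀ n) := by
    have := measurable_Phi_shift (m := m) (θ := θ) (φ₀ := φ₀) (j := 0) (n := n)
      fun k h1 h2 => h k (by omega) (by omega)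
    simpa only [shift_zero] using this
  have hc := (continuous_pair_eval (mixed D) (1 : Mat D)).measurable
  exact Real.measurable_log.comp
    (((hc.comp hP).inv).mul (hc.comp (measurable_comp_mapSpace hP h0)))

lemma measurable_logBound {Ω : Type*} {m : MeasurableSpace Ω} {D : ℕ} {φ₀ : Ω → MapSpace D}
    (h : Measurable[m] φ₀) : Measurable[m] (logBound φ₀) :=
  (measurable_norm.comp (Real.measurable_log.comp (continuous_lo.measurable.comp h))).add
    (measurable_norm.comp (Real.measurable_log.comp (continuous_hi.measurable.comp h)))

lemma memLp_logBound (hD : 1 ≤ D) (hφ₀ : Measurable φ₀) (hpos : ∀ ω, IsPositiveMap (φ₀ ω))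
    (hn : ∀ᵐ ω ∂μ, Nonvanishing (adj (φ₀ ω))) {p : ℝ} (hL : LogMoments μ φ₀ p) :
    MemLp (logBound φ₀) (ENNReal.ofReal p) μ := by
  have h : MemLp (fun ω => ‖Real.log (lowerNorm (adj (φ₀ ω)))‖ +
      (‖Real.log (lowerNorm (adj (φ₀ ω)))‖ + ‖Real.log (opNorm (adj (φ₀ ω)))‖))
      (ENNReal.ofReal p) μ := hL.2.norm.add (hL.2.norm.add hL.1.norm)
  refine h.mono (measurable_logBound hφ₀).aestronglyMeasurable ?_
  filter_upwards [hn] with ω hω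
  have h1 := lo_pos_of_nonvanishing_adj hD (hpos ω) hω
  have h2 := (lo_le (φ₀ ω) (mixed_mem_states hD)).trans (le_hi (φ₀ ω) (mixed_mem_states hD))
  have h3 := abs_log_le_of_mem_Icc h1 h2 (hi_le_opNorm hD (hpos ω))
  rw [logBound, lowerNorm_adj (hpos ω)]
  simp only [Real.norm_eq_abs]
  refine (abs_of_nonneg (add_nonneg (abs_nonneg _) (abs_nonneg _))).le.trans
    (le_trans ?_ (le_abs_self _))
  linarith

/-- The approximation error of the growth is controlled by the contraction coefficient. -/
lemma abs_logNorm_sub_growth_le (hD : 1 ≤ D) (hpos : ∀ ω, IsPositiveMap (φ₀ ω)) {ω : Ω}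
    (hreg : Regular θ φ₀ ω) {n : ℕ} (hZ : Z₁ θ φ₀ ω ∈ projRange (adj (Phi θ φ₀ n ω))) :
    |logNorm θ φ₀ 0 ω - growth θ φ₀ n ω| ≤
      (6 + 4 * logBound φ₀ ω) * contr (Phi θ φ₀ n ω) := by
  have hP := (isPositiveMap_Phi (θ := θ) hpos n ω).adj
  have hN := hreg.nonvanishing hpos n
  have hn : Nonvanishing (adj (φ₀ ω)) := by
    have := hreg 0
    simpa [proc] using this
  have hs := projRange_subset_states hP hN
  have hmix : proj (adj (Phi θ φ₀ n ω)) (mixed D) ∈ projRange (adj (Phi θ φ₀ n ω)) :=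
    ⟨_, mixed_mem_states hD, rfl⟩
  rw [logNorm_zero_eq hpos (hs hZ), growth_eq hD, ← contr_adj]
  exact (comparable_projRange hP hN hZ hmix).abs_log_sub_le (hpos ω).adj hn (hs hZ) (hs hmix)
    (crossRatio_nonneg _) (crossRatio_le_one _) fun A hA => abs_log_le_logBound hD (hpos ω) hn hA

lemma lpBall_of_abs_le {p : ℝ} (hp : 0 < p) {f W : Ω → ℝ} (hf : AEStronglyMeasurable f μ)
    (hW : LpBall μ p W) (h : ∀ ω, |f ω| ≤ |W ω|) : LpBall μ p f := by
  have hfp : MemLp f (ENNReal.ofReal p) μ := hW.1.mono hf (Eventually.of_forall h)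
  refine ⟨hfp, (integral_mono (integrable_abs_rpow hp hfp) (integrable_abs_rpow hp hW.1)
    fun ω => Real.rpow_le_rpow (abs_nonneg _) (h ω) hp.le).trans hW.2⟩

lemma lpBall_one (p : ℝ) : LpBall μ p fun _ => (1 : ℝ) :=
  ⟨memLp_const 1, by simp⟩

/-- The mean contraction coefficient of `n` steps. -/
def meanContr (μ : Measure Ω) (θ : Ω ≃ᵐ Ω) (φ₀ : Ω → MapSpace D) (n : ℕ) : ℝ :=
  ∫ ω, contr (Phi θ φ₀ n ω) ∂μ

lemma measurable_contr_shift_past {j n : ℕ} {k : ℤ} (h : (j + n : ℤ) ≤ k) :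
    Measurable[past θ φ₀ k] fun ω => contr (Phi θ φ₀ n (shift θ j ω)) :=
  measurable_contr.comp (measurable_Phi_shift fun _ _ h2 => measurable_proc_past (by omega))

lemma measurable_contr_shift_future {j n : ℕ} {k : ℤ} (h : k ≤ j + 1) :
    Measurable[future θ φ₀ k] fun ω => contr (Phi θ φ₀ n (shift θ j ω)) :=
  measurable_contr.comp (measurable_Phi_shift fun _ h1 _ => measurable_proc_future (by omega))

lemma lpBall_contr_shift (hθ : MeasurePreserving θ μ μ) (hφ₀ : Measurable φ₀) {p : ℝ}
    (hp : 0 < p) (j : ℤ) (n : ℕ) : LpBall μ p fun ω => contr (Phi θ φ₀ n (shift θ j ω)) :=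
  lpBall_of_abs_le hp ((measurable_contr.comp ((measurable_Phi hφ₀ hθ n).comp
    (measurePreserving_shift hθ j).measurable)).aestronglyMeasurable) (lpBall_one p) fun ω => by
      rw [abs_of_nonneg (contr_nonneg _), abs_one]
      exact contr_le_one _

lemma integral_contr_shift (hθ : MeasurePreserving θ μ μ) (hφ₀ : Measurable φ₀) (j : ℤ) (n : ℕ) :
    ∫ ω, contr (Phi θ φ₀ n (shift θ j ω)) ∂μ = meanContr μ θ φ₀ n := by
  have hm : Measurable fun ω => contr (Phi θ φ₀ n ω) :=
    measurable_contr.comp (measurable_Phi hφ₀ hθ n)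
  have h := measurePreserving_shift hθ j
  rw [meanContr]
  nth_rw 2 [← h.map_eq]
  rw [integral_map h.measurable.aemeasurable hm.aestronglyMeasurable]

lemma meanContr_nonneg (n : ℕ) : 0 ≤ meanContr μ θ φ₀ n :=
  integral_nonneg fun _ => contr_nonneg _

variable {p q : ℝ} {β : ℕ → ℝ}

lemma integral_mul_eq_covariance_add {X Y : Ω → ℝ} (hX : MemLp X 2 μ) (hY : MemLp Y 2 μ) :
    ∫ ω, X ω * Y ω ∂μ = cov[X, Y; μ] + (∫ ω, X ω ∂μ) * ∫ ω, Y ω ∂μ := by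
  rw [covariance_eq_sub hX hY]
  simp

/-- Two blocks of length `m` separated by a gap of length `m` are almost independent. -/
lemma meanContr_three_mul_le (hθ : MeasurePreserving θ μ μ) (hφ₀ : Measurable φ₀)
    (hpos : ∀ ω, IsPositiveMap (φ₀ ω)) (hreg : ∀ᵐ ω ∂μ, Regular θ φ₀ ω) (hp : 2 ≤ p)
    (hmix : MixBound μ θ φ₀ p β) {m : ℕ} (hm : 1 ≤ m) :
    meanContr μ θ φ₀ (3 * m) ≤ meanContr μ θ φ₀ m ^ 2 + β m := by
  have hp0 : 0 < p := by linarith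
  have hY := lpBall_contr_shift hθ hφ₀ hp0 0 m
  have hX := lpBall_contr_shift hθ hφ₀ hp0 ((2 * m : ℕ) : ℤ) m
  have hY2 := memLp_two_of_memLp hp hY.1
  have hX2 := memLp_two_of_memLp hp hX.1
  have h1 := hmix m m hm _ _
    (measurable_contr_shift_past (θ := θ) (φ₀ := φ₀) (j := 0) (n := m) (by simp))
    (measurable_contr_shift_future (θ := θ) (φ₀ := φ₀) (j := 2 * m) (n := m)
      (by push_cast; omega)) hY hX
  have h2 := integral_mul_eq_covariance_add hY2 hX2
  rw [integral_contr_shift hθ hφ₀, integral_contr_shift hθ hφ₀] at h2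
  have h3 : meanContr μ θ φ₀ (3 * m) ≤ ∫ ω, contr (Phi θ φ₀ m (shift θ 0 ω)) *
      contr (Phi θ φ₀ m (shift θ ((2 * m : ℕ) : ℤ) ω)) ∂μ := by
    refine integral_mono_of_nonneg (Eventually.of_forall fun ω => contr_nonneg _)
      (hY2.integrable_mul hX2) ?_
    filter_upwards [hreg] with ω hω
    simp only [shift_zero]
    rw [show 3 * m = m + (m + m) by ring]
    have e1 := contr_Phi_add_le hpos hω m (m + m)
    have e2 := contr_Phi_add_le hpos (hω.shift m) m m
    rw [shift_shift, show ((m : ℤ) + m) = ((2 * m : ℕ) : ℤ) by push_cast; ring] at e2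
    refine e1.trans (mul_le_mul_of_nonneg_left (e2.trans ?_) (contr_nonneg _))
    exact mul_le_of_le_one_left (contr_nonneg _) (contr_le_one _)
  have h4 := (le_abs_self _).trans h1
  rw [h2] at h3
  simp only [Nat.cast_zero] at h4
  nlinarith

lemma summable_meanContr (hθ : Ergodic θ μ) (hD : 1 ≤ D) (hφ₀ : Measurable φ₀)
    (hpos : ∀ ω, IsPositiveMap (φ₀ ω)) (hτ : ∀ᵐ ω ∂μ, tau θ φ₀ ω < ⊤) (hp : 2 ≤ p)
    (hβ0 : ∀ n, 0 ≤ β n) (hβ : Summable β) (hmix : MixBound μ θ φ₀ p β) :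
    Summable (meanContr μ θ φ₀) := by
  have hmp := hθ.toMeasurePreserving
  have hreg := ae_regular hmp hD hφ₀ hpos hτ
  have hm : ∀ n, AEStronglyMeasurable (fun ω => contr (Phi θ φ₀ n ω)) μ := fun n =>
    (measurable_contr.comp (measurable_Phi hφ₀ hmp n)).aestronglyMeasurable
  have hb : ∀ n ω, ‖contr (Phi θ φ₀ n ω)‖ ≤ 1 := fun n ω => by
    rw [Real.norm_of_nonneg (contr_nonneg _)]
    exact contr_le_one _
  have hi : ∀ n, Integrable (fun ω => contr (Phi θ φ₀ n ω)) μ := fun n =>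
    Integrable.of_bound (hm n) 1 (Eventually.of_forall (hb n))
  refine summable_of_antitone_of_le_sq_add (fun m n hmn => ?_) meanContr_nonneg ?_ hβ0 hβ
    fun m hm => meanContr_three_mul_le hmp hφ₀ hpos hreg hp hmix hm
  · exact integral_mono_ae (hi n) (hi m) (hreg.mono fun ω hω => antitone_contr_Phi hpos hω hmn)
  · have h := tendsto_integral_of_dominated_convergence (fun _ : Ω => (1 : ℝ)) hm
      (integrable_const _) (fun n => Eventually.of_forall (hb n))
      (ae_tendsto_contr hθ hD hφ₀ hpos hτ)
    simp only [integral_zero] at h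
    exact h

/-- The block `m + 1, …, 2m` separates `φ_0` from the future of `3m`: decoupling twice bounds the
weighted mean of its contraction coefficient. -/
lemma integral_mul_contr_mul_le (hθ : MeasurePreserving θ μ μ) (hφ₀ : Measurable φ₀)
    (hpq : p.HolderConjugate q) (hp : 2 ≤ p) (hmix : MixBound μ θ φ₀ p β) {m : ℕ} (hm : 1 ≤ m)
    {H W : Ω → ℝ} (hH0 : ∀ ω, 0 ≤ H ω) (hHm : Measurable[past θ φ₀ (0 : ℕ)] H)
    (hH : LpBall μ p H) (hW0 : ∀ ω, 0 ≤ W ω) (hWm : Measurable[future θ φ₀ (3 * m : ℕ)] W)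
    (hW : LpBall μ p W) :
    ∫ ω, H ω * (contr (Phi θ φ₀ m (shift θ m ω)) * W ω) ∂μ ≤
      meanContr μ θ φ₀ m + 2 * β m := by
  have hp0 : 0 < p := by linarith
  have hc := lpBall_contr_shift hθ hφ₀ hp0 m m
  have hcW : LpBall μ p fun ω => contr (Phi θ φ₀ m (shift θ m ω)) * W ω := by
    refine lpBall_of_abs_le hp0 (hc.1.1.mul hW.1.1) hW fun ω => ?_
    rw [abs_mul, abs_of_nonneg (contr_nonneg _)]
    exact mul_le_of_le_one_left (abs_nonneg _) (contr_le_one _)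
  have h1 : |cov[H, fun ω => contr (Phi θ φ₀ m (shift θ m ω)) * W ω; μ]| ≤ β m :=
    hmix m 0 hm H _ hHm (Measurable.mul
    ((measurable_contr_shift_future (θ := θ) (φ₀ := φ₀) (j := m) (n := m)
      (k := (m : ℤ) + (0 : ℕ)) (by simp)))
    (hWm.mono (future_anti (by push_cast; omega)) le_rfl)) hH hcW
  have h2 := hmix m (2 * m) hm _ W
    (measurable_contr_shift_past (θ := θ) (φ₀ := φ₀) (j := m) (n := m) (by push_cast; omega))
    (hWm.mono (future_anti (by push_cast; omega)) le_rfl) hc hW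
  have hH2 := memLp_two_of_memLp hp hH.1
  have hc2 := memLp_two_of_memLp hp hc.1
  have hW2 := memLp_two_of_memLp hp hW.1
  have hcW2 := memLp_two_of_memLp hp hcW.1
  have e1 := integral_mul_eq_covariance_add hH2 hcW2
  have e2 := integral_mul_eq_covariance_add hc2 hW2
  rw [integral_contr_shift hθ hφ₀] at e2
  have hle : ∀ {f : Ω → ℝ}, (∀ ω, 0 ≤ f ω) → LpBall μ p f → ∫ ω, f ω ∂μ ≤ 1 := fun {f} h0 hf => by
    have := hf.integral_abs_le hpq hp
    simpa only [abs_of_nonneg (h0 _)] using this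
  have i1 := hle hH0 hH
  have i2 := hle hW0 hW
  have i3 : 0 ≤ ∫ ω, H ω ∂μ := integral_nonneg hH0
  have i4 : 0 ≤ ∫ ω, W ω ∂μ := integral_nonneg hW0
  have i5 : 0 ≤ ∫ ω, contr (Phi θ φ₀ m (shift θ m ω)) * W ω ∂μ :=
    integral_nonneg fun ω => mul_nonneg (contr_nonneg _) (hW0 ω)
  have i6 := meanContr_nonneg (μ := μ) (θ := θ) (φ₀ := φ₀) m
  have j1 := (le_abs_self _).trans h1
  have j2 := (le_abs_self _).trans h2
  rw [e1]
  have k1 := mul_le_of_le_one_left i5 i1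
  have k2 := mul_le_of_le_one_right i6 i2
  linarith

/-- The integrable majorant of the approximation error of the growth. -/
def errorBound (φ₀ : Ω → MapSpace D) (ω : Ω) : ℝ := 6 + 4 * logBound φ₀ ω

lemma logBound_nonneg (ω : Ω) : 0 ≤ logBound φ₀ ω := add_nonneg (abs_nonneg _) (abs_nonneg _)

lemma errorBound_nonneg (ω : Ω) : 0 ≤ errorBound φ₀ ω := by
  have := logBound_nonneg (φ₀ := φ₀) ω
  rw [errorBound]
  linarith

lemma measurable_errorBound {Ω : Type*} {m : MeasurableSpace Ω} {D : ℕ} {φ₀ : Ω → MapSpace D}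
    (h : Measurable[m] φ₀) : Measurable[m] (errorBound φ₀) :=
  ((measurable_logBound h).const_mul 4).const_add 6

lemma abs_growth_le (hD : 1 ≤ D) (hpos : ∀ ω, IsPositiveMap (φ₀ ω)) {ω : Ω}
    (hreg : Regular θ φ₀ ω) (n : ℕ) : |growth θ φ₀ n ω| ≤ logBound φ₀ ω := by
  have hn : Nonvanishing (adj (φ₀ ω)) := by
    have := hreg 0
    simpa [proc] using this
  rw [growth_eq hD]
  exact abs_log_le_logBound hD (hpos ω) hn
    (proj_mem_states (isPositiveMap_Phi hpos n ω).adj (hreg.nonvanishing hpos n)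
      (mixed_mem_states hD))

/-- The growth is the almost sure limit of its finite-range approximations. -/
lemma aestronglyMeasurable_logNorm (hθ : Ergodic θ μ) (hD : 1 ≤ D) (hφ₀ : Measurable φ₀)
    (hpos : ∀ ω, IsPositiveMap (φ₀ ω)) (hτ : ∀ᵐ ω ∂μ, tau θ φ₀ ω < ⊤) :
    AEStronglyMeasurable (logNorm θ φ₀ 0) μ := by
  have hmp := hθ.toMeasurePreserving
  refine aestronglyMeasurable_of_tendsto_ae atTop (f := fun n => growth θ φ₀ n)
    (fun n => (measurable_growth (θ := θ) fun k _ _ =>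
      measurable_proc hφ₀ hmp k).aestronglyMeasurable) ?_
  filter_upwards [ae_regular hmp hD hφ₀ hpos hτ, ae_tendsto_contr hθ hD hφ₀ hpos hτ,
    ae_tendsto_leftPF hθ hD hφ₀ hpos hτ] with ω h1 h2 h3
  rw [tendsto_iff_norm_sub_tendsto_zero]
  refine squeeze_zero (fun n => norm_nonneg _) (fun n => ?_)
    (by simpa using h2.const_mul (errorBound φ₀ ω))
  rw [norm_sub_rev, Real.norm_eq_abs]
  exact abs_logNorm_sub_growth_le hD hpos h1 (h3.2 n)

lemma memLp_logNorm (hθ : Ergodic θ μ) (hD : 1 ≤ D) (hφ₀ : Measurable φ₀)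
    (hpos : ∀ ω, IsPositiveMap (φ₀ ω)) (hτ : ∀ᵐ ω ∂μ, tau θ φ₀ ω < ⊤)
    (hM : MemLp (logBound φ₀) (ENNReal.ofReal p) μ) :
    MemLp (logNorm θ φ₀ 0) (ENNReal.ofReal p) μ := by
  refine hM.mono (aestronglyMeasurable_logNorm hθ hD hφ₀ hpos hτ) ?_
  filter_upwards [ae_regular hθ.toMeasurePreserving hD hφ₀ hpos hτ,
    ae_tendsto_leftPF hθ hD hφ₀ hpos hτ] with ω h1 h3
  have hn : Nonvanishing (adj (φ₀ ω)) := by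
    have := h1 0
    simpa [proc] using this
  have hZ : Z₁ θ φ₀ ω ∈ states D := projRange_subset_states
    (isPositiveMap_Phi hpos 0 ω).adj (h1.nonvanishing hpos 0) (h3.2 0)
  rw [logNorm_zero_eq hpos hZ, Real.norm_eq_abs, Real.norm_of_nonneg (logBound_nonneg ω)]
  exact abs_log_le_logBound hD (hpos ω) hn hZ

lemma memLp_errorBound (hM : MemLp (logBound φ₀) (ENNReal.ofReal p) μ) :
    MemLp (errorBound φ₀) (ENNReal.ofReal p) μ := by
  have h1 : MemLp (fun _ : Ω => (6 : ℝ)) (ENNReal.ofReal p) μ := memLp_const 6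
  exact h1.add (hM.const_mul 4)

/-- An error bounded by `H` times the contraction coefficient of the block `m + 1, …, 2m` has
small covariance with the unit ball of the future of `3m`. -/
lemma abs_covariance_le_of_abs_le_contr (hθ : MeasurePreserving θ μ μ) (hφ₀ : Measurable φ₀)
    (hpq : p.HolderConjugate q) (hp : 2 ≤ p) (hmix : MixBound μ θ φ₀ p β) {m : ℕ} (hm : 1 ≤ m)
    {κ : ℝ} (hκ : 0 < κ) {H d W : Ω → ℝ} (hH0 : ∀ ω, 0 ≤ H ω)
    (hHm : Measurable[past θ φ₀ (0 : ℕ)] H) (hH : LpBall μ p fun ω => κ⁻¹ * H ω)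
    (hd2 : MemLp d 2 μ)
    (hd : ∀ᵐ ω ∂μ, |d ω| ≤ H ω * contr (Phi θ φ₀ m (shift θ m ω)))
    (hWm : Measurable[future θ φ₀ (3 * m : ℕ)] W) (hW : LpBall μ p W) :
    |cov[d, W; μ]| ≤ 2 * (κ * (meanContr μ θ φ₀ m + 2 * β m)) := by
  have hp0 : 0 < p := by linarith
  have hkey : ∀ V : Ω → ℝ, (∀ ω, 0 ≤ V ω) → Measurable[future θ φ₀ (3 * m : ℕ)] V →
      LpBall μ p V → ∫ ω, |d ω| * V ω ∂μ ≤ κ * (meanContr μ θ φ₀ m + 2 * β m) :=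
    fun V hV0 hVm hV => by
      have h := integral_mul_contr_mul_le hθ hφ₀ hpq hp hmix hm
        (fun ω => mul_nonneg (inv_nonneg.mpr hκ.le) (hH0 ω))
        (hHm.const_mul κ⁻¹) hH hV0 hVm hV
      have hc2 := memLp_two_of_memLp hp (lpBall_contr_shift hθ hφ₀ hp0 m m).1
      have hcV : MemLp (fun ω => contr (Phi θ φ₀ m (shift θ m ω)) * V ω) 2 μ := by
        refine (memLp_two_of_memLp hp hV.1).mono (hc2.1.mul hV.1.1)
          (Eventually.of_forall fun ω => ?_)
        rw [norm_mul, Real.norm_of_nonneg (contr_nonneg _)]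
        exact mul_le_of_le_one_left (norm_nonneg _) (contr_le_one _)
      have hi : Integrable (fun ω => κ * (κ⁻¹ * H ω *
          (contr (Phi θ φ₀ m (shift θ m ω)) * V ω))) μ :=
        ((memLp_two_of_memLp hp hH.1).integrable_mul hcV).const_mul κ
      calc ∫ ω, |d ω| * V ω ∂μ ≤ ∫ ω, κ * (κ⁻¹ * H ω *
            (contr (Phi θ φ₀ m (shift θ m ω)) * V ω)) ∂μ := by
            refine integral_mono_of_nonneg
              (Eventually.of_forall fun ω => mul_nonneg (abs_nonneg _) (hV0 ω)) hi ?_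
            filter_upwards [hd] with ω hω
            have e : κ * (κ⁻¹ * H ω * (contr (Phi θ φ₀ m (shift θ m ω)) * V ω)) =
                H ω * contr (Phi θ φ₀ m (shift θ m ω)) * V ω := by
              rw [mul_assoc κ⁻¹, mul_inv_cancel_left₀ hκ.ne', mul_assoc]
            rw [e]
            exact mul_le_mul_of_nonneg_right hω (hV0 ω)
        _ ≤ _ := by
            rw [integral_const_mul]
            exact mul_le_mul_of_nonneg_left h hκ.le
  have hWabs : LpBall μ p fun ω => |W ω| :=
    lpBall_of_abs_le hp0 hW.1.1.norm hW fun ω => (abs_abs (W ω)).le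
  have k1 := hkey (fun ω => |W ω|) (fun ω => abs_nonneg _) (measurable_norm.comp hWm) hWabs
  have k2 := hkey (fun _ => 1) (fun _ => zero_le_one) measurable_const (lpBall_one p)
  simp only [mul_one] at k2
  have k3 := hW.integral_abs_le hpq hp
  have k4 : 0 ≤ ∫ ω, |d ω| ∂μ := integral_nonneg fun _ => abs_nonneg _
  have k5 := mul_le_of_le_one_right k4 k3
  have := abs_covariance_le_integral hd2 (memLp_two_of_memLp hp hW.1)
  linarith

/-- Correlation of the growth with the future of `3m`: the approximation of range `2m` is decoupled
by the gap, and the error is the contraction coefficient of the block `m + 1, …, 2m`. -/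
lemma exists_abs_covariance_logNorm_le (hθ : Ergodic θ μ) (hD : 1 ≤ D) (hφ₀ : Measurable φ₀)
    (hpos : ∀ ω, IsPositiveMap (φ₀ ω)) (hτ : ∀ᵐ ω ∂μ, tau θ φ₀ ω < ⊤)
    (hpq : p.HolderConjugate q) (hp : 2 ≤ p) (hL : LogMoments μ φ₀ p)
    (hβ0 : ∀ n, 0 ≤ β n) (hmix : MixBound μ θ φ₀ p β) :
    ∃ K : ℝ, 0 ≤ K ∧ ∀ m : ℕ, 1 ≤ m → ∀ W : Ω → ℝ, Measurable[future θ φ₀ (3 * m : ℕ)] W →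
      LpBall μ p W → |cov[logNorm θ φ₀ 0, W; μ]| ≤ K * (meanContr μ θ φ₀ m + β m) := by
  have hmp := hθ.toMeasurePreserving
  have hp0 : 0 < p := by linarith
  have hreg := ae_regular hmp hD hφ₀ hpos hτ
  have hn : ∀ᵐ ω ∂μ, Nonvanishing (adj (φ₀ ω)) := hreg.mono fun ω h => by
    have := h 0
    simpa [proc] using this
  have hM := memLp_logBound hD hφ₀ hpos hn hL
  have hE := memLp_errorBound hM
  have hlam := memLp_logNorm hθ hD hφ₀ hpos hτ hM
  have hlam2 := memLp_two_of_memLp hp hlam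
  obtain ⟨κ, hκ, hscale⟩ := exists_scale (one_le_two.trans hp) hE
  refine ⟨5 * κ, mul_nonneg (by norm_num) hκ.le, fun m hm W hWm hW => ?_⟩
  have he0 := meanContr_nonneg (μ := μ) (θ := θ) (φ₀ := φ₀) m
  have hb0 := hβ0 m
  have hW2 := memLp_two_of_memLp hp hW.1
  have hφ₀past : Measurable[past θ φ₀ (0 : ℕ)] φ₀ := by
    have h := measurable_proc_past (θ := θ) (φ₀ := φ₀) (n := (0 : ℕ)) (k := 0) le_rfl
    have e : proc θ φ₀ 0 = φ₀ := funext fun ω => by simp [proc]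
    rwa [e] at h
  have hgm : Measurable[past θ φ₀ (2 * m : ℕ)] (growth θ φ₀ (2 * m)) :=
    measurable_growth fun k _ hk => measurable_proc_past hk
  have hgm' : AEStronglyMeasurable (growth θ φ₀ (2 * m)) μ :=
    (hgm.mono (past_le hmp hφ₀ _) le_rfl).aestronglyMeasurable
  have hg : LpBall μ p fun ω => κ⁻¹ * growth θ φ₀ (2 * m) ω := by
    refine hscale _ hgm' (hreg.mono fun ω h => ?_)
    refine (abs_growth_le hD hpos h _).trans (le_trans ?_ (le_abs_self _))
    rw [errorBound]
    linarith [logBound_nonneg (φ₀ := φ₀) ω]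
  have hgLp : MemLp (growth θ φ₀ (2 * m)) 2 μ := by
    have h := (memLp_two_of_memLp hp hg.1).const_mul κ
    have e : (fun ω => κ * (κ⁻¹ * growth θ φ₀ (2 * m) ω)) = growth θ φ₀ (2 * m) :=
      funext fun ω => by rw [mul_inv_cancel_left₀ hκ.ne']
    rwa [e] at h
  -- The approximation and `W` are separated by a gap of length `m`.
  have h1 : |cov[growth θ φ₀ (2 * m), W; μ]| ≤ κ * β m := by
    have h := hmix m (2 * m) hm _ W (hgm.const_mul κ⁻¹)
      (hWm.mono (future_anti (by push_cast; omega)) le_rfl) hg hW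
    rw [covariance_const_mul_left, abs_mul, abs_of_pos (inv_pos.mpr hκ),
      inv_mul_le_iff₀ hκ] at h
    exact h
  obtain ⟨d, hd⟩ : ∃ d : Ω → ℝ, d = fun ω => logNorm θ φ₀ 0 ω - growth θ φ₀ (2 * m) ω := ⟨_, rfl⟩
  have hd2 : MemLp d 2 μ := by
    rw [hd]
    exact hlam2.sub hgLp
  have hdle : ∀ᵐ ω ∂μ, |d ω| ≤ errorBound φ₀ ω * contr (Phi θ φ₀ m (shift θ m ω)) := by
    filter_upwards [hreg, ae_tendsto_leftPF hθ hD hφ₀ hpos hτ] with ω h2 h3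
    rw [hd]
    refine (abs_logNorm_sub_growth_le hD hpos h2 (h3.2 (2 * m))).trans
      (mul_le_mul_of_nonneg_left ?_ (errorBound_nonneg ω))
    rw [two_mul]
    exact (contr_Phi_add_le hpos h2 m m).trans
      (mul_le_of_le_one_left (contr_nonneg _) (contr_le_one _))
  have hEb : LpBall μ p fun ω => κ⁻¹ * errorBound φ₀ ω :=
    hscale _ hE.1 (Eventually.of_forall fun _ => le_rfl)
  have hEm : Measurable[past θ φ₀ (0 : ℕ)] (errorBound φ₀) := measurable_errorBound hφ₀past
  have h2 : |cov[d, W; μ]| ≤ 2 * (κ * (meanContr μ θ φ₀ m + 2 * β m)) :=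
    abs_covariance_le_of_abs_le_contr hmp hφ₀ hpq hp hmix hm hκ errorBound_nonneg hEm hEb hd2 hdle
      hWm hW
  have e : cov[logNorm θ φ₀ 0, W; μ] = cov[growth θ φ₀ (2 * m), W; μ] + cov[d, W; μ] := by
    rw [hd, covariance_fun_sub_left hlam2 hgLp hW2]
    ring
  rw [e]
  refine (abs_add_le _ _).trans ?_
  have := mul_nonneg hκ.le he0
  linarith

/-- Integrability and summability of the projections `E[ξ_0 | F^n]` under an abstract
summable mixing bound. -/
lemma memLp_xi_and_tsum_lt_top (hθ : Ergodic θ μ) (hD : 1 ≤ D) (hφ₀ : Measurable φ₀)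
    (hpos : ∀ ω, IsPositiveMap (φ₀ ω)) (hτ : ∀ᵐ ω ∂μ, tau θ φ₀ ω < ⊤)
    (hpq : p.HolderConjugate q) (hp : 2 ≤ p) (hL : LogMoments μ φ₀ p)
    (hβ0 : ∀ n, 0 ≤ β n) (hβ : Summable β) (hmix : MixBound μ θ φ₀ p β) :
    MemLp (xi μ θ φ₀ 0) (ENNReal.ofReal p) μ ∧
      ∑' n : ℕ, eLpNorm (μ[xi μ θ φ₀ 0 | future θ φ₀ ((n : ℤ) + 1)]) (ENNReal.ofReal q) μ < ⊤ := by
  have hmp := hθ.toMeasurePreserving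
  have hn : ∀ᵐ ω ∂μ, Nonvanishing (adj (φ₀ ω)) :=
    (ae_regular hmp hD hφ₀ hpos hτ).mono fun ω h => by
      have := h 0
      simpa [proc] using this
  have hlam := memLp_logNorm hθ hD hφ₀ hpos hτ (memLp_logBound hD hφ₀ hpos hn hL)
  have hlam2 := memLp_two_of_memLp hp hlam
  have hxi : MemLp (xi μ θ φ₀ 0) (ENNReal.ofReal p) μ := hlam.sub (memLp_const _)
  refine ⟨hxi, ?_⟩
  obtain ⟨K, hK, hcov⟩ := exists_abs_covariance_logNorm_le hθ hD hφ₀ hpos hτ hpq hp hL hβ0 hmix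
  have hxiW : ∀ W : Ω → ℝ, LpBall μ p W →
      ∫ ω, xi μ θ φ₀ 0 ω * W ω ∂μ = cov[logNorm θ φ₀ 0, W; μ] := fun W hW => by
    have hW2 := memLp_two_of_memLp hp hW.1
    have hi := hlam2.integrable_mul hW2
    rw [covariance_eq_sub hlam2 hW2, ← integral_const_mul, ← integral_sub hi
      ((hW2.integrable one_le_two).const_mul _)]
    refine integral_congr_ae (Eventually.of_forall fun ω => ?_)
    simp only [xi, Pi.mul_apply]
    ring
  set f : ℕ → ℝ := fun m => K * (meanContr μ θ φ₀ m + β m) with hf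
  have hf0 : ∀ m, 0 ≤ f m := fun m =>
    mul_nonneg hK (add_nonneg (meanContr_nonneg m) (hβ0 m))
  have hfs : Summable f :=
    ((summable_meanContr hθ hD hφ₀ hpos hτ hp hβ0 hβ hmix).add hβ).mul_left K
  set a : ℕ → ℝ≥0∞ := fun n =>
    eLpNorm (μ[xi μ θ φ₀ 0 | future θ φ₀ ((n : ℤ) + 1)]) (ENNReal.ofReal q) μ with ha
  -- `a n` belongs to `F^(n+1)`, and the gap `m = (n + 3) / 3` must be positive for `F^(n+3)`;
  -- the first two terms are therefore treated separately.
  have hle : ∀ n, a (n + 2) ≤ ENNReal.ofReal (f ((n + 3) / 3)) := fun n => by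
    refine eLpNorm_condExp_le_of_forall hpq hp (future_le hmp hφ₀ _) hxi fun W hWm hW => ?_
    rw [hxiW W hW]
    exact hcov ((n + 3) / 3) (by omega) W
      (hWm.mono (future_anti (by push_cast; omega)) le_rfl) hW
  have hfin : ∀ n, a n < ⊤ := fun n => by
    have h2 : MemLp (xi μ θ φ₀ 0) (ENNReal.ofReal q) μ := by
      refine hxi.mono_exponent (ENNReal.ofReal_le_ofReal ?_)
      have h1 := hpq.symm.lt
      have h2 := hpq.sub_one_mul_conj
      nlinarith
    refine (h2.condExp ?_).2
    rw [← ENNReal.ofReal_one]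
    exact ENNReal.ofReal_le_ofReal hpq.symm.lt.le
  have hs : Summable fun n => f ((n + 3) / 3) :=
    (summable_nat_add_iff (f := fun n => f (n / 3)) 3).mpr (summable_comp_div_three hf0 hfs)
  have htail : ∑' n, a (n + 2) < ⊤ := by
    refine (ENNReal.tsum_le_tsum hle).trans_lt ?_
    rw [← ENNReal.ofReal_tsum_of_nonneg (fun n => hf0 _) hs]
    exact ENNReal.ofReal_lt_top
  rw [← (ENNReal.summable (f := fun n => a (n + 2))).sum_add_tsum_nat_add' ]
  exact ENNReal.add_lt_top.mpr ⟨ENNReal.sum_lt_top.mpr fun n _ => hfin n, htail⟩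

end MainEstimate

end QProc

end

theorem theorem3 {Ω : Type*} [MeasurableSpace Ω] (μ : Measure Ω) [IsProbabilityMeasure μ]
    (θ : Ω ≃ᵐ Ω) (hθ : Ergodic θ μ) (D : ℕ) (hD : 1 ≤ D)
    (φ₀ : Ω → QProc.MapSpace D) (hφ₀ : Measurable φ₀)
    (hpos : ∀ ω, QProc.IsPositiveMap (φ₀ ω))
    (hτ : ∀ᵐ ω ∂μ, QProc.tau θ φ₀ ω < ⊤) :
    (∀ᵐ ω ∂μ, Tendsto (fun n : ℕ => QProc.leftPF θ φ₀ n ω) atTop (𝓝 (QProc.Z₁ θ φ₀ ω))) ∧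
    (∀ p q : ℝ, 2 < p → p.HolderConjugate q → QProc.LogMoments μ φ₀ p →
      Summable (fun n : ℕ => QProc.alphaMix μ θ φ₀ (n + 1) ^ ((p - 2) / p)) →
      MemLp (QProc.xi μ θ φ₀ 0) (ENNReal.ofReal p) μ ∧
      ∑' n : ℕ, eLpNorm (μ[QProc.xi μ θ φ₀ 0 | QProc.future θ φ₀ ((n : ℤ) + 1)])
        (ENNReal.ofReal q) μ < ⊤) ∧
    (QProc.LogMoments μ φ₀ 2 →
      Summable (fun n : ℕ => QProc.rhoMix μ θ φ₀ (n + 1)) →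
      MemLp (QProc.xi μ θ φ₀ 0) 2 μ ∧
      ∑' n : ℕ, eLpNorm (μ[QProc.xi μ θ φ₀ 0 | QProc.future θ φ₀ ((n : ℤ) + 1)]) 2 μ < ⊤) := by
  refine ⟨(QProc.ae_tendsto_leftPF hθ hD hφ₀ hpos hτ).mono fun ω h => h.1, ?_, ?_⟩
  · intro p q hp hpq hL hα
    refine QProc.memLp_xi_and_tsum_lt_top hθ hD hφ₀ hpos hτ hpq hp.le hL (fun n => ?_)
      (QProc.summable_alphaMix_bound hp hα)
      (QProc.mixBound_alphaMix hθ.toMeasurePreserving hφ₀ hpq hp.le)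
    have := QProc.alphaMix_nonneg (μ := μ) (θ := θ) (φ₀ := φ₀) n
    positivity
  · intro hL hρ
    have h := QProc.memLp_xi_and_tsum_lt_top hθ hD hφ₀ hpos hτ Real.HolderConjugate.two_two
      le_rfl hL QProc.rhoMix_nonneg ((summable_nat_add_iff 1).mp hρ) QProc.mixBound_rhoMix
    simpa only [ENNReal.ofReal_ofNat] using h
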